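/- **Setting.** Let $I\subseteq\mathbb R$ be a nonempty open interval, $m\ge 0$ an integer, and $C:I\to M_m(\mathbb R)$ a smooth matrix function with $\operatorname{tr}C(x)=0$ for all $x\in I$. Consider the linear system $\mathbf y''=C(x)\mathbf y$, $\mathbf y\in\mathbb R^m$. *Equivalence transformations* over an open interval $J$ are the changes $\tilde x=\varphi(x)$, $\tilde{\mathbf y}=\psi(x)P\mathbf y$, where $P$ is a constant nonsingular matrix, $\varphi,\psi$ are smooth on $J$, $\varphi'$ and $\psi$ have no zeros, and $\varphi''/\varphi'=2\psi'/\psi$; two systems are *equivalent* if such a change turns the solutions of one exactly into the solutions of the other. A system is *reducible* if it is equivalent (i) to a system that has a proper subsystem of fewer dimension (for some proper nonempty set $S$ of indices, the equations for $y_i''$, $i\in S$, contain only the unknowns $y_j$, $j\in S$), or (ii) to a linear system with a constant matrix; otherwise it is *irreducible*. An *admitted generator* is a smooth vector field on $I\times\mathbb R^m$ whose second prolongation annihilates $\mathbf y''-C(x)\mathbf y$ on $\mathbf y''=C(x)\mathbf y$. The *trivial* ones are $c\,\mathbf y\cdot\nabla+\mathbf h(x)\cdot\nabla$ with $c\in\mathbb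 R$ and $\mathbf h''=C\mathbf h$. Put $$X_1=x(x\partial_x+\mathbf y\cdot\nabla),\quad X_2=2x\partial_x+\mathbf y\cdot\nabla,\quad X_3=\partial_x,\quad X_A=(A\mathbf y)\cdot\nabla ,$$ where $A$ is a constant real $m\times m$ matrix, and let $E$ be the unit matrix. **Theorem.** Suppose that the system is irreducible; for (a)–(c) it is enough that it is not equivalent to a system with a constant matrix. (a) Suppose the system admits on $I$ one of the generators $X=X_2+X_A$, $X=X_3+X_A$, $X=X_1+X_3+X_A$. Then over every nonempty open subinterval $J\subseteq I$ on which the coefficient of $\partial_x$ in $X$ has no zero, the system is equivalent to a system with matrix $$\tilde C(\tilde x)=e^{\tilde xA'}C_0e^{-\tilde xA'},\qquad C_0A'-A'C_0\ne0,$$ for some constant matrices $A',C_0$, by a transformation that maps $X$ to the admitted generator $\partial_{\tilde x}+(A'\tilde{\mathbf y})\cdot\tilde\nabla$ of the new system. (b) If the span of $X_2+X_{A_2}$, $X_3+X_{A_3}$ is a Lie algebra of admitted generators, then there is a constant matrix $C_0$ with $$C(x)=e^{xA_3}C_0e^{-xA_3}\quad(x\in I),\qquad A_2A_3-A_3(A_2+2E)=0,$$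 $$A_2C_0-C_0(A_2+4E)=0,\qquad \operatorname{tr}C_0=0,\qquad A_3C_0-C_0A_3\neq0 .$$ (c) If the span of $X_1+X_{A_1}$, $X_2+X_{A_2}$, $X_3+X_{A_3}$ is a Lie algebra of admitted generators, then there is a constant matrix $C_0$ with $C(x)=e^{xA_3}C_0e^{-xA_3}$ on $I$ and $$A_1A_2-A_2A_1=2A_1,\qquad A_1A_3-A_3A_1=A_2,\qquad A_2A_3-A_3A_2=2A_3,$$ $$A_2C_0-C_0(A_2+4E)=0,\qquad C_0A_1-A_1C_0=0,\qquad \operatorname{tr}C_0=0,\qquad A_3C_0-C_0A_3\ne0 .$$ In particular, if the system is irreducible, $m$ is odd and the system admits a nontrivial generator on $I$, then over some nonempty open subinterval $J\subseteq I$ it is equivalent to a system whose matrix has the form in (a), (b) or (c), by a transformation under which the Lie algebra of all generators admitted on $I$ corresponds, up to trivial generators, to the Lie algebra spanned by $X_3+X_{A}$ (with $A=A'$ in (a)), by $X_2+X_{A_2},\,X_3+X_{A_3}$, or by $X_1+X_{A_1},\,X_2+X_{A_2},\,X_3+X_{A_3}$, respectively, which the new system admits. -/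

import Mathlib

open scoped Matrix ContDiff

noncomputable section

/-- The space `ℝ × ℝᵐ` of the independent variable `x` and the dependent variables `y`. -/
abbrev BaseSpace (m : ℕ) : Type := ℝ × (Fin m → ℝ)

/-- A vector field `a(x,y) ∂ₓ + η(x,y)·∇`, written as `(x, y) ↦ (a(x,y), η(x,y))`. -/
abbrev PointField (m : ℕ) : Type := BaseSpace m → BaseSpace m

/-- `u` solves the linear system `y'' = C(x) y` on `I` (`w` is the derivative of `u`). -/
def IsSolution {m : ℕ} (I : Set ℝ) (C : ℝ → Matrix (Fin m) (Fin m) ℝ) (u : ℝ → Fin m → ℝ) : Prop :=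
  ∃ w : ℝ → Fin m → ℝ, ∀ x ∈ I, HasDerivAt u (w x) x ∧ HasDerivAt w (C x *ᵥ u x) x

/-! ## Equivalence transformations and irreducibility -/

/-- An equivalence transformation `x̃ = φ(x)`, `ỹ = ψ(x) P y` over the interval `J`, where `P` is a
constant nonsingular matrix and `φ'' / φ' = 2 ψ' / ψ`. (A shift of `y` by a solution does not
change the matrix of a homogeneous linear system, and is therefore not needed.) -/
structure EquivTransf (m : ℕ) (J : Set ℝ) where
  φ : ℝ → ℝ
  ψ : ℝ → ℝ
  P : GL (Fin m) ℝ
  smooth_φ : ContDiffOn ℝ ∞ φ J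
  smooth_ψ : ContDiffOn ℝ ∞ ψ J
  deriv_φ_ne : ∀ x ∈ J, deriv φ x ≠ 0
  ψ_ne : ∀ x ∈ J, ψ x ≠ 0
  compat : ∀ x ∈ J, deriv (deriv φ) x / deriv φ x = 2 * (deriv ψ x / ψ x)

/-- The change of variables `(x, y) ↦ (φ(x), ψ(x) P y)`. -/
def EquivTransf.toMap {m : ℕ} {J : Set ℝ} (T : EquivTransf m J) : BaseSpace m → BaseSpace m :=
  fun z => (T.φ z.1, T.ψ z.1 • ((T.P : Matrix (Fin m) (Fin m) ℝ) *ᵥ z.2))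

/-- The transformation `T` turns the system `y'' = C(x) y` on `J` into the system
`ỹ'' = C̃(x̃) ỹ` on `φ(J)`: a curve `y = u(x)` solves the first system if and only if its image
`ỹ = v(x̃)` solves the second one. -/
def EquivTransf.Carries {m : ℕ} {J : Set ℝ} (T : EquivTransf m J)
    (C C' : ℝ → Matrix (Fin m) (Fin m) ℝ) : Prop :=
  ∀ u v : ℝ → Fin m → ℝ, (∀ x ∈ J, (T.φ x, v (T.φ x)) = T.toMap (x, u x)) →
    (IsSolution J C u ↔ IsSolution (T.φ '' J) C' v)

/-- The transformation `T` maps the vector field `X` over `J` to the vector field `X'` over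
`φ(J)`. -/
def EquivTransf.Pushes {m : ℕ} {J : Set ℝ} (T : EquivTransf m J) (X X' : PointField m) : Prop :=
  ∀ x ∈ J, ∀ y : Fin m → ℝ,
    fderiv ℝ T.toMap (x, y) (X (x, y)) = X' (T.toMap (x, y))

/-- The system is equivalent to a linear system with a constant matrix. -/
def ReducesToConstant {m : ℕ} (I : Set ℝ) (C : ℝ → Matrix (Fin m) (Fin m) ℝ) : Prop :=
  ∃ (T : EquivTransf m I) (K : Matrix (Fin m) (Fin m) ℝ), T.Carries C (fun _ => K)

/-- The system is equivalent to a system with a proper subsystem of fewer dimension: for some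
proper nonempty set `S` of indices, the equations for `yᵢ''`, `i ∈ S`, contain only the unknowns
`yⱼ`, `j ∈ S`. -/
def ReducesToSubsystem {m : ℕ} (I : Set ℝ) (C : ℝ → Matrix (Fin m) (Fin m) ℝ) : Prop :=
  ∃ (T : EquivTransf m I) (C' : ℝ → Matrix (Fin m) (Fin m) ℝ), T.Carries C C' ∧
    ∃ S : Finset (Fin m), S.Nonempty ∧ S ≠ Finset.univ ∧
      ∀ x ∈ T.φ '' I, ∀ i ∈ S, ∀ j ∉ S, C' x i j = 0

/-- Irreducible systems: those that are not reducible in either of the two ways. -/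
def IsIrreducibleSystem {m : ℕ} (I : Set ℝ) (C : ℝ → Matrix (Fin m) (Fin m) ℝ) : Prop :=
  ¬ ReducesToSubsystem I C ∧ ¬ ReducesToConstant I C

/-! ## Admitted generators -/

/-- Coefficient of `∂_{y'}` in the first prolongation of `X = a ∂ₓ + η·∇`, at `(x, y, y') = (x, y, p)`:
`Dₓη - p Dₓa`, where `Dₓ = ∂ₓ + p·∇`. -/
def prolong₁ {m : ℕ} (X : PointField m) (j : ℝ × (Fin m → ℝ) × (Fin m → ℝ)) : Fin m → ℝ :=
  fderiv ℝ (fun z => (X z).2) (j.1, j.2.1) (1, j.2.2) -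
    fderiv ℝ (fun z => (X z).1) (j.1, j.2.1) (1, j.2.2) • j.2.2

/-- Coefficient of `∂_{y''}` in the second prolongation of `X`, at `(x, y, y', y'') = (x, y, p, q)`:
`Dₓη¹ - q Dₓa`, where `η¹` is the coefficient of `∂_{y'}`. -/
def prolong₂ {m : ℕ} (X : PointField m) (x : ℝ) (y p q : Fin m → ℝ) : Fin m → ℝ :=
  fderiv ℝ (prolong₁ X) (x, y, p) (1, p, q) -
    fderiv ℝ (fun z => (X z).1) (x, y) (1, p) • q

/-- The system `y'' = C(x) y` on `I` admits the generator `X` (a smooth vector field on `I × ℝᵐ`):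
the second prolongation of `X` annihilates `y'' - C(x) y` wherever `y'' = C(x) y`. -/
def Admits {m : ℕ} (I : Set ℝ) (C : ℝ → Matrix (Fin m) (Fin m) ℝ) (X : PointField m) : Prop :=
  ContDiffOn ℝ ∞ X (I ×ˢ Set.univ) ∧
    ∀ x ∈ I, ∀ y p : Fin m → ℝ,
      prolong₂ X x y p (C x *ᵥ y) -
        fderiv ℝ (fun z : BaseSpace m => C z.1 *ᵥ z.2) (x, y) (X (x, y)) = 0

/-- Trivial generators: the combinations `c y·∇ + h(x)·∇` with `h'' = C h`. -/
def IsTrivialGenerator {m : ℕ} (I : Set ℝ) (C : ℝ → Matrix (Fin m) (Fin m) ℝ)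
    (X : PointField m) : Prop :=
  ∃ (c : ℝ) (h : ℝ → Fin m → ℝ), IsSolution I C h ∧
    ∀ x ∈ I, ∀ y : Fin m → ℝ, X (x, y) = (0, c • y + h x)

/-- `L` is a Lie algebra of vector fields admitted by the system. -/
def AdmitsLieAlgebra {m : ℕ} (I : Set ℝ) (C : ℝ → Matrix (Fin m) (Fin m) ℝ)
    (L : Submodule ℝ (PointField m)) : Prop :=
  (∀ X ∈ L, Admits I C X) ∧ ∀ X ∈ L, ∀ Y ∈ L, VectorField.lieBracket ℝ X Y ∈ L

/-- `X₁ = x (x ∂ₓ + y·∇)`. -/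
def genX₁ (m : ℕ) : PointField m := fun z => (z.1 ^ 2, z.1 • z.2)

/-- `X₂ = 2x ∂ₓ + y·∇`. -/
def genX₂ (m : ℕ) : PointField m := fun z => (2 * z.1, z.2)

/-- `X₃ = ∂ₓ`. -/
def genX₃ (m : ℕ) : PointField m := fun _ => (1, 0)

/-- `X_A = (A y)·∇`. -/
def genXA {m : ℕ} (A : Matrix (Fin m) (Fin m) ℝ) : PointField m := fun z => (0, A *ᵥ z.2)

/-! ## The three canonical cases -/

/-- `C(x) = e^{xA} C₀ e^{-xA}` for all `x ∈ J`. -/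
def HasExpForm {m : ℕ} (J : Set ℝ) (C : ℝ → Matrix (Fin m) (Fin m) ℝ)
    (A C₀ : Matrix (Fin m) (Fin m) ℝ) : Prop :=
  ∀ x ∈ J, C x = NormedSpace.exp (x • A) * C₀ * NormedSpace.exp (-(x • A))

/-- Case (a). -/
def CaseA {m : ℕ} (J : Set ℝ) (C : ℝ → Matrix (Fin m) (Fin m) ℝ)
    (A C₀ : Matrix (Fin m) (Fin m) ℝ) : Prop :=
  HasExpForm J C A C₀ ∧ C₀ * A - A * C₀ ≠ 0

/-- Case (b). -/
def CaseB {m : ℕ} (J : Set ℝ) (C : ℝ → Matrix (Fin m) (Fin m) ℝ)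
    (A₂ A₃ C₀ : Matrix (Fin m) (Fin m) ℝ) : Prop :=
  HasExpForm J C A₃ C₀ ∧
    A₂ * A₃ - A₃ * (A₂ + (2 : ℝ) • (1 : Matrix (Fin m) (Fin m) ℝ)) = 0 ∧
    A₂ * C₀ - C₀ * (A₂ + (4 : ℝ) • (1 : Matrix (Fin m) (Fin m) ℝ)) = 0 ∧
    C₀.trace = 0 ∧ A₃ * C₀ - C₀ * A₃ ≠ 0

/-- Case (c). -/
def CaseC {m : ℕ} (J : Set ℝ) (C : ℝ → Matrix (Fin m) (Fin m) ℝ)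
    (A₁ A₂ A₃ C₀ : Matrix (Fin m) (Fin m) ℝ) : Prop :=
  HasExpForm J C A₃ C₀ ∧
    A₁ * A₂ - A₂ * A₁ = (2 : ℝ) • A₁ ∧ A₁ * A₃ - A₃ * A₁ = A₂ ∧
    A₂ * A₃ - A₃ * A₂ = (2 : ℝ) • A₃ ∧
    A₂ * C₀ - C₀ * (A₂ + (4 : ℝ) • (1 : Matrix (Fin m) (Fin m) ℝ)) = 0 ∧
    C₀ * A₁ - A₁ * C₀ = 0 ∧ C₀.trace = 0 ∧ A₃ * C₀ - C₀ * A₃ ≠ 0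

/-- `T`, defined over `J ⊆ I`, turns the system into `ỹ'' = C'(x̃) ỹ` and, up to trivial
generators, it identifies the Lie algebra of all generators admitted by the system on `I` with the
Lie algebra `L` admitted by the new system. -/
def NormalizesTo {m : ℕ} (I : Set ℝ) {J : Set ℝ} (T : EquivTransf m J)
    (C C' : ℝ → Matrix (Fin m) (Fin m) ℝ) (L : Submodule ℝ (PointField m)) : Prop :=
  T.Carries C C' ∧ AdmitsLieAlgebra (T.φ '' J) C' L ∧
    (∀ Z ∈ L, ∃ Y : PointField m, Admits I C Y ∧ T.Pushes Y Z) ∧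
    ∀ Y : PointField m, Admits I C Y →
      ∃ Z ∈ L, ∃ Z₀ : PointField m, IsTrivialGenerator (T.φ '' J) C' Z₀ ∧ T.Pushes Y (Z + Z₀)

end

/-!
The determining equations of a point symmetry are polynomial in the velocity `p = y'`. Their
cubic and quadratic parts show that an admitted generator is projective in `y`
(`Admits.point_form`). For a nonzero system with `tr C = 0`, two traces of the linear part remove
the projective terms, and the trace of the constant part gives `a''' = 0`: up to a solution
`h(x)·∇`, every generator is `genField (a, A) = a ∂ₓ + ((a'/2) E + A) y·∇` with a quadratic
polynomial `a` and a constant matrix `A` subject to `a C' + 2 a' C + C A - A C = 0`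
(`Admits.exists_genField`, `admits_genField_iff`).

Where `a ≠ 0`, the substitution `φ' = 1/a`, `ψ = |a|^{-1/2}` takes such a generator to
`∂ₓ + (A y)·∇`, the system to one with matrix `a² C + (disc a)/4`, and the determining equation of
`a ∂ₓ + ⋯` to `C̃' = A C̃ - C̃ A`, whose solutions are `e^{xA} C₀ e^{-xA}` (`straighten_carries`,
`straighten_pushes`, `hasExpForm_of_hasDerivAt`). If `A` commutes with `C`, then `a² C` is constant
and the system is equivalent to a constant one (`reducesToConstant_of_isSymm_of_commute`). When `A`
is only known to commute with `C` on a subinterval, the commutation has to be propagated to all of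
`I`. For `a = 2x` this crosses the singular point `0` of an Euler equation; there smoothness of `C`
is used (`euler_eq_zero`). The relations in the two- and three-dimensional cases are the determining
equations of the dilation and of the projective field at `x = 0`, evaluated there by continuing
`e^{xA₃} C₀ e^{-xA₃}` to the whole line (`dilation_relation`, `projective_relation`).

For odd `m`, a matrix commuting with an irreducible system has a real eigenvalue and is therefore
scalar (`eq_smul_one_of_commute`). So a symmetry `(a, A)` with `tr A = 0` is determined by `a`, and
the generators modulo trivial ones form a subalgebra of the quadratic polynomials under
`a b' - a' b`, that is, of `sl₂(ℝ)`. Such a subalgebra is a line, a plane of polynomials with a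
common root, or everything (`quadBracket_subalgebra_classification`). Straightening the only
generator, the one with the double root, or `∂ₓ` itself gives the three normal forms.
-/

noncomputable section

open scoped Matrix.Norms.Operator

variable {m : ℕ}

/-! ### Matrix-valued functions of one variable -/

theorem contDiffOn_matrix_of_entries {C : ℝ → Matrix (Fin m) (Fin m) ℝ} {I : Set ℝ}
    (h : ∀ i j, ContDiffOn ℝ ∞ (fun t => C t i j) I) : ContDiffOn ℝ ∞ C I := by
  have h2 : ContDiffOn ℝ ∞ (fun t => ∑ i, ∑ j, C t i j • Matrix.single i j (1 : ℝ)) I :=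
    ContDiffOn.sum fun i _ => ContDiffOn.sum fun j _ => (h i j).smul contDiffOn_const
  refine h2.congr fun t _ => ?_
  conv_lhs => rw [Matrix.matrix_eq_sum_single (C t)]
  simp [Matrix.smul_single]

theorem ContDiffOn.hasDerivAt_deriv {F : Type*} [NormedAddCommGroup F] [NormedSpace ℝ F]
    {f : ℝ → F} {I : Set ℝ} (hI : IsOpen I) (hf : ContDiffOn ℝ ∞ f I) :
    ∀ x ∈ I, HasDerivAt f (deriv f x) x := fun x hx =>
  ((hf.contDiffAt (hI.mem_nhds hx)).differentiableAt (by simp)).hasDerivAt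

theorem ContDiffOn.deriv_infty {F : Type*} [NormedAddCommGroup F] [NormedSpace ℝ F]
    {f : ℝ → F} {I : Set ℝ} (hI : IsOpen I) (hf : ContDiffOn ℝ ∞ f I) :
    ContDiffOn ℝ ∞ (deriv f) I :=
  ((contDiffOn_infty_iff_deriv_of_isOpen hI).1 hf).2

theorem HasDerivAt.matrix_linear {C : ℝ → Matrix (Fin m) (Fin m) ℝ}
    {C₁ : Matrix (Fin m) (Fin m) ℝ} {x : ℝ} (h : HasDerivAt C C₁ x)
    {F : Type*} [NormedAddCommGroup F] [NormedSpace ℝ F]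
    (L : Matrix (Fin m) (Fin m) ℝ →ₗ[ℝ] F) : HasDerivAt (fun t => L (C t)) (L C₁) x :=
  (LinearMap.toContinuousLinearMap L).hasFDerivAt.comp_hasDerivAt x h

theorem HasDerivAt.matrix_mulVec {C : ℝ → Matrix (Fin m) (Fin m) ℝ}
    {C₁ : Matrix (Fin m) (Fin m) ℝ} {x : ℝ} (h : HasDerivAt C C₁ x)
    {u : ℝ → Fin m → ℝ} {u₁ : Fin m → ℝ} (hu : HasDerivAt u u₁ x) :
    HasDerivAt (fun t => C t *ᵥ u t) (C₁ *ᵥ u x + C x *ᵥ u₁) x := by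
  rw [hasDerivAt_pi] at hu ⊢
  intro i
  have h2 : HasDerivAt (fun t => ∑ j, C t i j * u t j)
      (∑ j, (C₁ i j * u x j + C x i j * u₁ j)) x := by
    refine HasDerivAt.fun_sum fun j _ => HasDerivAt.mul ?_ (hu j)
    exact h.matrix_linear (Matrix.entryLinearMap ℝ ℝ i j)
  simpa [Matrix.mulVec, dotProduct, Finset.sum_add_distrib] using h2

theorem HasDerivAt.mulVec_const {C : ℝ → Matrix (Fin m) (Fin m) ℝ}
    {C₁ : Matrix (Fin m) (Fin m) ℝ} {x : ℝ} (h : HasDerivAt C C₁ x) (y : Fin m → ℝ) :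
    HasDerivAt (fun t => C t *ᵥ y) (C₁ *ᵥ y) x := by
  simpa using h.matrix_mulVec (hasDerivAt_const x y)

theorem HasDerivAt.const_mulVec (A : Matrix (Fin m) (Fin m) ℝ) {x : ℝ}
    {u : ℝ → Fin m → ℝ} {u₁ : Fin m → ℝ} (hu : HasDerivAt u u₁ x) :
    HasDerivAt (fun t => A *ᵥ u t) (A *ᵥ u₁) x := by
  simpa using (hasDerivAt_const x A).matrix_mulVec hu

theorem hasDerivAt_matrix_trace {C : ℝ → Matrix (Fin m) (Fin m) ℝ}
    {C₁ : Matrix (Fin m) (Fin m) ℝ} {x : ℝ} (h : HasDerivAt C C₁ x) :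
    HasDerivAt (fun t => (C t).trace) C₁.trace x :=
  h.matrix_linear (Matrix.traceLinearMap (Fin m) ℝ ℝ)

theorem eqOn_of_hasDerivAt_zero {F : Type*} [NormedAddCommGroup F] [NormedSpace ℝ F]
    {U : Set ℝ} (hU : U.OrdConnected) {f : ℝ → F} (h : ∀ x ∈ U, HasDerivAt f 0 x)
    {x y : ℝ} (hx : x ∈ U) (hy : y ∈ U) : f x = f y := by
  have := (convex_iff_ordConnected.2 hU).norm_image_sub_le_of_norm_hasDerivWithin_le
    (f := f) (f' := fun _ => 0) (C := 0) (fun z hz => (h z hz).hasDerivWithinAt)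
    (fun z _ => by simp) hx hy
  simpa [sub_eq_zero, eq_comm] using this

/-! ### The equation `R' = A R - R A` -/

theorem exp_smul_mul_exp_neg_smul (A : Matrix (Fin m) (Fin m) ℝ) (x : ℝ) :
    NormedSpace.exp (x • A) * NormedSpace.exp (-(x • A)) = 1 := by
  rw [← Matrix.exp_add_of_commute _ _ (Commute.refl (x • A)).neg_right]
  simp

theorem exp_neg_smul_mul_exp_smul (A : Matrix (Fin m) (Fin m) ℝ) (x : ℝ) :
    NormedSpace.exp (-(x • A)) * NormedSpace.exp (x • A) = 1 := by
  rw [← Matrix.exp_add_of_commute _ _ (Commute.refl (x • A)).neg_left]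
  simp

theorem hasDerivAt_conj_exp (A C₀ : Matrix (Fin m) (Fin m) ℝ) (x : ℝ) :
    HasDerivAt (fun t : ℝ => NormedSpace.exp (t • A) * C₀ * NormedSpace.exp (-(t • A)))
      (A * (NormedSpace.exp (x • A) * C₀ * NormedSpace.exp (-(x • A))) -
        NormedSpace.exp (x • A) * C₀ * NormedSpace.exp (-(x • A)) * A) x := by
  have h1 : HasDerivAt (fun t : ℝ => NormedSpace.exp (t • A)) (A * NormedSpace.exp (x • A)) x :=
    hasDerivAt_exp_smul_const' A x
  have h2 : HasDerivAt (fun t : ℝ => NormedSpace.exp (t • (-A)))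
      (NormedSpace.exp (x • (-A)) * (-A)) x := hasDerivAt_exp_smul_const (-A) x
  simp only [smul_neg] at h2
  refine ((h1.mul_const C₀).mul h2).congr_deriv ?_
  noncomm_ring

theorem hasExpForm_of_hasDerivAt {U : Set ℝ} (hU : U.OrdConnected)
    {R : ℝ → Matrix (Fin m) (Fin m) ℝ} {A : Matrix (Fin m) (Fin m) ℝ}
    (h : ∀ x ∈ U, HasDerivAt R (A * R x - R x * A) x) {x₀ : ℝ} (hx₀ : x₀ ∈ U) :
    HasExpForm U R A (NormedSpace.exp (-(x₀ • A)) * R x₀ * NormedSpace.exp (x₀ • A)) := by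
  set S : ℝ → Matrix (Fin m) (Fin m) ℝ :=
    fun t => NormedSpace.exp (-(t • A)) * R t * NormedSpace.exp (t • A) with hS
  have hconst : ∀ x ∈ U, HasDerivAt S 0 x := by
    intro x hx
    have h1 : HasDerivAt (fun t : ℝ => NormedSpace.exp (t • A)) (A * NormedSpace.exp (x • A)) x :=
      hasDerivAt_exp_smul_const' A x
    have h2 : HasDerivAt (fun t : ℝ => NormedSpace.exp (t • (-A)))
        (NormedSpace.exp (x • (-A)) * (-A)) x := hasDerivAt_exp_smul_const (-A) x
    simp only [smul_neg] at h2
    refine ((h2.mul (h x hx)).mul h1).congr_deriv ?_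
    simp only [Pi.mul_apply]
    noncomm_ring
  intro x hx
  have h3 : S x = S x₀ := eqOn_of_hasDerivAt_zero hU hconst hx hx₀
  change R x = NormedSpace.exp (x • A) * S x₀ * NormedSpace.exp (-(x • A))
  rw [← h3]
  calc R x = (NormedSpace.exp (x • A) * NormedSpace.exp (-(x • A))) * R x *
        (NormedSpace.exp (x • A) * NormedSpace.exp (-(x • A))) := by
        rw [exp_smul_mul_exp_neg_smul]; simp
    _ = _ := by simp only [hS, mul_assoc]

/-- A solution of `R' = A R - R A` on an interval that vanishes at one point vanishes. -/
theorem eq_zero_of_hasDerivAt_conj {U : Set ℝ} (hU : U.OrdConnected)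
    {R : ℝ → Matrix (Fin m) (Fin m) ℝ} {A : Matrix (Fin m) (Fin m) ℝ}
    (h : ∀ x ∈ U, HasDerivAt R (A * R x - R x * A) x) {x₀ : ℝ} (hx₀ : x₀ ∈ U) (h0 : R x₀ = 0)
    {x : ℝ} (hx : x ∈ U) : R x = 0 := by
  rw [hasExpForm_of_hasDerivAt hU h hx₀ x hx, h0]
  simp

theorem commute_conj_exp_iff (A C₀ : Matrix (Fin m) (Fin m) ℝ) (x : ℝ) :
    A * (NormedSpace.exp (x • A) * C₀ * NormedSpace.exp (-(x • A))) =
      NormedSpace.exp (x • A) * C₀ * NormedSpace.exp (-(x • A)) * A ↔ A * C₀ = C₀ * A := by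
  have hA : Commute A (NormedSpace.exp (x • A)) := ((Commute.refl A).smul_right x).exp_right
  have hA' : Commute A (NormedSpace.exp (-(x • A))) :=
    ((Commute.refl A).smul_right x).neg_right.exp_right
  have e1 : A * (NormedSpace.exp (x • A) * C₀ * NormedSpace.exp (-(x • A))) =
      NormedSpace.exp (x • A) * (A * C₀) * NormedSpace.exp (-(x • A)) := by
    simp only [← mul_assoc, hA.eq]
  have e2 : NormedSpace.exp (x • A) * C₀ * NormedSpace.exp (-(x • A)) * A =
      NormedSpace.exp (x • A) * (C₀ * A) * NormedSpace.exp (-(x • A)) := by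
    simp only [mul_assoc, hA'.eq]
  rw [e1, e2]
  constructor
  · intro h
    have h2 := congrArg
      (fun M => NormedSpace.exp (-(x • A)) * M * NormedSpace.exp (x • A)) h
    have e3 : ∀ M : Matrix (Fin m) (Fin m) ℝ, NormedSpace.exp (-(x • A)) *
        (NormedSpace.exp (x • A) * M * NormedSpace.exp (-(x • A))) * NormedSpace.exp (x • A)
          = M := by
      intro M
      calc _ = (NormedSpace.exp (-(x • A)) * NormedSpace.exp (x • A)) * M *
            (NormedSpace.exp (-(x • A)) * NormedSpace.exp (x • A)) := by simp only [mul_assoc]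
        _ = M := by rw [exp_neg_smul_mul_exp_smul]; simp
    simpa only [e3] using h2
  · intro h; rw [h]

/-! ### Quadratic generators -/

/-- The quadratic polynomial `c₀ + c₁ x + c₂ x²` with coefficient triple `c`. -/
def quad (c : ℝ × ℝ × ℝ) (x : ℝ) : ℝ := c.1 + c.2.1 * x + c.2.2 * x ^ 2

/-- The derivative of `quad c`. -/
def quadDeriv (c : ℝ × ℝ × ℝ) (x : ℝ) : ℝ := c.2.1 + 2 * c.2.2 * x

/-- The coefficient triple of the Wronskian `a b' - a' b` of two quadratic polynomials. -/
def quadBracket (a b : ℝ × ℝ × ℝ) : ℝ × ℝ × ℝ :=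
  (a.1 * b.2.1 - a.2.1 * b.1, 2 * (a.1 * b.2.2 - a.2.2 * b.1), a.2.1 * b.2.2 - a.2.2 * b.2.1)

/-- The vector field `a ∂ₓ + ((a'/2) y + A y)·∇`, where `a` is the quadratic polynomial with
coefficients `g.1` and `A = g.2`. -/
def genField (g : (ℝ × ℝ × ℝ) × Matrix (Fin m) (Fin m) ℝ) : PointField m :=
  fun z => (quad g.1 z.1, (quadDeriv g.1 z.1 / 2) • z.2 + g.2 *ᵥ z.2)

/-- The determining equation `a C' + 2 a' C + C A - A C = 0` on `U` for the generator
`genField g`; the function `C₁` stands for the derivative of `C`. -/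
def IsSymm (U : Set ℝ) (C C₁ : ℝ → Matrix (Fin m) (Fin m) ℝ)
    (g : (ℝ × ℝ × ℝ) × Matrix (Fin m) (Fin m) ℝ) : Prop :=
  ∀ x ∈ U, quad g.1 x • C₁ x + (2 * quadDeriv g.1 x) • C x + (C x * g.2 - g.2 * C x) = 0

theorem hasDerivAt_quad (c : ℝ × ℝ × ℝ) (x : ℝ) : HasDerivAt (quad c) (quadDeriv c x) x := by
  have h := (((hasDerivAt_id x).const_mul c.2.1).const_add c.1).add
    (((hasDerivAt_id x).pow 2).const_mul c.2.2)
  refine h.congr_deriv ?_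
  simp [quadDeriv]
  ring

theorem hasDerivAt_quadDeriv (c : ℝ × ℝ × ℝ) (x : ℝ) :
    HasDerivAt (quadDeriv c) (2 * c.2.2) x := by
  have h := ((hasDerivAt_id x).const_mul (2 * c.2.2)).const_add c.2.1
  refine h.congr_deriv ?_
  simp

theorem quad_add (a b : ℝ × ℝ × ℝ) (x : ℝ) : quad (a + b) x = quad a x + quad b x := by
  simp [quad]; ring

theorem quad_smul (r : ℝ) (a : ℝ × ℝ × ℝ) (x : ℝ) : quad (r • a) x = r * quad a x := by
  simp [quad]; ring

theorem quadDeriv_add (a b : ℝ × ℝ × ℝ) (x : ℝ) :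
    quadDeriv (a + b) x = quadDeriv a x + quadDeriv b x := by
  simp [quadDeriv]; ring

theorem quadDeriv_smul (r : ℝ) (a : ℝ × ℝ × ℝ) (x : ℝ) :
    quadDeriv (r • a) x = r * quadDeriv a x := by
  simp [quadDeriv]; ring

theorem quad_quadBracket (a b : ℝ × ℝ × ℝ) (x : ℝ) :
    quad (quadBracket a b) x = quad a x * quadDeriv b x - quadDeriv a x * quad b x := by
  simp [quad, quadBracket, quadDeriv]; ring

theorem quadDeriv_quadBracket (a b : ℝ × ℝ × ℝ) (x : ℝ) :
    quadDeriv (quadBracket a b) x = quad a x * (2 * b.2.2) - (2 * a.2.2) * quad b x := by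
  simp [quad, quadBracket, quadDeriv]; ring

/-- The zeros of a nonzero quadratic polynomial have empty interior. -/
theorem frequently_quad_ne_zero {c : ℝ × ℝ × ℝ} (hc : c ≠ 0) (x : ℝ) :
    ∃ᶠ t in nhds x, quad c t ≠ 0 := by
  intro h
  have h0 : (quad c) =ᶠ[nhds x] fun _ => 0 := by
    filter_upwards [h] with t ht using not_not.1 ht
  have h1 : (quadDeriv c) =ᶠ[nhds x] fun _ => 0 := by
    filter_upwards [h0.eventuallyEq_nhds] with t ht
    exact (hasDerivAt_quad c t).unique ((hasDerivAt_const t (0 : ℝ)).congr_of_eventuallyEq ht)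
  have h2 : 2 * c.2.2 = 0 :=
    (hasDerivAt_quadDeriv c x).unique ((hasDerivAt_const x (0 : ℝ)).congr_of_eventuallyEq h1)
  have e2 : c.2.2 = 0 := by linarith
  have e1 := h1.self_of_nhds
  have e0 := h0.self_of_nhds
  simp only [quad, quadDeriv, e2] at e0 e1
  have e1' : c.2.1 = 0 := by linarith
  rw [e1'] at e0
  exact hc (Prod.ext (by simpa using e0) (Prod.ext e1' e2))

theorem genField_add (g h : (ℝ × ℝ × ℝ) × Matrix (Fin m) (Fin m) ℝ) :
    genField (g + h) = genField g + genField h := by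
  funext z
  refine Prod.ext ?_ ?_
  · simp [genField, quad_add]
  · simp only [genField, Prod.fst_add, Prod.snd_add, quadDeriv_add, Matrix.add_mulVec,
      Pi.add_apply, add_div, add_smul]
    abel

theorem genField_smul (r : ℝ) (g : (ℝ × ℝ × ℝ) × Matrix (Fin m) (Fin m) ℝ) :
    genField (r • g) = r • genField g := by
  funext z
  refine Prod.ext ?_ ?_
  · simp [genField, quad_smul]
  · simp only [genField, Prod.smul_fst, Prod.smul_snd, quadDeriv_smul, Matrix.smul_mulVec,
      Pi.smul_apply, smul_add, smul_smul, mul_div_assoc]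

theorem genX₁_add_genXA (A : Matrix (Fin m) (Fin m) ℝ) :
    genX₁ m + genXA A = genField ((0, 0, 1), A) := by
  funext z
  refine Prod.ext ?_ ?_
  · simp [genX₁, genXA, genField, quad]
  · simp [genX₁, genXA, genField, quadDeriv]

theorem genX₂_add_genXA (A : Matrix (Fin m) (Fin m) ℝ) :
    genX₂ m + genXA A = genField ((0, 2, 0), A) := by
  funext z
  refine Prod.ext ?_ ?_
  · simp [genX₂, genXA, genField, quad]
  · simp [genX₂, genXA, genField, quadDeriv]

theorem genX₃_add_genXA (A : Matrix (Fin m) (Fin m) ℝ) :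
    genX₃ m + genXA A = genField ((1, 0, 0), A) := by
  funext z
  refine Prod.ext ?_ ?_
  · simp [genX₃, genXA, genField, quad]
  · simp [genX₃, genXA, genField, quadDeriv]

theorem genX₁_add_genX₃_add_genXA (A : Matrix (Fin m) (Fin m) ℝ) :
    genX₁ m + genX₃ m + genXA A = genField ((1, 0, 1), A) := by
  funext z
  refine Prod.ext ?_ ?_
  · simp [genX₁, genX₃, genXA, genField, quad, add_comm]
  · simp [genX₁, genX₃, genXA, genField, quadDeriv]

theorem hasFDerivAt_genField (g : (ℝ × ℝ × ℝ) × Matrix (Fin m) (Fin m) ℝ) (z : BaseSpace m) :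
    ∃ L : BaseSpace m →L[ℝ] BaseSpace m, HasFDerivAt (genField g) L z ∧ ∀ w, L w =
      (quadDeriv g.1 z.1 * w.1, (g.1.2.2 * w.1) • z.2 + (quadDeriv g.1 z.1 / 2) • w.2 +
        g.2 *ᵥ w.2) := by
  have hfst : HasFDerivAt (fun z : BaseSpace m => z.1)
    (ContinuousLinearMap.fst ℝ ℝ (Fin m → ℝ)) z := hasFDerivAt_fst
  have hsnd : HasFDerivAt (fun z : BaseSpace m => z.2)
    (ContinuousLinearMap.snd ℝ ℝ (Fin m → ℝ)) z := hasFDerivAt_snd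
  have h1 := (hasDerivAt_quad g.1 z.1).comp_hasFDerivAt z hfst
  have h2 := ((hasDerivAt_quadDeriv g.1 z.1).div_const 2).comp_hasFDerivAt z hfst
  have h3 := (LinearMap.toContinuousLinearMap (Matrix.mulVecLin g.2)).hasFDerivAt.comp z hsnd
  refine ⟨_, h1.prodMk ((h2.smul hsnd).add h3), fun w => ?_⟩
  refine Prod.ext ?_ ?_
  · simp
  · simp [add_comm]

theorem contDiff_genField (g : (ℝ × ℝ × ℝ) × Matrix (Fin m) (Fin m) ℝ) :
    ContDiff ℝ ∞ (genField g) := by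
  have h1 : ContDiff ℝ ∞ (fun z : BaseSpace m => g.2 *ᵥ z.2) :=
    (LinearMap.toContinuousLinearMap (Matrix.mulVecLin g.2)).contDiff.comp contDiff_snd
  unfold genField quad quadDeriv
  fun_prop

theorem lieBracket_genField (g h : (ℝ × ℝ × ℝ) × Matrix (Fin m) (Fin m) ℝ) :
    VectorField.lieBracket ℝ (genField g) (genField h) =
      genField (quadBracket g.1 h.1, h.2 * g.2 - g.2 * h.2) := by
  funext z
  obtain ⟨L, hL, eL⟩ := hasFDerivAt_genField g z
  obtain ⟨M, hM, eM⟩ := hasFDerivAt_genField h z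
  rw [VectorField.lieBracket, hL.fderiv, hM.fderiv, eL, eM]
  refine Prod.ext ?_ ?_
  · simp only [genField, Prod.fst_sub, quad_quadBracket]
    ring
  · simp only [genField, Prod.snd_sub, quadDeriv_quadBracket, Matrix.sub_mulVec,
      Matrix.mulVec_add, Matrix.mulVec_smul, Matrix.mulVec_mulVec]
    module

theorem IsSymm.add {U : Set ℝ} {C C₁ : ℝ → Matrix (Fin m) (Fin m) ℝ}
    {g h : (ℝ × ℝ × ℝ) × Matrix (Fin m) (Fin m) ℝ} (hg : IsSymm U C C₁ g) (hh : IsSymm U C C₁ h) :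
    IsSymm U C C₁ (g + h) := by
  intro x hx
  rw [← add_zero (0 : Matrix (Fin m) (Fin m) ℝ)]
  nth_rw 1 [← hg x hx]
  nth_rw 1 [← hh x hx]
  simp only [Prod.fst_add, Prod.snd_add, quad_add, quadDeriv_add, mul_add, add_mul, add_smul]
  abel

theorem IsSymm.smul {U : Set ℝ} {C C₁ : ℝ → Matrix (Fin m) (Fin m) ℝ} (r : ℝ)
    {g : (ℝ × ℝ × ℝ) × Matrix (Fin m) (Fin m) ℝ} (hg : IsSymm U C C₁ g) :
    IsSymm U C C₁ (r • g) := by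
  intro x hx
  rw [← smul_zero (M := ℝ) (A := Matrix (Fin m) (Fin m) ℝ) r, ← hg x hx]
  simp only [Prod.smul_fst, Prod.smul_snd, quad_smul, quadDeriv_smul, smul_mul_assoc,
    mul_smul_comm]
  module

theorem isSymm_scalar {U : Set ℝ} {C C₁ : ℝ → Matrix (Fin m) (Fin m) ℝ} (r : ℝ) :
    IsSymm U C C₁ (0, r • 1) := by
  intro x _
  simp [quad, quadDeriv]

/-- The symmetries form a Lie algebra: differentiate the determining equations and use the Jacobi
identity. -/
theorem IsSymm.bracket {U : Set ℝ} (hU : IsOpen U) {C C₁ C₂ : ℝ → Matrix (Fin m) (Fin m) ℝ}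
    (hC : ∀ x ∈ U, HasDerivAt C (C₁ x) x) (hC₁ : ∀ x ∈ U, HasDerivAt C₁ (C₂ x) x)
    {g h : (ℝ × ℝ × ℝ) × Matrix (Fin m) (Fin m) ℝ} (hg : IsSymm U C C₁ g) (hh : IsSymm U C C₁ h) :
    IsSymm U C C₁ (quadBracket g.1 h.1, h.2 * g.2 - g.2 * h.2) := by
  have key : ∀ g : (ℝ × ℝ × ℝ) × Matrix (Fin m) (Fin m) ℝ, IsSymm U C C₁ g → ∀ x ∈ U,
      quadDeriv g.1 x • C₁ x + quad g.1 x • C₂ x + ((4 * g.1.2.2) • C x +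
        (2 * quadDeriv g.1 x) • C₁ x) + (C₁ x * g.2 - g.2 * C₁ x) = 0 := by
    intro g hg x hx
    have h1 := (((hasDerivAt_quad g.1 x).smul (hC₁ x hx)).add
      (((hasDerivAt_quadDeriv g.1 x).const_mul 2).smul (hC x hx))).add
      (((hC x hx).mul_const g.2).sub ((hC x hx).const_mul g.2))
    have h2 := h1.unique ((hasDerivAt_const x (0 : Matrix (Fin m) (Fin m) ℝ)).congr_of_eventuallyEq
      (by filter_upwards [hU.mem_nhds hx] with t ht using hg t ht))
    rw [← h2]
    module
  intro x hx
  have eg := hg x hx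
  have eh := hh x hx
  have kg := key g hg x hx
  have kh := key h hh x hx
  have : quad (quadBracket g.1 h.1) x • C₁ x + (2 * quadDeriv (quadBracket g.1 h.1) x) • C x +
      (C x * (h.2 * g.2 - g.2 * h.2) - (h.2 * g.2 - g.2 * h.2) * C x) =
      quad g.1 x • (quadDeriv h.1 x • C₁ x + quad h.1 x • C₂ x + ((4 * h.1.2.2) • C x +
        (2 * quadDeriv h.1 x) • C₁ x) + (C₁ x * h.2 - h.2 * C₁ x)) -
      quad h.1 x • (quadDeriv g.1 x • C₁ x + quad g.1 x • C₂ x + ((4 * g.1.2.2) • C x +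
        (2 * quadDeriv g.1 x) • C₁ x) + (C₁ x * g.2 - g.2 * C₁ x)) +
      (2 * quadDeriv g.1 x) • (quad h.1 x • C₁ x + (2 * quadDeriv h.1 x) • C x +
        (C x * h.2 - h.2 * C x)) -
      (2 * quadDeriv h.1 x) • (quad g.1 x • C₁ x + (2 * quadDeriv g.1 x) • C x +
        (C x * g.2 - g.2 * C x)) +
      ((quad h.1 x • C₁ x + (2 * quadDeriv h.1 x) • C x + (C x * h.2 - h.2 * C x)) * g.2 -
        g.2 * (quad h.1 x • C₁ x + (2 * quadDeriv h.1 x) • C x + (C x * h.2 - h.2 * C x))) -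
      ((quad g.1 x • C₁ x + (2 * quadDeriv g.1 x) • C x + (C x * g.2 - g.2 * C x)) * h.2 -
        h.2 * (quad g.1 x • C₁ x + (2 * quadDeriv g.1 x) • C x + (C x * g.2 - g.2 * C x))) := by
    simp only [quad_quadBracket, quadDeriv_quadBracket, mul_add, add_mul, mul_sub, sub_mul,
      smul_mul_assoc, mul_smul_comm, mul_assoc]
    module
  rw [this, eg, eh, kg, kh]
  simp

/-! ### The algebraic relations in the two- and three-dimensional cases -/

theorem IsSymm.hasDerivAt_of_translation {U : Set ℝ} {C C₁ : ℝ → Matrix (Fin m) (Fin m) ℝ}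
    (hC : ∀ x ∈ U, HasDerivAt C (C₁ x) x) {A : Matrix (Fin m) (Fin m) ℝ}
    (h : IsSymm U C C₁ ((1, 0, 0), A)) : ∀ x ∈ U, HasDerivAt C (A * C x - C x * A) x := by
  intro x hx
  refine (hC x hx).congr_deriv ?_
  have := h x hx
  simp only [quad, quadDeriv] at this
  rw [← sub_eq_zero, ← this]
  module

theorem mul_comm_of_hasExpForm {U : Set ℝ} {C : ℝ → Matrix (Fin m) (Fin m) ℝ}
    {A C₀ : Matrix (Fin m) (Fin m) ℝ} (h : HasExpForm U C A C₀) {x : ℝ} (hx : x ∈ U) :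
    A * C x = C x * A ↔ A * C₀ = C₀ * A := by
  rw [h x hx]
  exact commute_conj_exp_iff A C₀ x

/-- The determining equation of the dilation, as a function of `x`, solves `R' = A₃ R - R A₃` for
the globally defined matrix `e^{xA₃} C₀ e^{-xA₃}`. Hence it can be evaluated at `x = 0` even if
the interval does not contain that point. -/
theorem dilation_relation {U : Set ℝ} {C C₁ : ℝ → Matrix (Fin m) (Fin m) ℝ}
    {A₂ A₃ C₀ : Matrix (Fin m) (Fin m) ℝ}
    (h2 : IsSymm U C C₁ ((0, 2, 0), A₂)) (h3 : IsSymm U C C₁ ((1, 0, 0), A₃))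
    (h23 : A₂ * A₃ - A₃ * A₂ = (2 : ℝ) • A₃) (hexp : HasExpForm U C A₃ C₀)
    {x₀ : ℝ} (hx₀ : x₀ ∈ U) (x : ℝ) :
    (4 : ℝ) • (NormedSpace.exp (x • A₃) * C₀ * NormedSpace.exp (-(x • A₃))) +
      (NormedSpace.exp (x • A₃) * C₀ * NormedSpace.exp (-(x • A₃)) * A₂ -
        A₂ * (NormedSpace.exp (x • A₃) * C₀ * NormedSpace.exp (-(x • A₃)))) +
      (2 * x) • (A₃ * (NormedSpace.exp (x • A₃) * C₀ * NormedSpace.exp (-(x • A₃))) -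
        NormedSpace.exp (x • A₃) * C₀ * NormedSpace.exp (-(x • A₃)) * A₃) = 0 := by
  have hD := hasDerivAt_conj_exp A₃ C₀
  have hx : C x₀ = NormedSpace.exp (x₀ • A₃) * C₀ * NormedSpace.exp (-(x₀ • A₃)) := hexp x₀ hx₀
  set D : ℝ → Matrix (Fin m) (Fin m) ℝ :=
    fun t => NormedSpace.exp (t • A₃) * C₀ * NormedSpace.exp (-(t • A₃)) with hDdef
  change ∀ t, HasDerivAt D (A₃ * D t - D t * A₃) t at hD
  change C x₀ = D x₀ at hx
  change (4 : ℝ) • D x + (D x * A₂ - A₂ * D x) + (2 * x) • (A₃ * D x - D x * A₃) = 0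
  refine eq_zero_of_hasDerivAt_conj (U := Set.univ) Set.ordConnected_univ
    (R := fun t => (4 : ℝ) • D t + (D t * A₂ - A₂ * D t) + (2 * t) • (A₃ * D t - D t * A₃))
    (A := A₃) (fun t _ => ?_) (Set.mem_univ x₀) ?_ (Set.mem_univ x)
  · have h1 := (((hD t).const_smul (4 : ℝ)).add
      (((hD t).mul_const A₂).sub ((hD t).const_mul A₂))).add
      (((hasDerivAt_id t).const_mul 2).smul (((hD t).const_mul A₃).sub ((hD t).mul_const A₃)))
    refine h1.congr_deriv ?_
    rw [← sub_eq_zero]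
    have : ((2 : ℝ) • A₃ - (A₂ * A₃ - A₃ * A₂)) * D t - D t * ((2 : ℝ) • A₃ -
      (A₂ * A₃ - A₃ * A₂)) = 0 := by rw [h23]; simp
    rw [← this]
    simp only [mul_add, add_mul, mul_sub, sub_mul, smul_mul_assoc, mul_smul_comm, mul_assoc,
      id_eq, Pi.sub_apply]
    module
  · have e2 := h2 x₀ hx₀
    have e3 := h3 x₀ hx₀
    simp only [quad, quadDeriv] at e2 e3
    rw [hx] at e2 e3
    change (4 : ℝ) • D x₀ + (D x₀ * A₂ - A₂ * D x₀) + (2 * x₀) • (A₃ * D x₀ - D x₀ * A₃) = 0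
    linear_combination (norm := module) e2 - (2 * x₀) • e3

/-- The determining equation of the projective field, as a function of `x`, also solves
`R' = A₃ R - R A₃`, by `dilation_relation` and `[A₁, A₃] = A₂`. Hence it holds at `x = 0`. -/
theorem projective_relation {U : Set ℝ} {C C₁ : ℝ → Matrix (Fin m) (Fin m) ℝ}
    {A₁ A₂ A₃ C₀ : Matrix (Fin m) (Fin m) ℝ}
    (h1 : IsSymm U C C₁ ((0, 0, 1), A₁))
    (h2 : IsSymm U C C₁ ((0, 2, 0), A₂)) (h3 : IsSymm U C C₁ ((1, 0, 0), A₃))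
    (h13 : A₁ * A₃ - A₃ * A₁ = A₂)
    (h23 : A₂ * A₃ - A₃ * A₂ = (2 : ℝ) • A₃) (hexp : HasExpForm U C A₃ C₀)
    {x₀ : ℝ} (hx₀ : x₀ ∈ U) : C₀ * A₁ - A₁ * C₀ = 0 := by
  have hdil := dilation_relation h2 h3 h23 hexp hx₀
  have hD := hasDerivAt_conj_exp A₃ C₀
  have hx : C x₀ = NormedSpace.exp (x₀ • A₃) * C₀ * NormedSpace.exp (-(x₀ • A₃)) := hexp x₀ hx₀
  have hD0 : C₀ = NormedSpace.exp ((0 : ℝ) • A₃) * C₀ * NormedSpace.exp (-((0 : ℝ) • A₃)) := by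
    simp
  set D : ℝ → Matrix (Fin m) (Fin m) ℝ :=
    fun t => NormedSpace.exp (t • A₃) * C₀ * NormedSpace.exp (-(t • A₃)) with hDdef
  change ∀ t, HasDerivAt D (A₃ * D t - D t * A₃) t at hD
  change C x₀ = D x₀ at hx
  change C₀ = D 0 at hD0
  change ∀ t, (4 : ℝ) • D t + (D t * A₂ - A₂ * D t) + (2 * t) • (A₃ * D t - D t * A₃) = 0 at hdil
  have key : (4 * (0 : ℝ)) • D 0 + (D 0 * A₁ - A₁ * D 0) +
      ((0 : ℝ) ^ 2) • (A₃ * D 0 - D 0 * A₃) = 0 := by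
    refine eq_zero_of_hasDerivAt_conj (U := Set.univ) Set.ordConnected_univ
      (R := fun t => (4 * t) • D t + (D t * A₁ - A₁ * D t) + (t ^ 2) • (A₃ * D t - D t * A₃))
      (A := A₃) (fun t _ => ?_) (Set.mem_univ x₀) ?_ (Set.mem_univ 0)
    · have d1 := ((((hasDerivAt_id t).const_mul 4).smul (hD t)).add
        (((hD t).mul_const A₁).sub ((hD t).const_mul A₁))).add
        (((hasDerivAt_id t).pow 2).smul (((hD t).const_mul A₃).sub ((hD t).mul_const A₃)))
      refine d1.congr_deriv ?_
      rw [← sub_eq_zero, ← hdil t, ← h13]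
      simp only [mul_add, add_mul, mul_sub, sub_mul, smul_mul_assoc, mul_smul_comm, mul_assoc,
        id_eq, Pi.sub_apply, Pi.pow_apply]
      module
    · have e1 := h1 x₀ hx₀
      have e3 := h3 x₀ hx₀
      simp only [quad, quadDeriv] at e1 e3
      rw [hx] at e1 e3
      change (4 * x₀) • D x₀ + (D x₀ * A₁ - A₁ * D x₀) + (x₀ ^ 2) • (A₃ * D x₀ - D x₀ * A₃) = 0
      linear_combination (norm := module) e1 - (x₀ ^ 2) • e3
  rw [hD0]
  simpa using key

theorem caseB_of_isSymm {U : Set ℝ} (hU : U.OrdConnected) {C C₁ : ℝ → Matrix (Fin m) (Fin m) ℝ}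
    (hC : ∀ x ∈ U, HasDerivAt C (C₁ x) x) {A₂ A₃ : Matrix (Fin m) (Fin m) ℝ}
    (h2 : IsSymm U C C₁ ((0, 2, 0), A₂)) (h3 : IsSymm U C C₁ ((1, 0, 0), A₃))
    (h23 : A₂ * A₃ - A₃ * A₂ = (2 : ℝ) • A₃) (htr : ∀ x ∈ U, (C x).trace = 0)
    {x₀ : ℝ} (hx₀ : x₀ ∈ U) (hne : A₃ * C x₀ ≠ C x₀ * A₃) :
    ∃ C₀, CaseB U C A₂ A₃ C₀ := by
  have hexp := hasExpForm_of_hasDerivAt hU (h3.hasDerivAt_of_translation hC) hx₀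
  refine ⟨_, hexp, ?_, ?_, ?_, ?_⟩
  · rw [mul_add, mul_smul_comm, mul_one, ← h23]; abel
  · have := dilation_relation h2 h3 h23 hexp hx₀ 0
    simp only [zero_smul, neg_zero, NormedSpace.exp_zero, one_mul, mul_one, mul_zero,
      add_zero] at this
    rw [mul_add, mul_smul_comm, mul_one, ← neg_eq_zero, ← this]
    module
  · rw [Matrix.trace_mul_comm, ← mul_assoc, exp_smul_mul_exp_neg_smul, one_mul]
    exact htr x₀ hx₀
  · rw [sub_ne_zero]
    exact fun h => hne ((mul_comm_of_hasExpForm hexp hx₀).2 h)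

theorem caseC_of_isSymm {U : Set ℝ} (hU : U.OrdConnected) {C C₁ : ℝ → Matrix (Fin m) (Fin m) ℝ}
    (hC : ∀ x ∈ U, HasDerivAt C (C₁ x) x) {A₁ A₂ A₃ : Matrix (Fin m) (Fin m) ℝ}
    (h1 : IsSymm U C C₁ ((0, 0, 1), A₁))
    (h2 : IsSymm U C C₁ ((0, 2, 0), A₂)) (h3 : IsSymm U C C₁ ((1, 0, 0), A₃))
    (h12 : A₁ * A₂ - A₂ * A₁ = (2 : ℝ) • A₁) (h13 : A₁ * A₃ - A₃ * A₁ = A₂)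
    (h23 : A₂ * A₃ - A₃ * A₂ = (2 : ℝ) • A₃) (htr : ∀ x ∈ U, (C x).trace = 0)
    {x₀ : ℝ} (hx₀ : x₀ ∈ U) (hne : A₃ * C x₀ ≠ C x₀ * A₃) :
    ∃ C₀, CaseC U C A₁ A₂ A₃ C₀ := by
  obtain ⟨C₀, hexp, -, hB, htrace, hne'⟩ := caseB_of_isSymm hU hC h2 h3 h23 htr hx₀ hne
  exact ⟨C₀, hexp, h12, h13, h23, hB, projective_relation h1 h2 h3 h13 h23 hexp hx₀,
    htrace, hne'⟩

/-! ### Straightening a generator -/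

/-- If `f = v ∘ φ` near `x` and `φ' (x) ≠ 0`, a derivative of `f` gives one of `v`. -/
theorem hasDerivAt_of_comp {F : Type*} [NormedAddCommGroup F] [NormedSpace ℝ F] {φ : ℝ → ℝ}
    {v f : ℝ → F} {x d : ℝ} {f' : F} (hφ : HasStrictDerivAt φ d x) (hd : d ≠ 0)
    (hf : HasDerivAt f f' x) (hv : ∀ᶠ t in nhds x, v (φ t) = f t) :
    HasDerivAt v (d⁻¹ • f') (φ x) := by
  have h1 := hφ.to_localInverse hd
  set χ := hφ.localInverse φ d x hd with hχ
  have hright : ∀ᶠ y in nhds (φ x), φ (χ y) = y := hφ.eventually_right_inverse hd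
  have hx : χ (φ x) = x :=
    (hφ.eventually_left_inverse hd).self_of_nhds
  have h2 : HasDerivAt (f ∘ χ) (d⁻¹ • f') (φ x) := by
    refine HasDerivAt.scomp (φ x) ?_ h1.hasDerivAt
    rwa [hx]
  refine h2.congr_of_eventuallyEq ?_
  have hcont : Filter.Tendsto χ (nhds (φ x)) (nhds x) := by
    have := h1.hasDerivAt.continuousAt.tendsto
    rwa [hx] at this
  filter_upwards [hright, hcont.eventually hv] with y h3 h4
  rw [h3] at h4
  exact h4

section Straighten

variable {J : Set ℝ} {c : ℝ × ℝ × ℝ} {φ : ℝ → ℝ}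

theorem contDiffOn_of_hasDerivAt_inv_quad (hJ : IsOpen J) (hc : ∀ x ∈ J, quad c x ≠ 0)
    (hφ : ∀ x ∈ J, HasDerivAt φ (quad c x)⁻¹ x) : ContDiffOn ℝ ∞ φ J := by
  rw [contDiffOn_infty_iff_deriv_of_isOpen hJ]
  refine ⟨fun x hx => (hφ x hx).differentiableAt.differentiableWithinAt, ?_⟩
  have h : ContDiffOn ℝ ∞ (fun x => (quad c x)⁻¹) J := by
    refine ContDiffOn.inv ?_ hc
    unfold quad
    fun_prop
  exact h.congr fun x hx => (hφ x hx).deriv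

theorem hasStrictDerivAt_of_hasDerivAt_inv_quad (hJ : IsOpen J) (hc : ∀ x ∈ J, quad c x ≠ 0)
    (hφ : ∀ x ∈ J, HasDerivAt φ (quad c x)⁻¹ x) {x : ℝ} (hx : x ∈ J) :
    HasStrictDerivAt φ (quad c x)⁻¹ x :=
  ((contDiffOn_of_hasDerivAt_inv_quad hJ hc hφ).contDiffAt (hJ.mem_nhds hx)).hasStrictDerivAt'
    (hφ x hx) (by simp)

theorem isOpen_image_of_hasDerivAt_inv_quad (hJ : IsOpen J) (hc : ∀ x ∈ J, quad c x ≠ 0)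
    (hφ : ∀ x ∈ J, HasDerivAt φ (quad c x)⁻¹ x) : IsOpen (φ '' J) := by
  rw [isOpen_iff_mem_nhds]
  rintro _ ⟨x, hx, rfl⟩
  rw [← (hasStrictDerivAt_of_hasDerivAt_inv_quad hJ hc hφ hx).map_nhds_eq
    (inv_ne_zero (hc x hx))]
  exact Filter.image_mem_map (hJ.mem_nhds hx)

theorem ordConnected_image_of_hasDerivAt_inv_quad (hJ' : J.OrdConnected)
    (hφ : ∀ x ∈ J, HasDerivAt φ (quad c x)⁻¹ x) : (φ '' J).OrdConnected :=
  (hJ'.isPreconnected.image φ fun x hx =>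
    (hφ x hx).continuousAt.continuousWithinAt).ordConnected

theorem injOn_of_hasDerivAt_inv_quad (hJ' : J.OrdConnected) (hc : ∀ x ∈ J, quad c x ≠ 0)
    (hφ : ∀ x ∈ J, HasDerivAt φ (quad c x)⁻¹ x) : Set.InjOn φ J := by
  have key : ∀ x ∈ J, ∀ y ∈ J, x < y → φ x ≠ φ y := by
    intro x hx y hy hxy he
    have hsub : Set.Icc x y ⊆ J := hJ'.out hx hy
    obtain ⟨t, ht, h0⟩ := exists_hasDerivAt_eq_zero hxy
      (fun t ht => (hφ t (hsub ht)).continuousAt.continuousWithinAt) he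
      (fun t ht => hφ t (hsub (Set.Ioo_subset_Icc_self ht)))
    exact inv_ne_zero (hc t (hsub (Set.Ioo_subset_Icc_self ht))) h0
  intro x hx y hy he
  rcases lt_trichotomy x y with h | h | h
  · exact absurd he (key x hx y hy h)
  · exact h
  · exact absurd he.symm (key y hy x hx h)

/-- The multiplier `|a|^{-1/2}` of the transformation that straightens `a ∂ₓ + ⋯`. Since
`Real.log a = log |a|`, no sign of `a` has to be chosen. -/
def multiplier (c : ℝ × ℝ × ℝ) (x : ℝ) : ℝ := Real.exp (-(Real.log (quad c x) / 2))

theorem multiplier_ne_zero (c : ℝ × ℝ × ℝ) (x : ℝ) : multiplier c x ≠ 0 := Real.exp_ne_zero _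

theorem hasDerivAt_multiplier {x : ℝ} (hx : quad c x ≠ 0) :
    HasDerivAt (multiplier c) (-(quadDeriv c x / (2 * quad c x)) * multiplier c x) x := by
  have h := (((hasDerivAt_quad c x).log hx).div_const 2).neg.exp
  refine h.congr_deriv ?_
  simp only [multiplier, Pi.neg_apply]
  field_simp

theorem hasDerivAt_inv_multiplier {x : ℝ} (hx : quad c x ≠ 0) :
    HasDerivAt (fun t => (multiplier c t)⁻¹)
      (quadDeriv c x / (2 * quad c x) * (multiplier c x)⁻¹) x := by
  refine ((hasDerivAt_multiplier hx).inv (multiplier_ne_zero c x)).congr_deriv ?_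
  have := multiplier_ne_zero c x
  field_simp

/-- The transformation `x̃ = φ(x)`, `ỹ = |a|^{-1/2} y` with `φ' = 1/a`, which takes `a ∂ₓ + ⋯` to
`∂ₓ + ⋯`. -/
def straighten (m : ℕ) (hJ : IsOpen J) (hc : ∀ x ∈ J, quad c x ≠ 0)
    (hφ : ∀ x ∈ J, HasDerivAt φ (quad c x)⁻¹ x) : EquivTransf m J where
  φ := φ
  ψ := multiplier c
  P := 1
  smooth_φ := contDiffOn_of_hasDerivAt_inv_quad hJ hc hφ
  smooth_ψ := by
    have h : ContDiffOn ℝ ∞ (quad c) J := by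
      unfold quad
      fun_prop
    exact ((h.log hc).div_const 2).neg.exp
  deriv_φ_ne := fun x hx => by
    rw [(hφ x hx).deriv]
    exact inv_ne_zero (hc x hx)
  ψ_ne := fun x _ => multiplier_ne_zero c x
  compat := fun x hx => by
    have h1 : HasDerivAt (deriv φ) (-quadDeriv c x / quad c x ^ 2) x := by
      refine ((hasDerivAt_quad c x).inv (hc x hx)).congr_of_eventuallyEq ?_
      filter_upwards [hJ.mem_nhds hx] with t ht using (hφ t ht).deriv
    rw [h1.deriv, (hφ x hx).deriv, (hasDerivAt_multiplier (hc x hx)).deriv]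
    have := hc x hx
    have := multiplier_ne_zero c x
    field_simp

/-- The matrix of the straightened system, `C̃(φ(x)) = a² C + (a'² - 2 a a'')/4`; the scalar is a
quarter of the discriminant of `a`. The inverse of `φ` is taken on `J`, and the values outside
`φ(J)` have no meaning. -/
def straightMatrix (J : Set ℝ) (c : ℝ × ℝ × ℝ) (φ : ℝ → ℝ)
    (C : ℝ → Matrix (Fin m) (Fin m) ℝ) (t : ℝ) : Matrix (Fin m) (Fin m) ℝ :=
  quad c (Function.invFunOn φ J t) ^ 2 • C (Function.invFunOn φ J t) +
    ((c.2.1 ^ 2 - 4 * c.1 * c.2.2) / 4) • 1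

theorem straightMatrix_apply (hJ' : J.OrdConnected) (hc : ∀ x ∈ J, quad c x ≠ 0)
    (hφ : ∀ x ∈ J, HasDerivAt φ (quad c x)⁻¹ x) (C : ℝ → Matrix (Fin m) (Fin m) ℝ)
    {x : ℝ} (hx : x ∈ J) :
    straightMatrix J c φ C (φ x) =
      quad c x ^ 2 • C x + ((c.2.1 ^ 2 - 4 * c.1 * c.2.2) / 4) • 1 := by
  rw [straightMatrix,
    (injOn_of_hasDerivAt_inv_quad hJ' hc hφ).leftInvOn_invFunOn hx]

/-- The derivative of `straightMatrix`, in terms of the derivative `C₁` of `C`. -/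
def straightMatrixDeriv (J : Set ℝ) (c : ℝ × ℝ × ℝ) (φ : ℝ → ℝ)
    (C C₁ : ℝ → Matrix (Fin m) (Fin m) ℝ) (t : ℝ) : Matrix (Fin m) (Fin m) ℝ :=
  let x := Function.invFunOn φ J t
  quad c x • (quad c x ^ 2 • C₁ x + (2 * quad c x * quadDeriv c x) • C x)

theorem straightMatrixDeriv_apply (hJ' : J.OrdConnected) (hc : ∀ x ∈ J, quad c x ≠ 0)
    (hφ : ∀ x ∈ J, HasDerivAt φ (quad c x)⁻¹ x) (C C₁ : ℝ → Matrix (Fin m) (Fin m) ℝ)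
    {x : ℝ} (hx : x ∈ J) :
    straightMatrixDeriv J c φ C C₁ (φ x) =
      quad c x • (quad c x ^ 2 • C₁ x + (2 * quad c x * quadDeriv c x) • C x) := by
  simp only [straightMatrixDeriv,
    (injOn_of_hasDerivAt_inv_quad hJ' hc hφ).leftInvOn_invFunOn hx]

theorem hasDerivAt_straightMatrix (hJ : IsOpen J) (hJ' : J.OrdConnected)
    (hc : ∀ x ∈ J, quad c x ≠ 0) (hφ : ∀ x ∈ J, HasDerivAt φ (quad c x)⁻¹ x)
    {C C₁ : ℝ → Matrix (Fin m) (Fin m) ℝ} (hC : ∀ x ∈ J, HasDerivAt C (C₁ x) x) :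
    ∀ t ∈ φ '' J, HasDerivAt (straightMatrix J c φ C) (straightMatrixDeriv J c φ C C₁ t) t := by
  rintro _ ⟨x, hx, rfl⟩
  have h1 := (((hasDerivAt_quad c x).pow 2).smul (hC x hx)).add_const
    (((c.2.1 ^ 2 - 4 * c.1 * c.2.2) / 4) • (1 : Matrix (Fin m) (Fin m) ℝ))
  have h2 := hasDerivAt_of_comp (v := straightMatrix J c φ C)
    (hasStrictDerivAt_of_hasDerivAt_inv_quad hJ hc hφ hx) (inv_ne_zero (hc x hx)) h1
    (by filter_upwards [hJ.mem_nhds hx] with t ht using straightMatrix_apply hJ' hc hφ C ht)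
  refine h2.congr_deriv ?_
  rw [straightMatrixDeriv_apply hJ' hc hφ C C₁ hx, inv_inv]
  simp

/-- Symmetries `b ∂ₓ + ⋯` go over into symmetries `β ∂ₓ + ⋯` with `b = β(φ) a`. The additional
scalar in the new matrix must not be seen by `β`, that is, it vanishes or `β` is constant. -/
theorem IsSymm.straighten (hJ' : J.OrdConnected)
    (hc : ∀ x ∈ J, quad c x ≠ 0) (hφ : ∀ x ∈ J, HasDerivAt φ (quad c x)⁻¹ x)
    {C C₁ : ℝ → Matrix (Fin m) (Fin m) ℝ} {b β : ℝ × ℝ × ℝ} {B : Matrix (Fin m) (Fin m) ℝ}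
    (hb : ∀ x ∈ J, quad b x = quad β (φ x) * quad c x)
    (hb' : ∀ x ∈ J, quadDeriv b x = quadDeriv β (φ x) + quad β (φ x) * quadDeriv c x)
    (hβ : ∀ x, (c.2.1 ^ 2 - 4 * c.1 * c.2.2) * quadDeriv β x = 0) (h : IsSymm J C C₁ (b, B)) :
    IsSymm (φ '' J) (straightMatrix J c φ C) (straightMatrixDeriv J c φ C C₁) (β, B) := by
  rintro _ ⟨x, hx, rfl⟩
  have h1 := h x hx
  simp only at h1 ⊢
  rw [straightMatrixDeriv_apply hJ' hc hφ C C₁ hx, straightMatrix_apply hJ' hc hφ C hx]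
  rw [hb x hx, hb' x hx] at h1
  have h2 := hβ (φ x)
  have e : ((c.2.1 ^ 2 - 4 * c.1 * c.2.2) * quadDeriv β (φ x)) •
    (1 : Matrix (Fin m) (Fin m) ℝ) = 0 := by rw [h2, zero_smul]
  simp only [add_mul, mul_add, smul_mul_assoc, mul_smul_comm, one_mul, mul_one]
  linear_combination (norm := module) (quad c x ^ 2) • h1 + (1 / 2 : ℝ) • e

theorem quadDeriv_eq_of_quad_eq (hJ : IsOpen J) (hc : ∀ x ∈ J, quad c x ≠ 0)
    (hφ : ∀ x ∈ J, HasDerivAt φ (quad c x)⁻¹ x) {b β : ℝ × ℝ × ℝ}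
    (hb : ∀ x ∈ J, quad b x = quad β (φ x) * quad c x) :
    ∀ x ∈ J, quadDeriv b x = quadDeriv β (φ x) + quad β (φ x) * quadDeriv c x := by
  intro x hx
  have h1 := ((hasDerivAt_quad β (φ x)).comp x (hφ x hx)).mul (hasDerivAt_quad c x)
  have h2 := (hasDerivAt_quad b x).unique (h1.congr_of_eventuallyEq
    (by filter_upwards [hJ.mem_nhds hx] with t ht using hb t ht))
  rw [h2]
  have := hc x hx
  simp only [Function.comp_apply]
  field_simp

theorem straighten_carries (hJ : IsOpen J) (hJ' : J.OrdConnected)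
    (hc : ∀ x ∈ J, quad c x ≠ 0) (hφ : ∀ x ∈ J, HasDerivAt φ (quad c x)⁻¹ x)
    (C : ℝ → Matrix (Fin m) (Fin m) ℝ) :
    (straighten m hJ hc hφ).Carries C (straightMatrix J c φ C) := by
  intro u v huv
  have hv : ∀ x ∈ J, v (φ x) = multiplier c x • u x := by
    intro x hx
    have := (Prod.ext_iff.1 (huv x hx)).2
    simpa [straighten, EquivTransf.toMap] using this
  have hmul : ∀ x ∈ J, straightMatrix J c φ C (φ x) *ᵥ v (φ x) =
      quad c x ^ 2 • (C x *ᵥ v (φ x)) +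
        ((quadDeriv c x ^ 2 - 2 * quad c x * (2 * c.2.2)) / 4) • v (φ x) := by
    intro x hx
    rw [straightMatrix_apply hJ' hc hφ C hx, Matrix.add_mulVec, Matrix.smul_mulVec,
      Matrix.smul_mulVec, Matrix.one_mulVec]
    congr 2
    simp only [quad, quadDeriv]
    ring
  have hstrict : ∀ x ∈ J, HasStrictDerivAt φ (quad c x)⁻¹ x :=
    fun x hx => hasStrictDerivAt_of_hasDerivAt_inv_quad hJ hc hφ hx
  constructor
  · rintro ⟨w, hw⟩
    have h1 : ∀ x ∈ J, HasDerivAt v (multiplier c x •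
        (quad c x • w x - (quadDeriv c x / 2) • u x)) (φ x) := by
      intro x hx
      have hx0 := hc x hx
      refine (hasDerivAt_of_comp (hstrict x hx) (inv_ne_zero hx0)
        ((hasDerivAt_multiplier hx0).smul (hw x hx).1)
        (by filter_upwards [hJ.mem_nhds hx] with t ht using hv t ht)).congr_deriv ?_
      match_scalars <;> field_simp
    refine ⟨deriv v, ?_⟩
    rintro _ ⟨x, hx, rfl⟩
    have hx0 := hc x hx
    refine ⟨(h1 x hx).differentiableAt.hasDerivAt, ?_⟩
    refine (hasDerivAt_of_comp (hstrict x hx) (inv_ne_zero hx0)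
      ((hasDerivAt_multiplier hx0).smul
        (((hasDerivAt_quad c x).smul (hw x hx).2).sub
          (((hasDerivAt_quadDeriv c x).div_const 2).smul (hw x hx).1)))
      (by filter_upwards [hJ.mem_nhds hx] with t ht using (h1 t ht).deriv)).congr_deriv ?_
    change _ = straightMatrix J c φ C (φ x) *ᵥ v (φ x)
    rw [hmul x hx, hv x hx, Matrix.mulVec_smul]
    simp only [Pi.smul_apply', Pi.sub_apply]
    match_scalars <;> field_simp <;> ring
  · rintro ⟨w, hw⟩
    have hu : ∀ x ∈ J, u x = (multiplier c x)⁻¹ • v (φ x) := by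
      intro x hx
      rw [hv x hx, smul_smul, inv_mul_cancel₀ (multiplier_ne_zero c x), one_smul]
    refine ⟨fun x => (quadDeriv c x / (2 * quad c x) * (multiplier c x)⁻¹) • v (φ x) +
      ((quad c x)⁻¹ * (multiplier c x)⁻¹) • w (φ x), fun x hx => ?_⟩
    have hx0 := hc x hx
    have hm0 := multiplier_ne_zero c x
    obtain ⟨hw1, hw2⟩ := hw (φ x) ⟨x, hx, rfl⟩
    change HasDerivAt w (straightMatrix J c φ C (φ x) *ᵥ v (φ x)) (φ x) at hw2
    have hv1 := hw1.scomp x (hφ x hx)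
    have hv2 := hw2.scomp x (hφ x hx)
    constructor
    · refine (((hasDerivAt_inv_multiplier hx0).smul hv1).congr_of_eventuallyEq
        (by filter_upwards [hJ.mem_nhds hx] with t ht using hu t ht)).congr_deriv ?_
      simp only [Function.comp_apply]
      match_scalars <;> field_simp
    · refine ((((((hasDerivAt_quadDeriv c x).div ((hasDerivAt_quad c x).const_mul 2)
        (mul_ne_zero two_ne_zero hx0)).mul (hasDerivAt_inv_multiplier hx0)).smul hv1).add
        ((((hasDerivAt_quad c x).inv hx0).mul (hasDerivAt_inv_multiplier hx0)).smul
          hv2)).congr_deriv ?_)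
      rw [hu x hx, Matrix.mulVec_smul, hmul x hx]
      simp only [Function.comp_apply, Pi.mul_apply, Pi.div_apply, Pi.inv_apply]
      match_scalars <;> field_simp <;> ring

/-- If `b = β(φ) a`, then straightening `a` maps `b ∂ₓ + ((b'/2) E + B) y·∇ + h(x)·∇` to
`β ∂ₓ + ((β'/2) E + B) y·∇ + k(x)·∇`, where `k(φ) = |a|^{-1/2} h`. -/
theorem straighten_pushes (hJ : IsOpen J) (hc : ∀ x ∈ J, quad c x ≠ 0)
    (hφ : ∀ x ∈ J, HasDerivAt φ (quad c x)⁻¹ x) {b β : ℝ × ℝ × ℝ}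
    {B : Matrix (Fin m) (Fin m) ℝ}
    (hb : ∀ x ∈ J, quad b x = quad β (φ x) * quad c x)
    {h k : ℝ → Fin m → ℝ} (hk : ∀ x ∈ J, k (φ x) = multiplier c x • h x)
    {X X' : PointField m} (hX : ∀ x ∈ J, ∀ y, X (x, y) = genField (b, B) (x, y) + (0, h x))
    (hX' : ∀ x ∈ J, ∀ y, X' (φ x, y) = genField (β, B) (φ x, y) + (0, k (φ x))) :
    (straighten m hJ hc hφ).Pushes X X' := by
  intro x hx y
  have hx0 := hc x hx
  have hm0 := multiplier_ne_zero c x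
  have hfst : HasFDerivAt (fun z : BaseSpace m => z.1)
    (ContinuousLinearMap.fst ℝ ℝ (Fin m → ℝ)) (x, y) := hasFDerivAt_fst
  have hsnd : HasFDerivAt (fun z : BaseSpace m => z.2)
    (ContinuousLinearMap.snd ℝ ℝ (Fin m → ℝ)) (x, y) := hasFDerivAt_snd
  have h1 := (hφ x hx).comp_hasFDerivAt (x, y) hfst
  have h2 := (hasDerivAt_multiplier hx0).comp_hasFDerivAt (x, y) hfst
  have h3 := h1.prodMk (h2.smul hsnd)
  have hmap : (straighten m hJ hc hφ).toMap =
      fun z : BaseSpace m => (φ z.1, multiplier c z.1 • z.2) := by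
    funext z
    simp [straighten, EquivTransf.toMap]
  rw [hmap]
  erw [h3.fderiv]
  rw [hX x hx, hX' x hx, hk x hx]
  refine Prod.ext ?_ ?_
  · simp [genField, hb x hx]
    field_simp
  · simp [genField, hb x hx, quadDeriv_eq_of_quad_eq hJ hc hφ hb x hx, Matrix.mulVec_smul]
    match_scalars <;> field_simp
    ring

end Straighten

theorem isSymm_straightMatrix {J : Set ℝ} (hJ' : J.OrdConnected)
    {C C₁ : ℝ → Matrix (Fin m) (Fin m) ℝ} {g : (ℝ × ℝ × ℝ) × Matrix (Fin m) (Fin m) ℝ}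
    (hg : IsSymm J C C₁ g) (hc : ∀ x ∈ J, quad g.1 x ≠ 0) {φ : ℝ → ℝ}
    (hφ : ∀ x ∈ J, HasDerivAt φ (quad g.1 x)⁻¹ x) :
    IsSymm (φ '' J) (straightMatrix J g.1 φ C) (straightMatrixDeriv J g.1 φ C C₁)
      ((1, 0, 0), g.2) :=
  hg.straighten (b := g.1) hJ' hc hφ (by simp [quad]) (by simp [quad, quadDeriv])
    (by simp [quadDeriv])

theorem mul_straightMatrix_comm_iff {J : Set ℝ} (hJ' : J.OrdConnected) {c : ℝ × ℝ × ℝ}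
    (hc : ∀ x ∈ J, quad c x ≠ 0) {φ : ℝ → ℝ} (hφ : ∀ x ∈ J, HasDerivAt φ (quad c x)⁻¹ x)
    (C : ℝ → Matrix (Fin m) (Fin m) ℝ) (A : Matrix (Fin m) (Fin m) ℝ) {x : ℝ} (hx : x ∈ J) :
    A * straightMatrix J c φ C (φ x) = straightMatrix J c φ C (φ x) * A ↔
      A * C x = C x * A := by
  rw [straightMatrix_apply hJ' hc hφ C hx]
  simp [mul_add, add_mul, hc x hx]

/-! ### Systems equivalent to a constant one -/

theorem exists_hasDerivAt_inv_quad {J : Set ℝ} (hJ : IsOpen J) (hJ' : J.OrdConnected)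
    {c : ℝ × ℝ × ℝ} (hc : ∀ x ∈ J, quad c x ≠ 0) :
    ∃ φ : ℝ → ℝ, ∀ x ∈ J, HasDerivAt φ (quad c x)⁻¹ x := by
  rcases J.eq_empty_or_nonempty with rfl | ⟨x₀, hx₀⟩
  · exact ⟨id, by simp⟩
  have hcont : ContinuousOn (fun x => (quad c x)⁻¹) J :=
    ContinuousOn.inv₀ (fun x _ => (hasDerivAt_quad c x).continuousAt.continuousWithinAt) hc
  refine ⟨fun x => ∫ t in x₀..x, (quad c t)⁻¹, fun x hx => ?_⟩
  refine intervalIntegral.integral_hasDerivAt_right ?_ ?_ (hcont.continuousAt (hJ.mem_nhds hx))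
  · exact (hcont.mono (hJ'.uIcc_subset hx₀ hx)).intervalIntegrable
  · exact hcont.stronglyMeasurableAtFilter hJ x hx

theorem EquivTransf.Carries.congr {J : Set ℝ} {T : EquivTransf m J}
    {C C' C'' : ℝ → Matrix (Fin m) (Fin m) ℝ} (h : T.Carries C C')
    (he : ∀ x ∈ J, C' (T.φ x) = C'' (T.φ x)) : T.Carries C C'' := by
  intro u v huv
  rw [h u v huv]
  constructor
  all_goals
    rintro ⟨w, hw⟩
    refine ⟨w, ?_⟩
    rintro _ ⟨x, hx, rfl⟩
    have := hw _ ⟨x, hx, rfl⟩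
    first
    | rwa [he x hx] at this
    | rwa [← he x hx] at this

theorem reducesToConstant_of_const {I : Set ℝ} (hI : IsOpen I) (hI' : I.OrdConnected)
    {C : ℝ → Matrix (Fin m) (Fin m) ℝ} {c : ℝ × ℝ × ℝ} (hc : ∀ x ∈ I, quad c x ≠ 0)
    {K : Matrix (Fin m) (Fin m) ℝ} (hK : ∀ x ∈ I, quad c x ^ 2 • C x = K) :
    ReducesToConstant I C := by
  obtain ⟨φ, hφ⟩ := exists_hasDerivAt_inv_quad hI hI' hc
  refine ⟨straighten m hI hc hφ, K + ((c.2.1 ^ 2 - 4 * c.1 * c.2.2) / 4) • 1,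
    (straighten_carries hI hI' hc hφ C).congr fun x hx => ?_⟩
  exact (straightMatrix_apply hI' hc hφ C hx).trans (by rw [hK x hx])

theorem reducesToConstant_of_eq_zero {I : Set ℝ} (hI : IsOpen I) (hI' : I.OrdConnected)
    {C : ℝ → Matrix (Fin m) (Fin m) ℝ} (h : ∀ x ∈ I, C x = 0) : ReducesToConstant I C :=
  reducesToConstant_of_const hI hI' (c := (1, 0, 0)) (fun x _ => by simp [quad]) (K := 0)
    (fun x hx => by simp [h x hx])

theorem eq_zero_of_quad_smul_eq_zero {I : Set ℝ} (hI : IsOpen I) {F : Type*}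
    [NormedAddCommGroup F] [NormedSpace ℝ F] {f : ℝ → F} (hf : ∀ x ∈ I, ContinuousAt f x)
    {c : ℝ × ℝ × ℝ} (hc : c ≠ 0) (h : ∀ x ∈ I, quad c x ≠ 0 → f x = 0) :
    ∀ x ∈ I, f x = 0 := by
  intro x hx
  by_contra hne
  have h1 : ∀ᶠ t in nhds x, f t ≠ 0 := (hf x hx).eventually_ne hne
  obtain ⟨t, ht, h2, h3⟩ :=
    ((frequently_quad_ne_zero hc x).and_eventually (h1.and (hI.mem_nhds hx))).exists
  exact h2 (h t h3 ht)

/-- If the matrix of a nonzero symmetry commutes with the system, then `a² C` is constant, so that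
either `a` has no zero and can be straightened, or `C = 0`. -/
theorem reducesToConstant_of_isSymm_of_commute {I : Set ℝ} (hI : IsOpen I) (hI' : I.OrdConnected)
    {C C₁ : ℝ → Matrix (Fin m) (Fin m) ℝ} (hC : ∀ x ∈ I, HasDerivAt C (C₁ x) x)
    {g : (ℝ × ℝ × ℝ) × Matrix (Fin m) (Fin m) ℝ} (hg : IsSymm I C C₁ g) (hg0 : g.1 ≠ 0)
    (hcomm : ∀ x ∈ I, g.2 * C x = C x * g.2) : ReducesToConstant I C := by
  have hconst : ∀ x ∈ I, HasDerivAt (fun t => quad g.1 t ^ 2 • C t) 0 x := by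
    intro x hx
    refine (((hasDerivAt_quad g.1 x).pow 2).smul (hC x hx)).congr_deriv ?_
    have h := hg x hx
    rw [hcomm x hx] at h
    simp only [Pi.pow_apply]
    linear_combination (norm := module) (quad g.1 x) • h
  by_cases hz : ∀ x ∈ I, quad g.1 x ≠ 0
  · rcases I.eq_empty_or_nonempty with rfl | ⟨x₀, hx₀⟩
    · exact reducesToConstant_of_eq_zero hI hI' (by simp)
    · exact reducesToConstant_of_const hI hI' hz fun x hx =>
        eqOn_of_hasDerivAt_zero hI' hconst hx hx₀
  · push Not at hz
    obtain ⟨x₀, hx₀, h0⟩ := hz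
    refine reducesToConstant_of_eq_zero hI hI'
      (eq_zero_of_quad_smul_eq_zero hI (fun x hx => (hC x hx).continuousAt) hg0 ?_)
    intro x hx hne
    have h1 : quad g.1 x ^ 2 • C x = quad g.1 x₀ ^ 2 • C x₀ :=
      eqOn_of_hasDerivAt_zero hI' hconst hx hx₀
    rw [h0] at h1
    simpa [hne] using h1

/-- For a system not equivalent to a constant one, the commutator of `A` with `C` is not identically
zero; by continuity, it is nonzero at some point that is not a zero of `a`. -/
theorem exists_not_commute {I : Set ℝ} (hI : IsOpen I) (hI' : I.OrdConnected)
    {C C₁ : ℝ → Matrix (Fin m) (Fin m) ℝ} (hC : ∀ x ∈ I, HasDerivAt C (C₁ x) x)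
    (hred : ¬ ReducesToConstant I C)
    {g : (ℝ × ℝ × ℝ) × Matrix (Fin m) (Fin m) ℝ} (hg : IsSymm I C C₁ g) (hg0 : g.1 ≠ 0) :
    ∃ x ∈ I, quad g.1 x ≠ 0 ∧ g.2 * C x ≠ C x * g.2 := by
  by_contra! hcon
  refine hred (reducesToConstant_of_isSymm_of_commute hI hI' hC hg hg0 fun x hx => ?_)
  rw [← sub_eq_zero]
  refine eq_zero_of_quad_smul_eq_zero hI (f := fun x => g.2 * C x - C x * g.2) (fun x hx => ?_)
    hg0 (fun x hx hne => by simp [hcon x hx hne]) x hx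
  exact (((hC x hx).const_mul g.2).sub ((hC x hx).mul_const g.2)).continuousAt

/-! ### Propagation of commutation relations -/

/-- Where `a` has no zero, the straightened system has the form `e^{xA} C₀ e^{-xA}`, and `A`
commutes with it at one point exactly if it commutes with `C₀`. -/
theorem commute_of_commute_at {U : Set ℝ} (hU : IsOpen U) (hU' : U.OrdConnected)
    {C C₁ : ℝ → Matrix (Fin m) (Fin m) ℝ} (hC : ∀ x ∈ U, HasDerivAt C (C₁ x) x)
    {g : (ℝ × ℝ × ℝ) × Matrix (Fin m) (Fin m) ℝ} (hg : IsSymm U C C₁ g)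
    (hc : ∀ x ∈ U, quad g.1 x ≠ 0) {x₀ : ℝ} (hx₀ : x₀ ∈ U)
    (h0 : g.2 * C x₀ = C x₀ * g.2) : ∀ x ∈ U, g.2 * C x = C x * g.2 := by
  obtain ⟨φ, hφ⟩ := exists_hasDerivAt_inv_quad hU hU' hc
  have hexp := hasExpForm_of_hasDerivAt (ordConnected_image_of_hasDerivAt_inv_quad hU' hφ)
    ((isSymm_straightMatrix hU' hg hc hφ).hasDerivAt_of_translation
      (hasDerivAt_straightMatrix hU hU' hc hφ hC)) ⟨x₀, hx₀, rfl⟩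
  intro x hx
  rw [← mul_straightMatrix_comm_iff hU' hc hφ C g.2 hx,
    mul_comm_of_hasExpForm hexp ⟨x, hx, rfl⟩, ← mul_comm_of_hasExpForm hexp ⟨x₀, hx₀, rfl⟩,
    mul_straightMatrix_comm_iff hU' hc hφ C g.2 hx₀]
  exact h0

open scoped InnerProductSpace in
/-- A smooth solution of the singular equation `x D' = L D` on an interval around `0` that
vanishes on a nonempty open set vanishes. If `⟪L v, v⟫ ≤ -‖v‖²/2`, then `x ‖D‖²` is antitone, which
forces `D = 0`; in general, differentiation replaces `L` by `L - 1`, so that after finitely many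
differentiations this case applies. -/
theorem euler_eq_zero {F : Type*} [NormedAddCommGroup F] [InnerProductSpace ℝ F] {I J : Set ℝ}
    (hI : IsOpen I) (hI' : I.OrdConnected) (h0 : (0 : ℝ) ∈ I) (hJ : IsOpen J) (hJI : J ⊆ I)
    (hJne : J.Nonempty) (n : ℕ) :
    ∀ (L : F →L[ℝ] F) (D : ℝ → F), ContDiffOn ℝ ∞ D I →
      (∀ v, ⟪L v, v⟫_ℝ ≤ (n - 1 / 2) * ‖v‖ ^ 2) → (∀ x ∈ I, x • deriv D x = L (D x)) →
      (∀ x ∈ J, D x = 0) → ∀ x ∈ I, D x = 0 := by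
  induction n with
  | zero =>
    intro L D hD hL hE _
    have hder : ∀ x ∈ I, HasDerivAt D (deriv D x) x := fun x hx =>
      ((hD.contDiffAt (hI.mem_nhds hx)).differentiableAt (by simp)).hasDerivAt
    have hder2 : ∀ x ∈ I, HasDerivAt (fun t => t * ‖D t‖ ^ 2)
        (1 * ‖D x‖ ^ 2 + x * (2 * ⟪D x, deriv D x⟫_ℝ)) x := fun x hx =>
      (hasDerivAt_id x).mul (hder x hx).norm_sq
    have hanti : AntitoneOn (fun t => t * ‖D t‖ ^ 2) I := by
      refine antitoneOn_of_deriv_nonpos (convex_iff_ordConnected.2 hI')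
        (fun x hx => (hder2 x hx).continuousAt.continuousWithinAt)
        (fun x hx => (hder2 x (interior_subset hx)).differentiableAt.differentiableWithinAt) ?_
      intro x hx
      have hx := interior_subset hx
      rw [(hder2 x hx).deriv]
      have h1 : x * (2 * ⟪D x, deriv D x⟫_ℝ) = 2 * ⟪L (D x), D x⟫_ℝ := by
        rw [← hE x hx, real_inner_smul_left, real_inner_comm]; ring
      have h2 := hL (D x)
      rw [h1]
      push_cast at h2
      linarith
    intro x hx
    rcases lt_trichotomy x 0 with h | h | h
    · have := hanti hx h0 h.le
      simp only [zero_mul] at this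
      have h3 : ‖D x‖ ^ 2 = 0 := by nlinarith [sq_nonneg ‖D x‖]
      simpa using h3
    · have h1 := hE x hx
      rw [h, zero_smul] at h1
      have h2 := hL (D 0)
      rw [← h1, inner_zero_left] at h2
      push_cast at h2
      have h3 : ‖D 0‖ ^ 2 = 0 := by nlinarith [sq_nonneg ‖D 0‖]
      rw [h]
      simpa using h3
    · have := hanti h0 hx h.le
      simp only [zero_mul] at this
      have h3 : ‖D x‖ ^ 2 = 0 := by nlinarith [sq_nonneg ‖D x‖]
      simpa using h3
  | succ n ih =>
    intro L D hD hL hE hzero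
    have hder : ∀ x ∈ I, HasDerivAt D (deriv D x) x := fun x hx =>
      ((hD.contDiffAt (hI.mem_nhds hx)).differentiableAt (by simp)).hasDerivAt
    have hD1 : ContDiffOn ℝ ∞ (deriv D) I := ((contDiffOn_infty_iff_deriv_of_isOpen hI).1 hD).2
    have hder1 : ∀ x ∈ I, HasDerivAt (deriv D) (deriv (deriv D) x) x := fun x hx =>
      ((hD1.contDiffAt (hI.mem_nhds hx)).differentiableAt (by simp)).hasDerivAt
    have h1 : ∀ x ∈ I, deriv D x = 0 := by
      refine ih (L - ContinuousLinearMap.id ℝ F) (deriv D) hD1 (fun v => ?_) (fun x hx => ?_)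
        (fun x hx => ?_)
      · have := hL v
        push_cast at this
        simp only [sub_apply, ContinuousLinearMap.id_apply, inner_sub_left,
          real_inner_self_eq_norm_sq]
        linarith
      · have e1 := (hasDerivAt_id x).smul (hder1 x hx)
        have e2 := L.hasFDerivAt.comp_hasDerivAt x (hder x hx)
        have e3 := e1.unique (e2.congr_of_eventuallyEq
          (by filter_upwards [hI.mem_nhds hx] with t ht using hE t ht))
        simp only [id_eq, one_smul] at e3
        simp only [sub_apply, ContinuousLinearMap.id_apply]
        rw [← e3]
        abel
      · exact (hder x (hJI hx)).unique ((hasDerivAt_const x (0 : F)).congr_of_eventuallyEq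
          (by filter_upwards [hJ.mem_nhds hx] with t ht using hzero t ht))
    obtain ⟨y, hy⟩ := hJne
    intro x hx
    rw [eqOn_of_hasDerivAt_zero hI' (fun t ht => (hder t ht).congr_deriv (h1 t ht)) hx (hJI hy),
      hzero y hy]

/-- A symmetry with `a = 2x` gives the Euler equation `x D' = [A, D]/2 - 2 D` for the commutator
`D = [A, C]`, to which `euler_eq_zero` applies. -/
theorem commute_of_commute_on_dilation {I J : Set ℝ} (hI : IsOpen I) (hI' : I.OrdConnected)
    (h0 : (0 : ℝ) ∈ I) (hJ : IsOpen J) (hJI : J ⊆ I) (hJne : J.Nonempty)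
    {C : ℝ → Matrix (Fin m) (Fin m) ℝ} (hC : ContDiffOn ℝ ∞ C I)
    {A : Matrix (Fin m) (Fin m) ℝ} (hg : IsSymm I C (deriv C) ((0, 2, 0), A))
    (hcomm : ∀ x ∈ J, A * C x = C x * A) : ∀ x ∈ I, A * C x = C x * A := by
  let ad : Matrix (Fin m) (Fin m) ℝ →ₗ[ℝ] Matrix (Fin m) (Fin m) ℝ :=
    LinearMap.mulLeft ℝ A - LinearMap.mulRight ℝ A
  have had : ∀ M, ad M = A * M - M * A := fun M => rfl
  let e : Matrix (Fin m) (Fin m) ℝ ≃L[ℝ] _ := toEuclidean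
  let E : Matrix (Fin m) (Fin m) ℝ →L[ℝ] _ :=
    e.toContinuousLinearMap.comp (LinearMap.toContinuousLinearMap ad)
  have hE : ∀ M, E M = e (A * M - M * A) := fun M => rfl
  let L := e.toContinuousLinearMap.comp
    ((LinearMap.toContinuousLinearMap ((1 / 2 : ℝ) • ad - (2 : ℝ) • LinearMap.id)).comp
      e.symm.toContinuousLinearMap)
  have hLE : ∀ M, L (e M) = e ((1 / 2 : ℝ) • (A * M - M * A) - (2 : ℝ) • M) := by
    intro M
    simp [L, had]
  obtain ⟨n, hn⟩ := exists_nat_ge (‖L‖ + 1 / 2)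
  have hder := hC.hasDerivAt_deriv hI
  have key := euler_eq_zero hI hI' h0 hJ hJI hJne n L (fun x => E (C x))
    (E.contDiff.comp_contDiffOn hC) (fun v => ?_) (fun x hx => ?_) (fun x hx => ?_)
  · intro x hx
    have := key x hx
    rw [hE, map_eq_zero_iff _ e.injective, sub_eq_zero] at this
    exact this
  · calc inner ℝ (L v) v ≤ ‖L v‖ * ‖v‖ := real_inner_le_norm _ _
      _ ≤ (‖L‖ * ‖v‖) * ‖v‖ := by gcongr; exact L.le_opNorm v
      _ = ‖L‖ * ‖v‖ ^ 2 := by ring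
      _ ≤ (n - 1 / 2) * ‖v‖ ^ 2 := by gcongr; linarith
  · have h1 : HasDerivAt (fun x => E (C x)) (E (deriv C x)) x :=
      E.hasFDerivAt.comp_hasDerivAt x (hder x hx)
    have h2 := hg x hx
    simp only [quad, quadDeriv] at h2
    rw [h1.deriv, hE, hE, hLE, ← map_smul]
    congr 1
    have h3 := congrArg (fun M => A * M - M * A) h2
    simp only [mul_add, add_mul, mul_sub, sub_mul, smul_mul_assoc, mul_smul_comm, mul_zero,
      zero_mul, sub_zero, ← mul_assoc] at h3
    simp only [mul_sub, sub_mul, ← mul_assoc]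
    linear_combination (norm := module) (1 / 2 : ℝ) • h3
  · rw [hE, hcomm x hx, sub_self, map_zero]

/-! ### The second prolongation -/

/-- The second prolongation in terms of the first two derivatives of the vector field. -/
theorem prolong₂_eq {I : Set ℝ} (hI : IsOpen I) {X : PointField m}
    (hX : ContDiffOn ℝ ∞ X (I ×ˢ Set.univ)) {x : ℝ} (hx : x ∈ I) (y p q : Fin m → ℝ) :
    prolong₂ X x y p q =
      (fderiv ℝ (fderiv ℝ X) (x, y) (1, p) (1, p) + fderiv ℝ X (x, y) (0, q)).2 -
      (fderiv ℝ (fderiv ℝ X) (x, y) (1, p) (1, p) + fderiv ℝ X (x, y) (0, q)).1 • p -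
      (2 * (fderiv ℝ X (x, y) (1, p)).1) • q := by
  have hopen : IsOpen (I ×ˢ (Set.univ : Set (Fin m → ℝ))) := hI.prod isOpen_univ
  have hd : ∀ z : BaseSpace m, z.1 ∈ I → DifferentiableAt ℝ X z := fun z hz =>
    (hX.contDiffAt (hopen.mem_nhds ⟨hz, Set.mem_univ _⟩)).differentiableAt (by simp)
  have h1 : ∀ z : BaseSpace m, z.1 ∈ I → ∀ w, fderiv ℝ (fun z => (X z).1) z w =
      (fderiv ℝ X z w).1 := by
    intro z hz w
    rw [fderiv.fst (hd z hz)]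
    rfl
  have h2 : ∀ z : BaseSpace m, z.1 ∈ I → ∀ w, fderiv ℝ (fun z => (X z).2) z w =
      (fderiv ℝ X z w).2 := by
    intro z hz w
    rw [fderiv.snd (hd z hz)]
    rfl
  have hdd : HasFDerivAt (fderiv ℝ X) (fderiv ℝ (fderiv ℝ X) (x, y)) (x, y) := by
    have : ContDiffAt ℝ 1 (fderiv ℝ X) (x, y) :=
      (hX.contDiffAt (hopen.mem_nhds ⟨hx, Set.mem_univ _⟩)).fderiv_right (by norm_cast)
    exact (this.differentiableAt (by simp)).hasFDerivAt
  have hbase : HasFDerivAt (fun j : ℝ × (Fin m → ℝ) × (Fin m → ℝ) => ((j.1, j.2.1) : BaseSpace m))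
      ((ContinuousLinearMap.fst ℝ ℝ _).prod ((ContinuousLinearMap.fst ℝ _ _).comp
        (ContinuousLinearMap.snd ℝ ℝ _))) (x, y, p) :=
    hasFDerivAt_fst.prodMk (hasFDerivAt_fst.comp (x, y, p) hasFDerivAt_snd)
  have hvel : HasFDerivAt
      (fun j : ℝ × (Fin m → ℝ) × (Fin m → ℝ) => (((1 : ℝ), j.2.2) : BaseSpace m))
      ((0 : _ →L[ℝ] ℝ).prod ((ContinuousLinearMap.snd ℝ _ _).comp
        (ContinuousLinearMap.snd ℝ ℝ _))) (x, y, p) :=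
    (hasFDerivAt_const _ _).prodMk (hasFDerivAt_snd.comp (x, y, p) hasFDerivAt_snd)
  have hp : HasFDerivAt (fun j : ℝ × (Fin m → ℝ) × (Fin m → ℝ) => j.2.2)
      ((ContinuousLinearMap.snd ℝ _ _).comp (ContinuousLinearMap.snd ℝ ℝ _)) (x, y, p) :=
    hasFDerivAt_snd.comp (x, y, p) hasFDerivAt_snd
  have hcomp := HasFDerivAt.comp (x, y, p) (f := fun j : ℝ × (Fin m → ℝ) × (Fin m → ℝ) =>
    ((j.1, j.2.1) : BaseSpace m)) (g := fderiv ℝ X) hdd hbase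
  have hF := hcomp.clm_apply hvel
  have hP := (hasFDerivAt_snd.comp (x, y, p) hF).sub
    ((hasFDerivAt_fst.comp (x, y, p) hF).smul hp)
  have hev : prolong₁ X =ᶠ[nhds (x, y, p)] fun j =>
      (fderiv ℝ X (j.1, j.2.1) (1, j.2.2)).2 - (fderiv ℝ X (j.1, j.2.1) (1, j.2.2)).1 • j.2.2 := by
    filter_upwards [(hI.preimage continuous_fst).mem_nhds (show (x, y, p) ∈ _ from hx)] with j hj
    rw [prolong₁, h1 (j.1, j.2.1) hj, h2 (j.1, j.2.1) hj]
  rw [prolong₂, h1 _ hx, hev.fderiv_eq]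
  erw [hP.fderiv]
  simp only [FunLike.coe_sub, Pi.sub_apply, ContinuousLinearMap.comp_apply,
    add_apply, smul_apply]
  simp
  module

theorem fderiv_mulVec_apply {C : ℝ → Matrix (Fin m) (Fin m) ℝ}
    {C₁ : Matrix (Fin m) (Fin m) ℝ} {x : ℝ} (h : HasDerivAt C C₁ x) (y : Fin m → ℝ)
    (w : BaseSpace m) :
    fderiv ℝ (fun z : BaseSpace m => C z.1 *ᵥ z.2) (x, y) w = w.1 • (C₁ *ᵥ y) + C x *ᵥ w.2 := by
  have hent : ∀ i, HasFDerivAt (fun z : BaseSpace m => ∑ j, C z.1 i j * z.2 j)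
      (∑ j, (C x i j • ((ContinuousLinearMap.proj j).comp (ContinuousLinearMap.snd ℝ ℝ _)) +
        y j • (C₁ i j • ContinuousLinearMap.fst ℝ ℝ (Fin m → ℝ)))) (x, y) := by
    intro i
    refine HasFDerivAt.fun_sum fun j _ => ?_
    have h1 : HasFDerivAt (fun z : BaseSpace m => C z.1 i j)
        (C₁ i j • ContinuousLinearMap.fst ℝ ℝ (Fin m → ℝ)) (x, y) :=
      HasDerivAt.comp_hasFDerivAt (f := fun z : BaseSpace m => z.1) (x, y)
        (h.matrix_linear (Matrix.entryLinearMap ℝ ℝ i j)) hasFDerivAt_fst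
    have h2 : HasFDerivAt (fun z : BaseSpace m => z.2 j)
        ((ContinuousLinearMap.proj j).comp (ContinuousLinearMap.snd ℝ ℝ (Fin m → ℝ))) (x, y) :=
      ((ContinuousLinearMap.proj (R := ℝ) (φ := fun _ : Fin m => ℝ) j).comp
        (ContinuousLinearMap.snd ℝ ℝ (Fin m → ℝ))).hasFDerivAt
    exact h1.mul h2
  have hpi := hasFDerivAt_pi.2 hent
  have : fderiv ℝ (fun z : BaseSpace m => C z.1 *ᵥ z.2) (x, y) = _ := hpi.fderiv
  rw [this]
  ext i
  simp [Matrix.mulVec, dotProduct, Finset.sum_add_distrib, Finset.mul_sum]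
  rw [add_comm]
  congr 1
  exact Finset.sum_congr rfl fun j _ => by ring

theorem hasDerivAt_fderiv_apply {X : PointField m} {γ : ℝ → BaseSpace m} {t : ℝ}
    {v : BaseSpace m} (hX : ContDiffAt ℝ 2 X (γ t)) (hγ : HasDerivAt γ v t) (w : BaseSpace m) :
    HasDerivAt (fun s => fderiv ℝ X (γ s) w) (fderiv ℝ (fderiv ℝ X) (γ t) v w) t := by
  have h1 : ContDiffAt ℝ 1 (fderiv ℝ X) (γ t) := hX.fderiv_right (by norm_num)
  have h2 := (h1.differentiableAt (by simp)).hasFDerivAt.comp_hasDerivAt t hγ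
  simpa using h2.clm_apply (hasDerivAt_const t w)

theorem hasDerivAt_comp_field {X : PointField m} {γ : ℝ → BaseSpace m} {t : ℝ}
    {v : BaseSpace m} (hX : ContDiffAt ℝ 2 X (γ t)) (hγ : HasDerivAt γ v t) :
    HasDerivAt (fun s => X (γ s)) (fderiv ℝ X (γ t) v) t :=
  (hX.differentiableAt (by simp)).hasFDerivAt.comp_hasDerivAt t hγ

theorem hasDerivAt_line (y p : Fin m → ℝ) (t : ℝ) :
    HasDerivAt (fun s : ℝ => y + s • p) p t := by
  simpa using ((hasDerivAt_id t).smul_const p).const_add y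

theorem admits_genField_iff {I : Set ℝ} (hI : IsOpen I) {C C₁ : ℝ → Matrix (Fin m) (Fin m) ℝ}
    (hC : ∀ x ∈ I, HasDerivAt C (C₁ x) x) (g : (ℝ × ℝ × ℝ) × Matrix (Fin m) (Fin m) ℝ) :
    Admits I C (genField g) ↔ IsSymm I C C₁ g := by
  have hsmooth : ContDiffOn ℝ ∞ (genField g) (I ×ˢ Set.univ) := (contDiff_genField g).contDiffOn
  have hD : ∀ z w, fderiv ℝ (genField g) z w = (quadDeriv g.1 z.1 * w.1,
      (g.1.2.2 * w.1) • z.2 + (quadDeriv g.1 z.1 / 2) • w.2 + g.2 *ᵥ w.2) := by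
    intro z w
    obtain ⟨L, hL, eL⟩ := hasFDerivAt_genField g z
    rw [hL.fderiv, eL]
  have hD2 : ∀ x y p, fderiv ℝ (fderiv ℝ (genField g)) (x, y) (1, p) (1, p) =
      (2 * g.1.2.2, (2 * g.1.2.2) • p) := by
    intro x y p
    have h1 : HasDerivAt (fun t : ℝ => ((t, y + (t - x) • p) : BaseSpace m)) (1, p) x :=
      (hasDerivAt_id x).prodMk
        (by simpa using (((hasDerivAt_id x).sub_const x).smul_const p).const_add y)
    have h2 := hasDerivAt_fderiv_apply (X := genField g)
      ((contDiff_genField g).contDiffAt.of_le (by norm_cast)) h1 (1, p)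
    have h3 : HasDerivAt (fun t : ℝ => ((quadDeriv g.1 t * 1,
        (g.1.2.2 * 1) • (y + (t - x) • p) + (quadDeriv g.1 t / 2) • p + g.2 *ᵥ p) : BaseSpace m))
        (2 * g.1.2.2 * 1, (g.1.2.2 * 1) • p + (2 * g.1.2.2 / 2) • p) x := by
      refine ((hasDerivAt_quadDeriv g.1 x).mul_const 1).prodMk ?_
      refine ((HasDerivAt.const_smul (g.1.2.2 * 1) ?_).add
        (((hasDerivAt_quadDeriv g.1 x).div_const 2).smul_const p)).add_const _
      simpa using (((hasDerivAt_id x).sub_const x).smul_const p).const_add y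
    simp only [hD] at h2
    have h4 := h2.unique h3
    simp only [sub_self, zero_smul, add_zero] at h4
    rw [h4]
    refine Prod.ext (by simp) ?_
    simp only
    module
  rw [Admits, IsSymm]
  simp only [hsmooth, true_and]
  refine forall₂_congr fun x hx => ?_
  have hform : ∀ y p, prolong₂ (genField g) x y p (C x *ᵥ y) -
      fderiv ℝ (fun z : BaseSpace m => C z.1 *ᵥ z.2) (x, y) (genField g (x, y)) =
      -((quad g.1 x • C₁ x + (2 * quadDeriv g.1 x) • C x + (C x * g.2 - g.2 * C x)) *ᵥ y) := by
    intro y p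
    rw [prolong₂_eq hI hsmooth hx, fderiv_mulVec_apply (hC x hx), hD2, hD, hD]
    simp only [genField, Prod.mk_add_mk, Matrix.add_mulVec, Matrix.sub_mulVec,
      Matrix.smul_mulVec, Matrix.mulVec_add, Matrix.mulVec_smul, Matrix.mulVec_mulVec]
    module
  constructor
  · intro h
    ext i j
    have h1 := h (Pi.single j 1) 0
    rw [hform, neg_eq_zero, Matrix.mulVec_single_one] at h1
    exact congrFun h1 i
  · intro h y p
    rw [hform, h]
    simp

/-! ### The determining equations -/

/-- The condition of invariance is a cubic polynomial in the velocity `p`; these are its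
coefficients, in decreasing order. -/
theorem determining_equations {I : Set ℝ} (hI : IsOpen I) {C C₁ : ℝ → Matrix (Fin m) (Fin m) ℝ}
    (hC : ∀ x ∈ I, HasDerivAt C (C₁ x) x) {X : PointField m} (hX : Admits I C X)
    {x : ℝ} (hx : x ∈ I) (y p : Fin m → ℝ) :
    (fderiv ℝ (fderiv ℝ X) (x, y) (0, p) (0, p)).1 = 0 ∧
    (fderiv ℝ (fderiv ℝ X) (x, y) (0, p) (0, p)).2 =
      (2 * (fderiv ℝ (fderiv ℝ X) (x, y) (1, 0) (0, p)).1) • p ∧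
    (2 : ℝ) • (fderiv ℝ (fderiv ℝ X) (x, y) (1, 0) (0, p)).2 -
      (fderiv ℝ (fderiv ℝ X) (x, y) (1, 0) (1, 0) + fderiv ℝ X (x, y) (0, C x *ᵥ y)).1 • p -
      (2 * (fderiv ℝ X (x, y) (0, p)).1) • (C x *ᵥ y) = 0 ∧
    (fderiv ℝ (fderiv ℝ X) (x, y) (1, 0) (1, 0) + fderiv ℝ X (x, y) (0, C x *ᵥ y)).2 -
      (2 * (fderiv ℝ X (x, y) (1, 0)).1) • (C x *ᵥ y) -
      ((X (x, y)).1 • (C₁ x *ᵥ y) + C x *ᵥ (X (x, y)).2) = 0 := by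
  obtain ⟨hsmooth, hadm⟩ := hX
  have hat : ContDiffAt ℝ ∞ X (x, y) :=
    hsmooth.contDiffAt ((hI.prod isOpen_univ).mem_nhds ⟨hx, Set.mem_univ _⟩)
  have hsymm : IsSymmSndFDerivAt ℝ X (x, y) := hat.isSymmSndFDerivAt (by
    rw [minSmoothness_of_isRCLikeNormedField]
    norm_cast)
  set D := fderiv ℝ X (x, y) with hD
  set D2 := fderiv ℝ (fderiv ℝ X) (x, y) with hD2
  set q := C x *ᵥ y with hq
  have hs : D2 (0, p) (1, 0) = D2 (1, 0) (0, p) := hsymm _ _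
  have e1 : ∀ s : ℝ, ((1 : ℝ), s • p) = ((1, 0) : BaseSpace m) + s • ((0, p) : BaseSpace m) := by
    intro s; simp
  have key : ∀ s : ℝ,
      ((D2 (1, 0) (1, 0) + D (0, q)).2 - (2 * (D (1, 0)).1) • q -
        ((X (x, y)).1 • (C₁ x *ᵥ y) + C x *ᵥ (X (x, y)).2)) +
      s • ((2 : ℝ) • (D2 (1, 0) (0, p)).2 - (D2 (1, 0) (1, 0) + D (0, q)).1 • p -
        (2 * (D (0, p)).1) • q) +
      s ^ 2 • ((D2 (0, p) (0, p)).2 - (2 * (D2 (1, 0) (0, p)).1) • p) +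
      s ^ 3 • (-((D2 (0, p) (0, p)).1 • p)) = 0 := by
    intro s
    have h := hadm x hx y (s • p)
    rw [prolong₂_eq hI hsmooth hx, fderiv_mulVec_apply (hC x hx), ← hD, ← hD2, ← hq, e1 s] at h
    simp only [map_add, map_smul, add_apply, smul_apply, hs, Prod.fst_add, Prod.snd_add,
      Prod.smul_fst, Prod.smul_snd, smul_eq_mul] at h
    simp only [Prod.fst_add, Prod.snd_add]
    linear_combination (norm := module) h
  -- a cubic polynomial that vanishes at `0`, `1`, `-1` and `2` is zero
  have k0 := key 0
  have k1 := key 1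
  have k2 := key (-1)
  have k3 := key 2
  simp only [ne_eq, OfNat.ofNat_ne_zero, not_false_eq_true, zero_pow, zero_smul, add_zero] at k0
  rw [k0] at k1 k2 k3
  have t3 : (D2 (0, p) (0, p)).1 • p = 0 := by
    linear_combination (norm := module) (1 / 2 : ℝ) • k1 + (1 / 6 : ℝ) • k2 - (1 / 6 : ℝ) • k3
  have t2 : (D2 (0, p) (0, p)).2 - (2 * (D2 (1, 0) (0, p)).1) • p = 0 := by
    linear_combination (norm := module) (1 / 2 : ℝ) • k1 + (1 / 2 : ℝ) • k2
  have t1 : (2 : ℝ) • (D2 (1, 0) (0, p)).2 - (D2 (1, 0) (1, 0) + D (0, q)).1 • p -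
      (2 * (D (0, p)).1) • q = 0 := by
    linear_combination (norm := module) k1 - t2 + t3
  refine ⟨?_, sub_eq_zero.1 t2, t1, k0⟩
  rcases smul_eq_zero.1 t3 with h | h
  · exact h
  · rw [h]
    have : ((0, 0) : BaseSpace m) = 0 := rfl
    simp [this]

theorem HasDerivAt.dotProduct_const {α : ℝ → Fin m → ℝ} {α₁ : Fin m → ℝ} {x : ℝ}
    (h : HasDerivAt α α₁ x) (y : Fin m → ℝ) :
    HasDerivAt (fun t => α t ⬝ᵥ y) (α₁ ⬝ᵥ y) x := by
  rw [hasDerivAt_pi] at h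
  exact HasDerivAt.fun_sum fun j _ => (h j).mul_const (y j)

/-- A function of `y` whose second derivative along each line through the origin is constant is
its second order Taylor polynomial. -/
theorem eq_taylor_of_hasDerivAt {F : Type*} [NormedAddCommGroup F] [NormedSpace ℝ F]
    {f f₁ : ℝ → F} {k : F} (h : ∀ t, HasDerivAt f (f₁ t) t) (h₁ : ∀ t, HasDerivAt f₁ k t) :
    f 1 = f 0 + f₁ 0 + (1 / 2 : ℝ) • k := by
  have e1 : ∀ t : ℝ, f₁ t = f₁ 0 + t • k := by
    intro t
    have := eqOn_of_hasDerivAt_zero (f := fun t => f₁ t - t • k) Set.ordConnected_univ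
      (fun s _ => ((h₁ s).sub ((hasDerivAt_id s).smul_const k)).congr_deriv (by simp))
      (Set.mem_univ t) (Set.mem_univ 0)
    simp only [zero_smul, sub_zero] at this
    rw [← this]; abel
  have := eqOn_of_hasDerivAt_zero (f := fun t : ℝ => f t - t • f₁ 0 - (t ^ 2 / 2) • k)
      Set.ordConnected_univ
      (fun s _ => (((h s).sub ((hasDerivAt_id s).smul_const (f₁ 0))).sub
        ((((hasDerivAt_id s).pow 2).div_const 2).smul_const k)).congr_deriv
          (by rw [e1 s]; simp))
      (Set.mem_univ 1) (Set.mem_univ 0)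
  simp only [one_smul, one_pow, zero_smul, sub_zero, ne_eq, OfNat.ofNat_ne_zero,
    not_false_eq_true, zero_pow, zero_div] at this
  rw [← this]; abel

theorem linear_fst_eq_dotProduct (L : BaseSpace m →L[ℝ] BaseSpace m) (y : Fin m → ℝ) :
    (L (0, y)).1 = (fun i => (L (0, Pi.single i 1)).1) ⬝ᵥ y := by
  let ℓ : (Fin m → ℝ) →ₗ[ℝ] ℝ :=
    (LinearMap.fst ℝ ℝ (Fin m → ℝ)).comp ((L : BaseSpace m →ₗ[ℝ] BaseSpace m).comp
      (LinearMap.inr ℝ ℝ (Fin m → ℝ)))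
  have h : ℓ y = _ := LinearMap.pi_apply_eq_sum_univ ℓ y
  have h2 : ∀ z, ℓ z = (L (0, z)).1 := fun z => rfl
  rw [h2] at h
  rw [h]
  simp only [dotProduct, smul_eq_mul, h2]
  refine Finset.sum_congr rfl fun i _ => ?_
  rw [mul_comm]
  congr 5
  ext j
  simp [Pi.single_apply, eq_comm]

theorem linear_snd_eq_mulVec (L : BaseSpace m →L[ℝ] BaseSpace m) (y : Fin m → ℝ) :
    (L (0, y)).2 = (Matrix.of fun i j => (L (0, Pi.single j 1)).2 i) *ᵥ y := by
  let ℓ : (Fin m → ℝ) →ₗ[ℝ] (Fin m → ℝ) :=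
    (LinearMap.snd ℝ ℝ (Fin m → ℝ)).comp ((L : BaseSpace m →ₗ[ℝ] BaseSpace m).comp
      (LinearMap.inr ℝ ℝ (Fin m → ℝ)))
  have h2 : ∀ z, ℓ z = (L (0, z)).2 := fun z => rfl
  have h3 : LinearMap.toMatrix' ℓ = Matrix.of fun i j => (L (0, Pi.single j 1)).2 i := by
    ext i j
    rw [LinearMap.toMatrix'_apply, h2]
    rfl
  rw [← h2, ← h3, LinearMap.toMatrix'_mulVec]

theorem HasDerivAt.fst_comp {f : ℝ → BaseSpace m} {f' : BaseSpace m} {t : ℝ}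
    (h : HasDerivAt f f' t) : HasDerivAt (fun s => (f s).1) f'.1 t :=
  (ContinuousLinearMap.fst ℝ ℝ (Fin m → ℝ)).hasFDerivAt.comp_hasDerivAt t h

theorem HasDerivAt.snd_comp {f : ℝ → BaseSpace m} {f' : BaseSpace m} {t : ℝ}
    (h : HasDerivAt f f' t) : HasDerivAt (fun s => (f s).2) f'.2 t :=
  (ContinuousLinearMap.snd ℝ ℝ (Fin m → ℝ)).hasFDerivAt.comp_hasDerivAt t h

theorem hasDerivAt_vertical (x : ℝ) (y p : Fin m → ℝ) (t : ℝ) :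
    HasDerivAt (fun s : ℝ => ((x, y + s • p) : BaseSpace m)) (0, p) t :=
  (hasDerivAt_const t x).prodMk (hasDerivAt_line y p t)

theorem hasDerivAt_horizontal (y : Fin m → ℝ) (x : ℝ) :
    HasDerivAt (fun s : ℝ => ((s, y) : BaseSpace m)) (1, 0) x :=
  (hasDerivAt_id x).prodMk (hasDerivAt_const x y)

/-- An admitted field is affine in `y` along `∂ₓ`, and its `y`-part is quadratic in `y` with a
quadratic part determined by the former. -/
theorem Admits.point_form {I : Set ℝ} (hI : IsOpen I) {C C₁ : ℝ → Matrix (Fin m) (Fin m) ℝ}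
    (hC : ∀ x ∈ I, HasDerivAt C (C₁ x) x) {X : PointField m} (hX : Admits I C X) :
    ∃ (a : ℝ → ℝ) (α h : ℝ → Fin m → ℝ) (B : ℝ → Matrix (Fin m) (Fin m) ℝ),
      ContDiffOn ℝ ∞ a I ∧ ContDiffOn ℝ ∞ α I ∧ ContDiffOn ℝ ∞ h I ∧ ContDiffOn ℝ ∞ B I ∧
      ∀ x ∈ I, ∀ y, X (x, y) =
        (a x + α x ⬝ᵥ y, h x + B x *ᵥ y + (deriv α x ⬝ᵥ y) • y) := by
  have hX2 : ∀ x ∈ I, ∀ y, ContDiffAt ℝ 2 X (x, y) := fun x hx y =>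
    (hX.1.contDiffAt ((hI.prod isOpen_univ).mem_nhds ⟨hx, Set.mem_univ _⟩)).of_le (by norm_cast)
  have hdet := fun x hx y p => determining_equations hI hC hX (x := x) hx y p
  have hsm : ∀ y : Fin m → ℝ, ContDiffOn ℝ ∞ (fun x => X (x, y)) I := fun y =>
    hX.1.comp (contDiff_id.prodMk contDiff_const).contDiffOn fun x hx => ⟨hx, Set.mem_univ _⟩
  have hsm1 : ∀ y : Fin m → ℝ, ContDiffOn ℝ ∞ (fun x => (X (x, y)).1) I := fun y => (hsm y).fst
  have hsm2 : ∀ y : Fin m → ℝ, ContDiffOn ℝ ∞ (fun x => (X (x, y)).2) I := fun y => (hsm y).snd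
  set α : ℝ → Fin m → ℝ := fun x i => (X (x, Pi.single i 1)).1 - (X (x, 0)).1 with hα
  have hαs : ContDiffOn ℝ ∞ α I := contDiffOn_pi.2 fun i => (hsm1 _).sub (hsm1 _)
  have hαd := hαs.hasDerivAt_deriv hI
  -- the function `t ↦ X (x, t y)` and its derivatives
  have hl0 : ∀ x ∈ I, ∀ y t, HasDerivAt (fun s : ℝ => X (x, 0 + s • y))
      (fderiv ℝ X (x, 0 + t • y) (0, y)) t := fun x hx y t =>
    hasDerivAt_comp_field (hX2 x hx _) (hasDerivAt_vertical x 0 y t)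
  have hl1 : ∀ x ∈ I, ∀ y t, HasDerivAt (fun s : ℝ => fderiv ℝ X (x, 0 + s • y) (0, y))
      (fderiv ℝ (fderiv ℝ X) (x, 0 + t • y) (0, y) (0, y)) t := fun x hx y t =>
    hasDerivAt_fderiv_apply (hX2 x hx _) (hasDerivAt_vertical x 0 y t) (0, y)
  have hfst_taylor : ∀ x ∈ I, ∀ y, (X (x, y)).1 = (X (x, 0)).1 + (fderiv ℝ X (x, 0) (0, y)).1 := by
    intro x hx y
    have := eq_taylor_of_hasDerivAt (fun t => (hl0 x hx y t).fst_comp)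
      (fun t => (hl1 x hx y t).fst_comp.congr_deriv (hdet x hx _ y).1)
    simpa using this
  have hfst : ∀ x ∈ I, ∀ y, (X (x, y)).1 = (X (x, 0)).1 + α x ⬝ᵥ y := by
    intro x hx y
    rw [hfst_taylor x hx y, linear_fst_eq_dotProduct]
    congr 2
    funext i
    simp only [hα]
    rw [hfst_taylor x hx (Pi.single i 1)]
    ring
  have hfst_vertical : ∀ x ∈ I, ∀ y p, (fderiv ℝ X (x, y) (0, p)).1 = α x ⬝ᵥ p := by
    intro x hx y p
    have h1 := (hasDerivAt_comp_field (t := 0) (hX2 x hx _)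
      (hasDerivAt_vertical x y p 0)).fst_comp
    simp only [zero_smul, add_zero] at h1
    have h2 : HasDerivAt (fun s : ℝ => (X (x, 0)).1 + α x ⬝ᵥ (y + s • p)) (α x ⬝ᵥ p) 0 := by
      simp only [dotProduct_add, dotProduct_smul, smul_eq_mul]
      simpa using (((hasDerivAt_id (0 : ℝ)).mul_const (α x ⬝ᵥ p)).const_add
        (α x ⬝ᵥ y)).const_add (X (x, 0)).1
    exact h1.unique (h2.congr_of_eventuallyEq (Filter.Eventually.of_forall fun s => hfst x hx _))
  have hfst_mixed : ∀ x ∈ I, ∀ y p, (fderiv ℝ (fderiv ℝ X) (x, y) (1, 0) (0, p)).1 =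
      deriv α x ⬝ᵥ p := by
    intro x hx y p
    have h1 := (hasDerivAt_fderiv_apply (hX2 x hx y) (hasDerivAt_horizontal y x) (0, p)).fst_comp
    refine h1.unique (((hαd x hx).dotProduct_const p).congr_of_eventuallyEq ?_)
    filter_upwards [hI.mem_nhds hx] with t ht using hfst_vertical t ht y p
  have hsnd_taylor : ∀ x ∈ I, ∀ y, (X (x, y)).2 =
      (X (x, 0)).2 + (fderiv ℝ X (x, 0) (0, y)).2 + (deriv α x ⬝ᵥ y) • y := by
    intro x hx y
    have := eq_taylor_of_hasDerivAt (fun t => (hl0 x hx y t).snd_comp)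
      (fun t => (hl1 x hx y t).snd_comp.congr_deriv
        ((hdet x hx _ y).2.1.trans (by rw [hfst_mixed x hx])))
    simpa [smul_smul] using this
  refine ⟨fun x => (X (x, 0)).1, α, fun x => (X (x, 0)).2,
    fun x => Matrix.of fun i j => (fderiv ℝ X (x, 0) (0, Pi.single j 1)).2 i,
    hsm1 0, hαs, hsm2 0, contDiffOn_matrix_of_entries fun i j => ?_, fun x hx y => ?_⟩
  · have h1 : ContDiffOn ℝ ∞ (fun x => (X (x, Pi.single j 1)).2 i - (X (x, 0)).2 i -
        deriv α x j * (Pi.single j 1 : Fin m → ℝ) i) I :=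
      ((contDiffOn_pi.1 (hsm2 _) i).sub (contDiffOn_pi.1 (hsm2 _) i)).sub
        ((contDiffOn_pi.1 (hαs.deriv_infty hI) j).mul contDiffOn_const)
    refine h1.congr fun x hx => ?_
    have := congrFun (hsnd_taylor x hx (Pi.single j 1)) i
    simp only [Pi.add_apply, Pi.smul_apply, dotProduct_single, mul_one, smul_eq_mul] at this
    simp only [Matrix.of_apply]
    rw [this]; ring
  · refine Prod.ext (hfst x hx y) ?_
    simp only
    rw [hsnd_taylor x hx y, linear_snd_eq_mulVec]

/-- The algebraic core of the linear determining equation: taking the traces over `p` and over `y`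
gives `u = 0`, and then `α ⊗ C = 0`. -/
theorem eq_zero_of_projective_equation (hm : 0 < m) {C : Matrix (Fin m) (Fin m) ℝ}
    (htr : C.trace = 0) {u α : Fin m → ℝ}
    (h : ∀ y p : Fin m → ℝ, (2 * (u ⬝ᵥ p)) • y + (u ⬝ᵥ y) • p - (α ⬝ᵥ (C *ᵥ y)) • p -
      (2 * (α ⬝ᵥ p)) • (C *ᵥ y) = 0) :
    u = 0 ∧ ∀ y p : Fin m → ℝ, (α ⬝ᵥ p) • (C *ᵥ y) = 0 := by
  have hv : ∀ y, α ⬝ᵥ (C *ᵥ y) = (α ᵥ* C) ⬝ᵥ y := fun y => Matrix.dotProduct_mulVec α C y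
  set v := α ᵥ* C with hvdef
  simp only [hv] at h
  have h1 : ∀ p : Fin m → ℝ, (2 * (m : ℝ) + 1) * (u ⬝ᵥ p) = v ⬝ᵥ p := by
    intro p
    have hs : ∑ j, ((2 * (u ⬝ᵥ p)) • (Pi.single j 1 : Fin m → ℝ) +
        (u ⬝ᵥ (Pi.single j 1 : Fin m → ℝ)) • p -
        (v ⬝ᵥ (Pi.single j 1 : Fin m → ℝ)) • p -
        (2 * (α ⬝ᵥ p)) • (C *ᵥ (Pi.single j 1 : Fin m → ℝ))) j = 0 :=
      Finset.sum_eq_zero fun j _ => congrFun (h (Pi.single j 1) p) j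
    simp only [Pi.add_apply, Pi.sub_apply, Pi.smul_apply, dotProduct_single, mul_one, smul_eq_mul,
      Pi.single_eq_same, Matrix.mulVec_single_one, Finset.sum_add_distrib, Finset.sum_sub_distrib,
      Finset.sum_const, Finset.card_univ, Fintype.card_fin, nsmul_eq_mul, ← Finset.mul_sum] at hs
    have e1 : ∑ j, C.col j j = 0 := htr
    rw [e1] at hs
    simp only [← dotProduct.eq_1] at hs
    linarith
  have h2 : ∀ y : Fin m → ℝ, u ⬝ᵥ y = v ⬝ᵥ y := by
    intro y
    have hs : ∑ j, ((2 * (u ⬝ᵥ (Pi.single j 1 : Fin m → ℝ))) • y +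
        (u ⬝ᵥ y) • (Pi.single j 1 : Fin m → ℝ) -
        (v ⬝ᵥ y) • (Pi.single j 1 : Fin m → ℝ) -
        (2 * (α ⬝ᵥ (Pi.single j 1 : Fin m → ℝ))) • (C *ᵥ y)) j = 0 :=
      Finset.sum_eq_zero fun j _ => congrFun (h y (Pi.single j 1)) j
    simp only [Pi.add_apply, Pi.sub_apply, Pi.smul_apply, dotProduct_single, mul_one, smul_eq_mul,
      Pi.single_eq_same, Finset.sum_add_distrib, Finset.sum_sub_distrib, mul_assoc,
      Finset.sum_const, Finset.card_univ, Fintype.card_fin, nsmul_eq_mul, ← Finset.mul_sum] at hs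
    simp only [← dotProduct.eq_1, hv] at hs
    have hm' : (0 : ℝ) < m := by exact_mod_cast hm
    have : ((m : ℝ) + 2) * (u ⬝ᵥ y - v ⬝ᵥ y) = 0 := by linarith
    rcases mul_eq_zero.1 this with h | h
    · linarith
    · linarith
  have hu : ∀ y : Fin m → ℝ, u ⬝ᵥ y = 0 := by
    intro y
    have hm' : (0 : ℝ) < m := by exact_mod_cast hm
    have e1 := h1 y
    rw [← h2 y] at e1
    have : (2 * (m : ℝ)) * (u ⬝ᵥ y) = 0 := by linarith
    rcases mul_eq_zero.1 this with h | h
    · linarith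
    · exact h
  refine ⟨by simpa using hu u, fun y p => ?_⟩
  have e := h y p
  rw [← h2 y, hu, hu] at e
  simpa [mul_smul] using e

theorem exists_quad_of_hasDerivAt {I : Set ℝ} (hI' : I.OrdConnected) {a a₁ a₂ : ℝ → ℝ}
    (h : ∀ x ∈ I, HasDerivAt a (a₁ x) x) (h₁ : ∀ x ∈ I, HasDerivAt a₁ (a₂ x) x)
    (h₂ : ∀ x ∈ I, HasDerivAt a₂ 0 x) :
    ∃ c : ℝ × ℝ × ℝ, ∀ x ∈ I, quad c x = a x ∧ quadDeriv c x = a₁ x := by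
  rcases I.eq_empty_or_nonempty with rfl | ⟨x₀, hx₀⟩
  · exact ⟨0, by simp⟩
  have e2 : ∀ x ∈ I, a₂ x = a₂ x₀ := fun x hx => eqOn_of_hasDerivAt_zero hI' h₂ hx hx₀
  have e1 : ∀ x ∈ I, a₁ x - a₂ x₀ * x = a₁ x₀ - a₂ x₀ * x₀ := fun x hx =>
    eqOn_of_hasDerivAt_zero (f := fun t => a₁ t - a₂ x₀ * t) hI'
      (fun t ht => ((h₁ t ht).sub ((hasDerivAt_id t).const_mul (a₂ x₀))).congr_deriv
        (by rw [e2 t ht]; simp)) hx hx₀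
  set c₁ := a₁ x₀ - a₂ x₀ * x₀ with hc₁
  have e0 : ∀ x ∈ I, a x - c₁ * x - a₂ x₀ / 2 * x ^ 2 = a x₀ - c₁ * x₀ - a₂ x₀ / 2 * x₀ ^ 2 :=
    fun x hx => eqOn_of_hasDerivAt_zero (f := fun t => a t - c₁ * t - a₂ x₀ / 2 * t ^ 2) hI'
      (fun t ht => (((h t ht).sub ((hasDerivAt_id t).const_mul c₁)).sub
        (((hasDerivAt_id t).pow 2).const_mul (a₂ x₀ / 2))).congr_deriv
        (by have := e1 t ht; simp; linarith)) hx hx₀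
  refine ⟨(a x₀ - c₁ * x₀ - a₂ x₀ / 2 * x₀ ^ 2, c₁, a₂ x₀ / 2), fun x hx => ⟨?_, ?_⟩⟩
  · simp only [quad]
    linarith [e0 x hx]
  · simp only [quadDeriv]
    linarith [e1 x hx]

theorem deriv_eq_zero_of_eqOn {F : Type*} [NormedAddCommGroup F] [NormedSpace ℝ F] {I : Set ℝ}
    (hI : IsOpen I) {f : ℝ → F} (h : ∀ x ∈ I, f x = 0) : ∀ x ∈ I, deriv f x = 0 := by
  intro x hx
  have : f =ᶠ[nhds x] fun _ => 0 := by filter_upwards [hI.mem_nhds hx] with t ht using h t ht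
  rw [this.deriv_eq]
  simp

/-- Every generator admitted by a nonzero system with trace zero is a quadratic generator plus a
solution. -/
theorem Admits.exists_genField (hm : 0 < m) {I : Set ℝ} (hI : IsOpen I) (hI' : I.OrdConnected)
    {C : ℝ → Matrix (Fin m) (Fin m) ℝ} (hC : ContDiffOn ℝ ∞ C I)
    (htr : ∀ x ∈ I, (C x).trace = 0) (hne : ∃ x ∈ I, C x ≠ 0) {X : PointField m}
    (hX : Admits I C X) :
    ∃ (g : (ℝ × ℝ × ℝ) × Matrix (Fin m) (Fin m) ℝ) (h : ℝ → Fin m → ℝ),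
      IsSymm I C (deriv C) g ∧ IsSolution I C h ∧
        ∀ x ∈ I, ∀ y, X (x, y) = genField g (x, y) + (0, h x) := by
  have hCd := hC.hasDerivAt_deriv hI
  obtain ⟨a, α, h, B, ha, hα, hh, hB, hform⟩ := hX.point_form hI hCd
  have hX2 : ∀ x ∈ I, ∀ y, ContDiffAt ℝ 2 X (x, y) := fun x hx y =>
    (hX.1.contDiffAt ((hI.prod isOpen_univ).mem_nhds ⟨hx, Set.mem_univ _⟩)).of_le (by norm_cast)
  have ha0 := ha.hasDerivAt_deriv hI
  have ha1 := (ha.deriv_infty hI).hasDerivAt_deriv hI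
  have ha2 := ((ha.deriv_infty hI).deriv_infty hI).hasDerivAt_deriv hI
  have hα0 := hα.hasDerivAt_deriv hI
  have hα1 := (hα.deriv_infty hI).hasDerivAt_deriv hI
  have hα2 := ((hα.deriv_infty hI).deriv_infty hI).hasDerivAt_deriv hI
  have hh0 := hh.hasDerivAt_deriv hI
  have hh1 := (hh.deriv_infty hI).hasDerivAt_deriv hI
  have hB0 := hB.hasDerivAt_deriv hI
  have hB1 := (hB.deriv_infty hI).hasDerivAt_deriv hI
  -- the derivatives of the field in the vertical and horizontal directions
  have D01 : ∀ x ∈ I, ∀ y p, fderiv ℝ X (x, y) (0, p) =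
      (α x ⬝ᵥ p, B x *ᵥ p + ((deriv α x ⬝ᵥ p) • y + (deriv α x ⬝ᵥ y) • p)) := by
    intro x hx y p
    have h1 := hasDerivAt_comp_field (t := 0) (hX2 x hx _) (hasDerivAt_vertical x y p 0)
    simp only [zero_smul, add_zero] at h1
    have h2 : HasDerivAt (fun s : ℝ => ((a x + (α x ⬝ᵥ y + s * (α x ⬝ᵥ p)),
        h x + (B x *ᵥ y + s • (B x *ᵥ p)) +
          (deriv α x ⬝ᵥ y + s * (deriv α x ⬝ᵥ p)) • (y + s • p)) : BaseSpace m))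
        (α x ⬝ᵥ p, B x *ᵥ p + ((deriv α x ⬝ᵥ p) • y + (deriv α x ⬝ᵥ y) • p)) 0 := by
      have e1 := (((hasDerivAt_id (0 : ℝ)).mul_const (α x ⬝ᵥ p)).const_add
        (α x ⬝ᵥ y)).const_add (a x)
      have e2 := (((hasDerivAt_id (0 : ℝ)).smul_const (B x *ᵥ p)).const_add
        (B x *ᵥ y)).const_add (h x)
      have e3 := (((hasDerivAt_id (0 : ℝ)).mul_const (deriv α x ⬝ᵥ p)).const_add
        (deriv α x ⬝ᵥ y)).smul (hasDerivAt_line y p 0)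
      refine (e1.prodMk (e2.add e3)).congr_deriv ?_
      refine Prod.ext (by simp) ?_
      simp only [id_eq]
      module
    refine h1.unique (h2.congr_of_eventuallyEq (Filter.Eventually.of_forall fun s => ?_))
    simp only [hform x hx, dotProduct_add, dotProduct_smul, Matrix.mulVec_add,
      Matrix.mulVec_smul, smul_eq_mul]
  have D10 : ∀ x ∈ I, ∀ y, fderiv ℝ X (x, y) (1, 0) =
      (deriv a x + deriv α x ⬝ᵥ y,
        deriv h x + deriv B x *ᵥ y + (deriv (deriv α) x ⬝ᵥ y) • y) := by
    intro x hx y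
    have h1 := hasDerivAt_comp_field (hX2 x hx y) (hasDerivAt_horizontal y x)
    refine h1.unique (HasDerivAt.congr_of_eventuallyEq ?_
      (by filter_upwards [hI.mem_nhds hx] with t ht using hform t ht y))
    refine ((ha0 x hx).add ((hα0 x hx).dotProduct_const y)).prodMk
      (((hh0 x hx).add ?_).add (((hα1 x hx).dotProduct_const y).smul_const y))
    exact (hB0 x hx).mulVec_const y
  have D1001 : ∀ x ∈ I, ∀ y p, fderiv ℝ (fderiv ℝ X) (x, y) (1, 0) (0, p) =
      (deriv α x ⬝ᵥ p, deriv B x *ᵥ p +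
        ((deriv (deriv α) x ⬝ᵥ p) • y + (deriv (deriv α) x ⬝ᵥ y) • p)) := by
    intro x hx y p
    have h1 := hasDerivAt_fderiv_apply (hX2 x hx y) (hasDerivAt_horizontal y x) (0, p)
    refine h1.unique (HasDerivAt.congr_of_eventuallyEq ?_
      (by filter_upwards [hI.mem_nhds hx] with t ht using D01 t ht y p))
    refine ((hα0 x hx).dotProduct_const p).prodMk (HasDerivAt.add ?_
      ((((hα1 x hx).dotProduct_const p).smul_const y).add
        (((hα1 x hx).dotProduct_const y).smul_const p)))
    exact (hB0 x hx).mulVec_const p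
  have D1010 : ∀ x ∈ I, ∀ y, fderiv ℝ (fderiv ℝ X) (x, y) (1, 0) (1, 0) =
      (deriv (deriv a) x + deriv (deriv α) x ⬝ᵥ y, deriv (deriv h) x + deriv (deriv B) x *ᵥ y +
        (deriv (deriv (deriv α)) x ⬝ᵥ y) • y) := by
    intro x hx y
    have h1 := hasDerivAt_fderiv_apply (hX2 x hx y) (hasDerivAt_horizontal y x) (1, 0)
    refine h1.unique (HasDerivAt.congr_of_eventuallyEq ?_
      (by filter_upwards [hI.mem_nhds hx] with t ht using D10 t ht y))
    refine ((ha1 x hx).add ((hα1 x hx).dotProduct_const y)).prodMk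
      (((hh1 x hx).add ?_).add (((hα2 x hx).dotProduct_const y).smul_const y))
    exact (hB1 x hx).mulVec_const y
  -- the equation linear in the velocity
  have hlinear : ∀ x ∈ I, ∀ y p, (2 : ℝ) • (deriv B x *ᵥ p +
      ((deriv (deriv α) x ⬝ᵥ p) • y + (deriv (deriv α) x ⬝ᵥ y) • p)) -
      (deriv (deriv a) x + deriv (deriv α) x ⬝ᵥ y + α x ⬝ᵥ (C x *ᵥ y)) • p -
      (2 * (α x ⬝ᵥ p)) • (C x *ᵥ y) = 0 := by
    intro x hx y p
    have := (determining_equations hI hCd hX hx y p).2.2.1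
    rw [D1001 x hx, D1010 x hx, D01 x hx, D01 x hx] at this
    exact this
  have hlinear_zero : ∀ x ∈ I, ∀ p, (2 : ℝ) • (deriv B x *ᵥ p) - deriv (deriv a) x • p = 0 := by
    intro x hx p
    simpa using hlinear x hx 0 p
  have hproj : ∀ x ∈ I, deriv (deriv α) x = 0 ∧
      ∀ y p : Fin m → ℝ, (α x ⬝ᵥ p) • (C x *ᵥ y) = 0 := by
    intro x hx
    refine eq_zero_of_projective_equation hm (htr x hx) fun y p => ?_
    linear_combination (norm := module) hlinear x hx y p - hlinear_zero x hx p
  -- `α` vanishes where `C ≠ 0`, and it is affine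
  have hα_zero : ∀ x ∈ I, α x = 0 := by
    obtain ⟨x₀, hx₀, hCne⟩ := hne
    have hev : ∀ᶠ t in nhds x₀, α t = 0 := by
      filter_upwards [hI.mem_nhds hx₀, (hCd x₀ hx₀).continuousAt.eventually_ne hCne] with t ht htC
      have h1 : ∀ y p : Fin m → ℝ, (α t ⬝ᵥ p) • (C t *ᵥ y) = 0 := (hproj t ht).2
      by_contra hαt
      refine htC (Matrix.ext_of_mulVec_single fun j => ?_)
      rcases smul_eq_zero.1 (h1 (Pi.single j 1) (α t)) with h2 | h2
      · exact absurd (dotProduct_self_eq_zero.1 h2) hαt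
      · rw [h2, Matrix.zero_mulVec]
    have h1 : deriv α x₀ = 0 := by
      have : α =ᶠ[nhds x₀] fun _ => 0 := hev
      rw [this.deriv_eq]; simp
    have h2 : ∀ x ∈ I, deriv α x = 0 := fun x hx => by
      rw [← h1]
      exact eqOn_of_hasDerivAt_zero hI'
        (fun t ht => (hα1 t ht).congr_deriv (hproj t ht).1) hx hx₀
    intro x hx
    rw [← hev.self_of_nhds]
    exact eqOn_of_hasDerivAt_zero hI' (fun t ht => (hα0 t ht).congr_deriv (h2 t ht)) hx hx₀
  have hα1_zero := deriv_eq_zero_of_eqOn hI hα_zero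
  have hα2_zero := deriv_eq_zero_of_eqOn hI hα1_zero
  have hα3_zero := deriv_eq_zero_of_eqOn hI hα2_zero
  have hconstant : ∀ x ∈ I, ∀ y, deriv (deriv h) x + deriv (deriv B) x *ᵥ y + B x *ᵥ (C x *ᵥ y) -
      (2 * deriv a x) • (C x *ᵥ y) - (a x • (deriv C x *ᵥ y) + C x *ᵥ (h x + B x *ᵥ y)) = 0 := by
    intro x hx y
    have := (determining_equations hI hCd hX hx y 0).2.2.2
    rw [D1010 x hx, D01 x hx, D10 x hx, hform x hx, hα_zero x hx, hα1_zero x hx, hα2_zero x hx,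
      hα3_zero x hx] at this
    simp only [zero_dotProduct, zero_smul, add_zero, Prod.mk_add_mk] at this
    exact this
  have hsol : ∀ x ∈ I, deriv (deriv h) x = C x *ᵥ h x := by
    intro x hx
    have := hconstant x hx 0
    simpa [sub_eq_zero] using this
  have hmat : ∀ x ∈ I, deriv (deriv B) x + B x * C x - (2 * deriv a x) • C x -
      (a x • deriv C x + C x * B x) = 0 := by
    intro x hx
    refine Matrix.ext_of_mulVec_single fun j => ?_
    have h1 := hconstant x hx (Pi.single j 1)
    have h2 := hsol x hx
    simp only [Matrix.add_mulVec, Matrix.sub_mulVec, Matrix.smul_mulVec, Matrix.mulVec_add,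
      ← Matrix.mulVec_mulVec, Matrix.zero_mulVec] at h1 ⊢
    linear_combination (norm := module) h1 - h2
  have hB1_eq : ∀ x ∈ I, deriv B x = (deriv (deriv a) x / 2) • 1 := by
    intro x hx
    refine Matrix.ext_of_mulVec_single fun j => ?_
    have h1 := hlinear_zero x hx (Pi.single j 1)
    rw [Matrix.smul_mulVec, Matrix.one_mulVec]
    linear_combination (norm := module) (1 / 2 : ℝ) • h1
  have hB2_eq : ∀ x ∈ I, deriv (deriv B) x = (deriv (deriv (deriv a)) x / 2) • 1 := by
    intro x hx
    refine (hB1 x hx).unique ((((ha2 x hx).div_const 2).smul_const 1).congr_of_eventuallyEq ?_)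
    filter_upwards [hI.mem_nhds hx] with t ht using hB1_eq t ht
  -- the trace of the constant part
  have ha3 : ∀ x ∈ I, deriv (deriv (deriv a)) x = 0 := by
    intro x hx
    have htr1 : (deriv C x).trace = 0 :=
      (hasDerivAt_matrix_trace (hCd x hx)).unique
        ((hasDerivAt_const x (0 : ℝ)).congr_of_eventuallyEq (by
          filter_upwards [hI.mem_nhds hx] with t ht using htr t ht))
    have h1 := congrArg Matrix.trace (hmat x hx)
    rw [hB2_eq x hx] at h1
    simp only [Matrix.trace_add, Matrix.trace_sub, Matrix.trace_smul, htr x hx, htr1,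
      Matrix.trace_mul_comm (C x) (B x), Matrix.trace_one, Fintype.card_fin,
      Matrix.trace_zero, smul_eq_mul, mul_zero, zero_add] at h1
    have hm' : (m : ℝ) ≠ 0 := by exact_mod_cast hm.ne'
    have h2 : deriv (deriv (deriv a)) x / 2 * m = 0 := by linarith
    rcases mul_eq_zero.1 h2 with h3 | h3
    · linarith
    · exact absurd h3 hm'
  obtain ⟨c, hc⟩ := exists_quad_of_hasDerivAt hI' ha0 ha1
    (fun x hx => (ha2 x hx).congr_deriv (ha3 x hx))
  obtain ⟨x₀, hx₀, -⟩ := hne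
  have hBconst : ∀ x ∈ I, B x - (deriv a x / 2) • (1 : Matrix (Fin m) (Fin m) ℝ) =
      B x₀ - (deriv a x₀ / 2) • (1 : Matrix (Fin m) (Fin m) ℝ) := fun x hx =>
    eqOn_of_hasDerivAt_zero (f := fun t => B t - (deriv a t / 2) • (1 : Matrix (Fin m) (Fin m) ℝ))
      hI' (fun t ht => ((hB0 t ht).sub (((ha1 t ht).div_const 2).smul_const 1)).congr_deriv
        (sub_eq_zero.2 (hB1_eq t ht))) hx hx₀
  set A := B x₀ - (deriv a x₀ / 2) • (1 : Matrix (Fin m) (Fin m) ℝ) with hA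
  have hBA : ∀ x ∈ I, B x = (deriv a x / 2) • 1 + A := fun x hx => by
    rw [← hBconst x hx]; abel
  refine ⟨(c, A), h, fun x hx => ?_, ⟨deriv h, fun x hx => ⟨hh0 x hx, ?_⟩⟩, fun x hx y => ?_⟩
  · have h1 := hmat x hx
    rw [hB2_eq x hx, ha3 x hx, hBA x hx] at h1
    simp only [(hc x hx).1, (hc x hx).2]
    simp only [add_mul, mul_add, smul_mul_assoc, mul_smul_comm, one_mul, mul_one] at h1
    linear_combination (norm := module) -h1
  · exact (hh1 x hx).congr_deriv (hsol x hx)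
  · rw [hform x hx, hα_zero x hx, hα1_zero x hx, hBA x hx]
    refine Prod.ext ?_ ?_
    · simp [genField, (hc x hx).1]
    · simp only [genField, (hc x hx).2, Prod.snd_add, zero_dotProduct, zero_smul, add_zero,
        Matrix.add_mulVec, Matrix.smul_mulVec, Matrix.one_mulVec]
      abel

/-! ### The one-, two- and three-dimensional cases -/

theorem genField_injective : Function.Injective (genField (m := m)) := by
  intro g g' h
  have hq : ∀ x, quad g.1 x = quad g'.1 x := fun x => congrArg Prod.fst (congrFun h (x, 0))
  have h0 := hq 0
  have h1 := hq 1
  have h2 := hq (-1)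
  simp only [quad] at h0 h1 h2
  have e : g.1 = g'.1 :=
    Prod.ext (by linarith) (Prod.ext (by linarith) (by linarith))
  refine Prod.ext e (Matrix.ext_of_mulVec_single fun j => ?_)
  have h3 : (quadDeriv g.1 0 / 2) • (Pi.single j 1 : Fin m → ℝ) + g.2 *ᵥ Pi.single j 1 =
      (quadDeriv g'.1 0 / 2) • (Pi.single j 1 : Fin m → ℝ) + g'.2 *ᵥ Pi.single j 1 :=
    congrArg Prod.snd (congrFun h (0, Pi.single j 1))
  rw [e] at h3
  exact add_left_cancel h3

/-- Of the three polynomials, only `2x` can have a zero, and only at `0`. -/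
theorem commute_of_commute_on {I J : Set ℝ} (hI : IsOpen I) (hI' : I.OrdConnected)
    (hJ : IsOpen J) (hJne : J.Nonempty) (hJI : J ⊆ I) {C : ℝ → Matrix (Fin m) (Fin m) ℝ}
    (hC : ContDiffOn ℝ ∞ C I) {g : (ℝ × ℝ × ℝ) × Matrix (Fin m) (Fin m) ℝ}
    (hg : IsSymm I C (deriv C) g)
    (hcase : g.1 = (0, 2, 0) ∨ g.1 = (1, 0, 0) ∨ g.1 = (1, 0, 1))
    (hcomm : ∀ x ∈ J, g.2 * C x = C x * g.2) : ∀ x ∈ I, g.2 * C x = C x * g.2 := by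
  obtain ⟨y, hy⟩ := hJne
  by_cases hz : ∀ x ∈ I, quad g.1 x ≠ 0
  · exact commute_of_commute_at hI hI' (hC.hasDerivAt_deriv hI) hg hz (hJI hy) (hcomm y hy)
  · push Not at hz
    obtain ⟨x₀, hx₀, h0⟩ := hz
    rcases hcase with h | h | h
    · have hx : x₀ = 0 := by
        rw [h] at h0
        simpa [quad] using h0
      rw [hx] at hx₀
      have : g = ((0, 2, 0), g.2) := Prod.ext h rfl
      rw [this] at hg
      exact commute_of_commute_on_dilation hI hI' hx₀ hJ hJI ⟨y, hy⟩ hC hg hcomm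
    · rw [h] at h0
      simp [quad] at h0
    · rw [h] at h0
      simp only [quad] at h0
      nlinarith [sq_nonneg x₀]

theorem caseA_of_isSymm {J : Set ℝ} (hJ : IsOpen J) (hJ' : J.OrdConnected)
    {C C₁ : ℝ → Matrix (Fin m) (Fin m) ℝ} (hC : ∀ x ∈ J, HasDerivAt C (C₁ x) x)
    {g : (ℝ × ℝ × ℝ) × Matrix (Fin m) (Fin m) ℝ} (hg : IsSymm J C C₁ g)
    (hc : ∀ x ∈ J, quad g.1 x ≠ 0) {φ : ℝ → ℝ} (hφ : ∀ x ∈ J, HasDerivAt φ (quad g.1 x)⁻¹ x)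
    {x₀ : ℝ} (hx₀ : x₀ ∈ J) (hne : g.2 * C x₀ ≠ C x₀ * g.2) :
    ∃ C₀, CaseA (φ '' J) (straightMatrix J g.1 φ C) g.2 C₀ := by
  have hexp := hasExpForm_of_hasDerivAt (ordConnected_image_of_hasDerivAt_inv_quad hJ' hφ)
    ((isSymm_straightMatrix hJ' hg hc hφ).hasDerivAt_of_translation
      (hasDerivAt_straightMatrix hJ hJ' hc hφ hC)) ⟨x₀, hx₀, rfl⟩
  refine ⟨_, hexp, ?_⟩
  rw [sub_ne_zero]
  intro h
  exact hne ((mul_straightMatrix_comm_iff hJ' hc hφ C g.2 hx₀).1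
    ((mul_comm_of_hasExpForm hexp ⟨x₀, hx₀, rfl⟩).2 h.symm))

theorem straighten_of_admits {I J : Set ℝ} (hI : IsOpen I) (hI' : I.OrdConnected)
    (hJ : IsOpen J) (hJ' : J.OrdConnected) (hJne : J.Nonempty) (hJI : J ⊆ I)
    {C : ℝ → Matrix (Fin m) (Fin m) ℝ} (hC : ContDiffOn ℝ ∞ C I)
    (hred : ¬ ReducesToConstant I C) {g : (ℝ × ℝ × ℝ) × Matrix (Fin m) (Fin m) ℝ}
    (hcase : g.1 = (0, 2, 0) ∨ g.1 = (1, 0, 0) ∨ g.1 = (1, 0, 1)) (hg : Admits I C (genField g))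
    (hc : ∀ x ∈ J, quad g.1 x ≠ 0) :
    ∃ (T : EquivTransf m J) (C' : ℝ → Matrix (Fin m) (Fin m) ℝ)
      (A' C₀ : Matrix (Fin m) (Fin m) ℝ),
      T.Carries C C' ∧ CaseA (T.φ '' J) C' A' C₀ ∧
        T.Pushes (genField g) (genX₃ m + genXA A') ∧
        Admits (T.φ '' J) C' (genX₃ m + genXA A') := by
  have hder := hC.hasDerivAt_deriv hI
  have hgI : IsSymm I C (deriv C) g := (admits_genField_iff hI hder g).1 hg
  have hgJ : IsSymm J C (deriv C) g := fun x hx => hgI x (hJI hx)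
  have hderJ : ∀ x ∈ J, HasDerivAt C (deriv C x) x := fun x hx => hder x (hJI hx)
  obtain ⟨x₀, hx₀, hne⟩ : ∃ x ∈ J, g.2 * C x ≠ C x * g.2 := by
    by_contra! hcomm
    refine hred (reducesToConstant_of_isSymm_of_commute hI hI' hder hgI ?_
      (commute_of_commute_on hI hI' hJ hJne hJI hC hgI hcase hcomm))
    rcases hcase with h | h | h <;> simp [h]
  obtain ⟨φ, hφ⟩ := exists_hasDerivAt_inv_quad hJ hJ' hc
  obtain ⟨C₀, hC₀⟩ := caseA_of_isSymm hJ hJ' hderJ hgJ hc hφ hx₀ hne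
  refine ⟨straighten m hJ hc hφ, straightMatrix J g.1 φ C, g.2, C₀,
    straighten_carries hJ hJ' hc hφ C, hC₀, ?_, ?_⟩
  · rw [genX₃_add_genXA]
    exact straighten_pushes hJ hc hφ (b := g.1) (β := (1, 0, 0)) (B := g.2)
      (fun x _ => by simp [quad]) (h := 0) (k := 0) (by simp) (by simp) (by simp)
  · rw [genX₃_add_genXA]
    exact (admits_genField_iff (isOpen_image_of_hasDerivAt_inv_quad hJ hc hφ)
      (hasDerivAt_straightMatrix hJ hJ' hc hφ hderJ) _).2 (isSymm_straightMatrix hJ' hgJ hc hφ)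

/-- Comparing coefficients, the bracket of the two generators can only be `-2 (X₃ + X_{A₃})`. -/
theorem caseB_of_admitsLieAlgebra {I : Set ℝ} (hI : IsOpen I) (hI' : I.OrdConnected)
    {C : ℝ → Matrix (Fin m) (Fin m) ℝ} (hC : ContDiffOn ℝ ∞ C I)
    (htr : ∀ x ∈ I, (C x).trace = 0) (hred : ¬ ReducesToConstant I C)
    {A₂ A₃ : Matrix (Fin m) (Fin m) ℝ}
    (h : AdmitsLieAlgebra I C (Submodule.span ℝ {genX₂ m + genXA A₂, genX₃ m + genXA A₃})) :
    ∃ C₀, CaseB I C A₂ A₃ C₀ := by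
  simp only [genX₂_add_genXA, genX₃_add_genXA] at h
  have hder := hC.hasDerivAt_deriv hI
  have m2 := Submodule.subset_span (R := ℝ) (Set.mem_insert (genField ((0, 2, 0), A₂))
    {genField ((1, 0, 0), A₃)})
  have m3 := Submodule.subset_span (R := ℝ) (Set.mem_insert_of_mem (genField ((0, 2, 0), A₂))
    (Set.mem_singleton (genField ((1, 0, 0), A₃))))
  have h2 := (admits_genField_iff hI hder _).1 (h.1 _ m2)
  have h3 := (admits_genField_iff hI hder _).1 (h.1 _ m3)
  have hbr := h.2 _ m2 _ m3
  rw [lieBracket_genField, Submodule.mem_span_pair] at hbr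
  obtain ⟨r, s, hrs⟩ := hbr
  rw [← genField_smul, ← genField_smul, ← genField_add] at hrs
  have e := genField_injective hrs
  simp only [quadBracket, Prod.smul_mk, Prod.mk_add_mk, Prod.mk.injEq, smul_eq_mul] at e
  obtain ⟨⟨e1, e2, -⟩, e4⟩ := e
  have hr : r = 0 := by linarith
  have hs : s = -2 := by linarith
  obtain ⟨x₀, hx₀, -, hne⟩ := exists_not_commute hI hI' hder hred h3 (by simp)
  refine caseB_of_isSymm hI' hder h2 h3 ?_ htr hx₀ hne
  rw [hr, hs] at e4
  linear_combination (norm := module) e4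

/-- The generators have independent polynomials, so each bracket is the combination that its
polynomial prescribes. -/
theorem caseC_of_admitsLieAlgebra {I : Set ℝ} (hI : IsOpen I) (hI' : I.OrdConnected)
    {C : ℝ → Matrix (Fin m) (Fin m) ℝ} (hC : ContDiffOn ℝ ∞ C I)
    (htr : ∀ x ∈ I, (C x).trace = 0) (hred : ¬ ReducesToConstant I C)
    {A₁ A₂ A₃ : Matrix (Fin m) (Fin m) ℝ}
    (h : AdmitsLieAlgebra I C
      (Submodule.span ℝ {genX₁ m + genXA A₁, genX₂ m + genXA A₂, genX₃ m + genXA A₃})) :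
    ∃ C₀, CaseC I C A₁ A₂ A₃ C₀ := by
  simp only [genX₁_add_genXA, genX₂_add_genXA, genX₃_add_genXA] at h
  have hder := hC.hasDerivAt_deriv hI
  set L := Submodule.span ℝ {genField ((0, 0, 1), A₁), genField ((0, 2, 0), A₂),
    genField ((1, 0, 0), A₃)} with hL
  have m1 : genField ((0, 0, 1), A₁) ∈ L := Submodule.subset_span (by simp)
  have m2 : genField ((0, 2, 0), A₂) ∈ L := Submodule.subset_span (by simp)
  have m3 : genField ((1, 0, 0), A₃) ∈ L := Submodule.subset_span (by simp)
  have h1 := (admits_genField_iff hI hder _).1 (h.1 _ m1)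
  have h2 := (admits_genField_iff hI hder _).1 (h.1 _ m2)
  have h3 := (admits_genField_iff hI hder _).1 (h.1 _ m3)
  have key : ∀ g : (ℝ × ℝ × ℝ) × Matrix (Fin m) (Fin m) ℝ, genField g ∈ L →
      g.2 = g.1.2.2 • A₁ + (g.1.2.1 / 2) • A₂ + g.1.1 • A₃ := by
    intro g hg
    rw [hL, Submodule.mem_span_triple] at hg
    obtain ⟨r, s, t, hrs⟩ := hg
    simp only [← genField_smul, ← genField_add] at hrs
    have e := genField_injective hrs
    rw [← e]
    simp
  have k23 := key _ (by simpa only [lieBracket_genField] using h.2 _ m2 _ m3)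
  have k13 := key _ (by simpa only [lieBracket_genField] using h.2 _ m1 _ m3)
  have k12 := key _ (by simpa only [lieBracket_genField] using h.2 _ m1 _ m2)
  simp only [quadBracket] at k23 k13 k12
  obtain ⟨x₀, hx₀, -, hne⟩ := exists_not_commute hI hI' hder hred h3 (by simp)
  refine caseC_of_isSymm hI' hder h1 h2 h3 ?_ ?_ ?_ htr hx₀ hne
  · linear_combination (norm := module) -k12
  · linear_combination (norm := module) -k13
  · linear_combination (norm := module) -k23

/-! ### Matrices commuting with an irreducible system -/

/-- A basis of `ℝᵐ` that consists of a basis of `W`, indexed by the complement of `S`, and of a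
basis of a complementary subspace, indexed by `S`. -/
theorem exists_basis_adapted (W : Submodule ℝ (Fin m → ℝ)) (hbot : W ≠ ⊥) (htop : W ≠ ⊤) :
    ∃ (b : Module.Basis (Fin m) ℝ (Fin m → ℝ)) (S : Finset (Fin m)), S.Nonempty ∧ S ≠ Finset.univ ∧
      (∀ j ∉ S, b j ∈ W) ∧ ∀ w ∈ W, ∀ i ∈ S, b.repr w i = 0 := by
  obtain ⟨W', hW'⟩ := Submodule.exists_isCompl W
  let bW := Module.finBasis ℝ W
  let bW' := Module.finBasis ℝ W'
  let b₀ := (bW.prod bW').map (Submodule.prodEquivOfIsCompl W W' hW')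
  have hcard : Fintype.card (Fin (Module.finrank ℝ W) ⊕ Fin (Module.finrank ℝ W')) = m := by
    simpa using (Module.finrank_eq_card_basis b₀).symm
  let e := Fintype.equivFinOfCardEq hcard
  have hinl : ∀ i, b₀ (Sum.inl i) ∈ W := by
    intro i
    simp [b₀]
  have hinr : ∀ w ∈ W, ∀ i, b₀.repr w (Sum.inr i) = 0 := by
    intro w hw i
    have : (Submodule.prodEquivOfIsCompl W W' hW').symm w = (⟨w, hw⟩, 0) :=
      Submodule.prodEquivOfIsCompl_symm_apply_left W W' hW' ⟨w, hw⟩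
    simp [b₀, this]
  have hW0 : 0 < Module.finrank ℝ W := by
    rw [Nat.pos_iff_ne_zero, Ne, Submodule.finrank_eq_zero]
    exact hbot
  have hW'0 : 0 < Module.finrank ℝ W' := by
    rw [Nat.pos_iff_ne_zero, Ne, Submodule.finrank_eq_zero]
    rintro rfl
    exact htop (by simpa using hW'.sup_eq_top)
  refine ⟨b₀.reindex e, Finset.univ.filter fun i => (e.symm i).isRight,
    ⟨e (Sum.inr ⟨0, hW'0⟩), by simp⟩, ?_, ?_, ?_⟩
  · intro h
    have : e (Sum.inl ⟨0, hW0⟩) ∈ Finset.univ.filter fun i => (e.symm i).isRight := by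
      rw [h]; simp
    simp at this
  · intro j hj
    rw [Module.Basis.reindex_apply]
    rcases hj' : e.symm j with i | i
    · exact hinl i
    · simp [hj'] at hj
  · intro w hw i hi
    rw [Module.Basis.repr_reindex_apply]
    rcases hi' : e.symm i with k | k
    · simp [hi'] at hi
    · exact hinr w hw k

/-- In a basis adapted to an invariant subspace `W`, the coordinates that vanish on `W` satisfy a
system of their own. -/
theorem reducesToSubsystem_of_invariant {I : Set ℝ} (hI : IsOpen I)
    {C : ℝ → Matrix (Fin m) (Fin m) ℝ}
    (W : Submodule ℝ (Fin m → ℝ)) (hbot : W ≠ ⊥) (htop : W ≠ ⊤)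
    (hW : ∀ x ∈ I, ∀ w ∈ W, C x *ᵥ w ∈ W) : ReducesToSubsystem I C := by
  obtain ⟨b, S, hS, hS', hbW, hrepr⟩ := exists_basis_adapted W hbot htop
  set P := LinearMap.toMatrix' (b.equivFun : (Fin m → ℝ) →ₗ[ℝ] (Fin m → ℝ)) with hP
  set Q := LinearMap.toMatrix' (b.equivFun.symm : (Fin m → ℝ) →ₗ[ℝ] (Fin m → ℝ)) with hQ
  have hPv : ∀ v, P *ᵥ v = b.equivFun v := fun v => LinearMap.toMatrix'_mulVec _ v
  have hQv : ∀ v, Q *ᵥ v = b.equivFun.symm v := fun v => LinearMap.toMatrix'_mulVec _ v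
  have hPQ : P * Q = 1 := by
    refine Matrix.ext_of_mulVec_single fun j => ?_
    rw [← Matrix.mulVec_mulVec, hPv, hQv, LinearEquiv.apply_symm_apply, Matrix.one_mulVec]
  have hQP : Q * P = 1 := by
    refine Matrix.ext_of_mulVec_single fun j => ?_
    rw [← Matrix.mulVec_mulVec, hPv, hQv, LinearEquiv.symm_apply_apply, Matrix.one_mulVec]
  let T : EquivTransf m I :=
    { φ := id, ψ := fun _ => 1, P := ⟨P, Q, hPQ, hQP⟩, smooth_φ := contDiffOn_id,
      smooth_ψ := contDiffOn_const, deriv_φ_ne := by simp, ψ_ne := by simp, compat := by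
        intro x _
        have : deriv (id : ℝ → ℝ) = fun _ => 1 := by funext; simp
        simp [this] }
  refine ⟨T, fun x => P * C x * Q, ?_, S, hS, hS', ?_⟩
  · intro u v huv
    have hv : ∀ x ∈ I, v x = P *ᵥ u x := by
      intro x hx
      have := (Prod.ext_iff.1 (huv x hx)).2
      simpa [T, EquivTransf.toMap] using this
    have hu : ∀ x ∈ I, u x = Q *ᵥ v x := by
      intro x hx
      rw [hv x hx, Matrix.mulVec_mulVec, hQP, Matrix.one_mulVec]
    constructor
    · rintro ⟨w, hw⟩
      refine ⟨fun x => P *ᵥ w x, ?_⟩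
      rintro _ ⟨x, hx, rfl⟩
      refine ⟨((hw x hx).1.const_mulVec P).congr_of_eventuallyEq
        (by filter_upwards [hI.mem_nhds hx] with t ht using hv t ht), ?_⟩
      refine ((hw x hx).2.const_mulVec P).congr_deriv ?_
      change _ = (P * C x * Q) *ᵥ v x
      rw [← Matrix.mulVec_mulVec, ← Matrix.mulVec_mulVec, ← hu x hx]
    · rintro ⟨w, hw⟩
      refine ⟨fun x => Q *ᵥ w x, fun x hx => ?_⟩
      obtain ⟨h1, h2⟩ := hw x ⟨x, hx, rfl⟩
      refine ⟨(h1.const_mulVec Q).congr_of_eventuallyEq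
        (by filter_upwards [hI.mem_nhds hx] with t ht using hu t ht), ?_⟩
      refine (h2.const_mulVec Q).congr_deriv ?_
      rw [hu x hx, Matrix.mulVec_mulVec, Matrix.mulVec_mulVec, ← mul_assoc, ← mul_assoc, hQP,
        one_mul]
  · rintro _ ⟨x, hx, rfl⟩ i hi j hj
    have h1 : (P * C x * Q) i j = ((P * C x * Q) *ᵥ Pi.single j 1) i := by
      rw [Matrix.mulVec_single_one]; rfl
    have h2 : b.equivFun.symm (Pi.single j 1) = b j := by
      simp [Module.Basis.equivFun_symm_apply, Pi.single_apply]
    change (P * C x * Q) i j = 0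
    rw [h1, ← Matrix.mulVec_mulVec, ← Matrix.mulVec_mulVec, hPv, hQv, h2]
    exact hrepr _ (hW x hx _ (hbW j hj)) i hi

theorem exists_isRoot_of_odd_natDegree {p : Polynomial ℝ} (hp : p.Monic)
    (hodd : Odd p.natDegree) : ∃ x, p.IsRoot x := by
  have hdeg : 0 < p.degree := Polynomial.natDegree_pos_iff_degree_pos.1 hodd.pos
  have h1 : Filter.Tendsto (fun x => p.eval x) Filter.atTop Filter.atTop :=
    p.tendsto_atTop_of_leadingCoeff_nonneg hdeg (by rw [hp.leadingCoeff]; exact zero_le_one)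
  set q := -(p.comp (-Polynomial.X)) with hq
  have hqdeg : q.natDegree = p.natDegree := by
    rw [hq, Polynomial.natDegree_neg, Polynomial.natDegree_comp]
    simp
  have hqlead : q.leadingCoeff = 1 := by
    rw [hq, Polynomial.leadingCoeff_neg, Polynomial.leadingCoeff_comp (by simp)]
    simp [hp.leadingCoeff, hodd.neg_one_pow]
  have h2 : Filter.Tendsto (fun x => q.eval x) Filter.atTop Filter.atTop :=
    q.tendsto_atTop_of_leadingCoeff_nonneg
      (Polynomial.natDegree_pos_iff_degree_pos.1 (by rw [hqdeg]; exact hodd.pos))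
      (by rw [hqlead]; exact zero_le_one)
  obtain ⟨x₁, hx₁⟩ := (h1.eventually_ge_atTop 0).exists
  obtain ⟨x₂, hx₂⟩ := (h2.eventually_ge_atTop 0).exists
  have hx₂' : p.eval (-x₂) ≤ 0 := by
    have : q.eval x₂ = -p.eval (-x₂) := by simp [hq]
    linarith
  exact mem_range_of_exists_le_of_exists_ge p.continuous ⟨-x₂, hx₂'⟩ ⟨x₁, hx₁⟩

/-- Schur's lemma for odd `m`: a commuting matrix has a real eigenvalue, and its eigenspace is
invariant. -/
theorem eq_smul_one_of_commute {I : Set ℝ} (hI : IsOpen I) {C : ℝ → Matrix (Fin m) (Fin m) ℝ}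
    (hm : Odd m) (hred : ¬ ReducesToSubsystem I C) {A : Matrix (Fin m) (Fin m) ℝ}
    (hA : ∀ x ∈ I, A * C x = C x * A) : ∃ r : ℝ, A = r • 1 := by
  obtain ⟨r, hr⟩ := exists_isRoot_of_odd_natDegree (Matrix.charpoly_monic A)
    (by rw [Matrix.charpoly_natDegree_eq_dim]; simpa using hm)
  have hdet : (A - r • 1).det = 0 := by
    have h1 : (Matrix.scalar (Fin m) r - A).det = 0 := by
      rw [← Matrix.eval_charpoly]; exact hr
    have h2 : A - r • 1 = -(Matrix.scalar (Fin m) r - A) := by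
      rw [Matrix.scalar_apply, ← Matrix.smul_one_eq_diagonal]; abel
    rw [h2, Matrix.det_neg, h1, mul_zero]
  obtain ⟨v, hv0, hv⟩ := Matrix.exists_mulVec_eq_zero_iff.2 hdet
  by_contra hne
  push Not at hne
  refine hred (reducesToSubsystem_of_invariant hI (LinearMap.ker (Matrix.mulVecLin (A - r • 1)))
    ?_ ?_ ?_)
  · intro h
    have : v ∈ LinearMap.ker (Matrix.mulVecLin (A - r • 1)) := hv
    rw [h] at this
    exact hv0 this
  · intro h
    refine hne r (sub_eq_zero.1 (Matrix.ext_of_mulVec_single fun j => ?_))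
    have : (Pi.single j 1 : Fin m → ℝ) ∈ LinearMap.ker (Matrix.mulVecLin (A - r • 1)) := by
      rw [h]; trivial
    rw [Matrix.zero_mulVec]
    exact this
  · intro x hx w hw
    have hw' : (A - r • 1) *ᵥ w = 0 := hw
    change (A - r • 1) *ᵥ (C x *ᵥ w) = 0
    have hc : (A - r • 1) * C x = C x * (A - r • 1) := by
      rw [sub_mul, mul_sub, hA x hx]; simp
    rw [Matrix.mulVec_mulVec, hc, ← Matrix.mulVec_mulVec, hw', Matrix.mulVec_zero]

/-! ### Lie algebras of quadratic polynomials -/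

/-- The Lie algebra of quadratic polynomials is `sl₂(ℝ)`: a nonzero subalgebra is a line, the
algebra of polynomials with a common root `r ∈ ℝ ∪ {∞}`, or everything. If `a`, `b` span a plane,
then `w = ab' - a'b` is orthogonal to it under the polar form of the discriminant. As `w` lies in
the plane, it is isotropic, that is, it has a double root `r`, and orthogonality to `w` means
vanishing at `r`. -/
theorem quadBracket_subalgebra_classification (V : Submodule ℝ (ℝ × ℝ × ℝ)) (hV : V ≠ ⊥)
    (hbr : ∀ a ∈ V, ∀ b ∈ V, quadBracket a b ∈ V) :
    (∃ c ∈ V, c ≠ 0 ∧ ∀ b ∈ V, ∃ r : ℝ, b = r • c) ∨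
    (∃ e₂ ∈ V, ∃ e₃ ∈ V, ((e₃ = (1, 0, 0) ∧ e₂ = (0, 2, 0)) ∨
      ∃ r : ℝ, e₃ = (r ^ 2, -2 * r, 1) ∧ e₂ = (2 * r, -2, 0)) ∧
      ∀ b ∈ V, ∃ s t : ℝ, b = s • e₂ + t • e₃) ∨
    V = ⊤ := by
  let det : ℝ × ℝ × ℝ → ℝ × ℝ × ℝ → ℝ × ℝ × ℝ → ℝ := fun a b c =>
    a.1 * (b.2.1 * c.2.2 - b.2.2 * c.2.1) - a.2.1 * (b.1 * c.2.2 - b.2.2 * c.1) +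
      a.2.2 * (b.1 * c.2.1 - b.2.1 * c.1)
  by_cases h3 : ∃ a ∈ V, ∃ b ∈ V, ∃ c ∈ V, det a b c ≠ 0
  · obtain ⟨a, ha, b, hb, c, hc, hd⟩ := h3
    refine Or.inr (Or.inr (Submodule.eq_top_iff'.2 fun v => ?_))
    -- Cramer's rule
    have hv : v = (det v b c / det a b c) • a + (det a v c / det a b c) • b +
        (det a b v / det a b c) • c := by
      refine Prod.ext ?_ (Prod.ext ?_ ?_)
      all_goals
        simp only [Prod.fst_add, Prod.snd_add, Prod.smul_fst, Prod.smul_snd, smul_eq_mul]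
        field_simp
        simp only [det]
        ring
    rw [hv]
    exact V.add_mem (V.add_mem (V.smul_mem _ ha) (V.smul_mem _ hb)) (V.smul_mem _ hc)
  push Not at h3
  obtain ⟨a, ha, ha0⟩ := Submodule.exists_mem_ne_zero_of_ne_bot hV
  by_cases h1 : ∀ b ∈ V, ∃ r : ℝ, b = r • a
  · exact Or.inl ⟨a, ha, ha0, h1⟩
  push Not at h1
  obtain ⟨b, hb, hbne⟩ := h1
  refine Or.inr (Or.inl ?_)
  obtain ⟨a₀, a₁, a₂⟩ := a
  obtain ⟨b₀, b₁, b₂⟩ := b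
  obtain ⟨w, hwdef⟩ : ∃ w, w = quadBracket (a₀, a₁, a₂) (b₀, b₁, b₂) := ⟨_, rfl⟩
  have hw : w ∈ V := hwdef ▸ hbr _ ha _ hb
  obtain ⟨w₀, w₁, w₂⟩ := w
  simp only [quadBracket, Prod.mk.injEq] at hwdef
  obtain ⟨hw0, hw1, hw2⟩ := hwdef
  have horth : ∀ v ∈ V, v.1 * w₂ - v.2.1 * w₁ / 2 + v.2.2 * w₀ = 0 := by
    intro v hv
    rw [← h3 _ ha _ hb v hv, hw0, hw1, hw2]
    simp only [det]
    ring
  have hne : ¬ (w₀ = 0 ∧ w₁ = 0 ∧ w₂ = 0) := by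
    rintro ⟨e0, e1, e2⟩
    rw [e0] at hw0
    rw [e1] at hw1
    rw [e2] at hw2
    by_cases k0 : a₀ = 0
    · by_cases k1 : a₁ = 0
      · have k2 : a₂ ≠ 0 := by
          rintro rfl
          exact ha0 (by simp [k0, k1])
        refine hbne (b₂ / a₂) (Prod.ext ?_ (Prod.ext ?_ ?_))
        all_goals
          simp only [Prod.smul_fst, Prod.smul_snd, smul_eq_mul]
          field_simp
          try nlinarith
      · refine hbne (b₁ / a₁) (Prod.ext ?_ (Prod.ext ?_ ?_))
        all_goals
          simp only [Prod.smul_fst, Prod.smul_snd, smul_eq_mul]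
          field_simp
          try linarith
    · refine hbne (b₀ / a₀) (Prod.ext ?_ (Prod.ext ?_ ?_))
      all_goals
        simp only [Prod.smul_fst, Prod.smul_snd, smul_eq_mul]
        field_simp
        try linarith
  have hww := horth _ hw
  simp only at hww
  by_cases k2 : w₂ = 0
  · -- the common root is `∞`
    have k1 : w₁ = 0 := by
      rw [k2] at hww
      have : w₁ * w₁ = 0 := by linarith
      simpa using this
    have k0 : w₀ ≠ 0 := fun h => hne ⟨h, k1, k2⟩
    have hv2 : ∀ v ∈ V, v.2.2 = 0 := by
      intro v hv
      have := horth v hv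
      rw [k1, k2] at this
      have h4 : v.2.2 * w₀ = 0 := by linarith
      exact (mul_eq_zero.1 h4).resolve_right k0
    have he3 : ((1, 0, 0) : ℝ × ℝ × ℝ) ∈ V := by
      have := V.smul_mem w₀⁻¹ hw
      simpa [k0, k1, k2] using this
    obtain ⟨u, hu, hu1⟩ : ∃ u ∈ V, u.2.1 ≠ 0 := by
      by_contra! hcon
      have e1 : a₁ = 0 := hcon _ ha
      have e2 : b₁ = 0 := hcon _ hb
      rw [e1, e2] at hw0
      exact k0 (by rw [hw0]; ring)
    have he2 : ((0, 2, 0) : ℝ × ℝ × ℝ) ∈ V := by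
      have := V.smul_mem (2 / u.2.1) (V.sub_mem hu (V.smul_mem u.1 he3))
      convert this using 1
      have := hv2 u hu
      refine Prod.ext ?_ (Prod.ext ?_ ?_)
      · simp
      · simp [hu1]
      · simp [this]
    refine ⟨_, he2, _, he3, Or.inl ⟨rfl, rfl⟩, fun v hv => ⟨v.2.1 / 2, v.1, ?_⟩⟩
    refine Prod.ext ?_ (Prod.ext ?_ ?_)
    · simp
    · simp
    · simp [hv2 v hv]
  · -- the common root is `r = -w₁ / (2 w₂)`
    obtain ⟨r, hr⟩ : ∃ r, w₁ = -2 * r * w₂ := ⟨-w₁ / (2 * w₂), by field_simp⟩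
    have hr0 : w₀ = r ^ 2 * w₂ := by
      rw [hr] at hww
      have : w₂ * (w₀ - r ^ 2 * w₂) = 0 := by linarith
      linarith [(mul_eq_zero.1 this).resolve_left k2]
    have hroot : ∀ v ∈ V, v.1 = -r * v.2.1 - r ^ 2 * v.2.2 := by
      intro v hv
      have := horth v hv
      rw [hr, hr0] at this
      have h4 : w₂ * (v.1 + r * v.2.1 + r ^ 2 * v.2.2) = 0 := by linarith
      linarith [(mul_eq_zero.1 h4).resolve_left k2]
    have he3 : ((r ^ 2, -2 * r, 1) : ℝ × ℝ × ℝ) ∈ V := by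
      have := V.smul_mem w₂⁻¹ hw
      convert this using 1
      refine Prod.ext ?_ (Prod.ext ?_ ?_)
      · simp [hr0]; field_simp
      · simp [hr]; field_simp
      · simp [k2]
    obtain ⟨u, hu, hu1⟩ : ∃ u ∈ V, u.2.1 + 2 * r * u.2.2 ≠ 0 := by
      by_contra! hcon
      have e1 : a₁ + 2 * r * a₂ = 0 := hcon _ ha
      have e2 : b₁ + 2 * r * b₂ = 0 := hcon _ hb
      refine k2 ?_
      rw [hw2]
      linear_combination b₂ * e1 - a₂ * e2
    have he2 : ((2 * r, -2, 0) : ℝ × ℝ × ℝ) ∈ V := by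
      have := V.smul_mem (-2 / (u.2.1 + 2 * r * u.2.2)) (V.sub_mem hu (V.smul_mem u.2.2 he3))
      convert this using 1
      have := hroot u hu
      refine Prod.ext ?_ (Prod.ext ?_ ?_)
      · simp only [Prod.smul_fst, Prod.fst_sub, smul_eq_mul, this]
        field_simp
        ring
      · simp only [Prod.smul_fst, Prod.smul_snd, Prod.snd_sub, Prod.fst_sub, smul_eq_mul]
        field_simp
        ring
      · simp
    refine ⟨_, he2, _, he3, Or.inr ⟨r, rfl, rfl⟩, fun v hv =>
      ⟨-(v.2.1 + 2 * r * v.2.2) / 2, v.2.2, ?_⟩⟩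
    refine Prod.ext ?_ (Prod.ext ?_ ?_)
    · simp only [Prod.fst_add, Prod.smul_fst, smul_eq_mul, hroot v hv]
      ring
    · simp only [Prod.snd_add, Prod.fst_add, Prod.smul_fst, Prod.smul_snd, smul_eq_mul]
      ring
    · simp

/-! ### The Lie algebra of all generators -/

/-- The symmetries with traceless matrix part; they represent the admitted generators modulo the
trivial ones. -/
def tracelessSymm (I : Set ℝ) (C C₁ : ℝ → Matrix (Fin m) (Fin m) ℝ) :
    Submodule ℝ ((ℝ × ℝ × ℝ) × Matrix (Fin m) (Fin m) ℝ) where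
  carrier := {g | IsSymm I C C₁ g ∧ g.2.trace = 0}
  add_mem' := fun {g h} hg hh => ⟨hg.1.add hh.1, by simp [hg.2, hh.2]⟩
  zero_mem' := ⟨fun x _ => by simp [quad, quadDeriv], by simp⟩
  smul_mem' := fun r g hg => ⟨hg.1.smul r, by simp [hg.2]⟩

theorem quadBracket_mem_tracelessSymm {I : Set ℝ} (hI : IsOpen I)
    {C : ℝ → Matrix (Fin m) (Fin m) ℝ} (hC : ContDiffOn ℝ ∞ C I)
    {g h : (ℝ × ℝ × ℝ) × Matrix (Fin m) (Fin m) ℝ} (hg : g ∈ tracelessSymm I C (deriv C))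
    (hh : h ∈ tracelessSymm I C (deriv C)) :
    (quadBracket g.1 h.1, h.2 * g.2 - g.2 * h.2) ∈ tracelessSymm I C (deriv C) := by
  refine ⟨IsSymm.bracket hI (hC.hasDerivAt_deriv hI) ((hC.deriv_infty hI).hasDerivAt_deriv hI)
    hg.1 hh.1, ?_⟩
  simp only [Matrix.trace_sub, Matrix.trace_mul_comm h.2 g.2, sub_self]

/-- A traceless symmetry is determined by its quadratic polynomial: the difference of two matrices
belonging to the same polynomial commutes with `C`, so it is scalar, and its trace is zero. -/
theorem tracelessSymm_ext (hm : Odd m) {I : Set ℝ} (hI : IsOpen I)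
    {C C₁ : ℝ → Matrix (Fin m) (Fin m) ℝ} (hred : ¬ ReducesToSubsystem I C)
    {g h : (ℝ × ℝ × ℝ) × Matrix (Fin m) (Fin m) ℝ} (hg : g ∈ tracelessSymm I C C₁)
    (hh : h ∈ tracelessSymm I C C₁) (hgh : g.1 = h.1) : g.2 = h.2 := by
  obtain ⟨h1, h2⟩ := (tracelessSymm I C C₁).sub_mem hg hh
  obtain ⟨r, hr⟩ := eq_smul_one_of_commute hI hm hred (A := g.2 - h.2) fun x hx => by
    have := h1 x hx
    simp only [Prod.fst_sub, Prod.snd_sub, hgh, sub_self, quad, quadDeriv, Prod.fst_zero,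
      Prod.snd_zero, zero_mul, mul_zero, add_zero, zero_smul, zero_add] at this
    exact (sub_eq_zero.1 this).symm
  simp only [Prod.snd_sub, hr, Matrix.trace_smul, Matrix.trace_one, Fintype.card_fin,
    smul_eq_mul] at h2
  have hm' : (m : ℝ) ≠ 0 := by exact_mod_cast hm.pos.ne'
  rw [(mul_eq_zero.1 h2).resolve_right hm', zero_smul] at hr
  exact sub_eq_zero.1 hr

theorem Admits.exists_tracelessSymm (hm : 0 < m) {I : Set ℝ} (hI : IsOpen I)
    (hI' : I.OrdConnected) {C : ℝ → Matrix (Fin m) (Fin m) ℝ} (hC : ContDiffOn ℝ ∞ C I)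
    (htr : ∀ x ∈ I, (C x).trace = 0) (hne : ∃ x ∈ I, C x ≠ 0) {X : PointField m}
    (hX : Admits I C X) :
    ∃ g ∈ tracelessSymm I C (deriv C), ∃ (r : ℝ) (h : ℝ → Fin m → ℝ), IsSolution I C h ∧
      ∀ x ∈ I, ∀ y, X (x, y) = genField (g.1, g.2 + r • 1) (x, y) + (0, h x) := by
  obtain ⟨g, h, hg, hh, hform⟩ := hX.exists_genField hm hI hI' hC htr hne
  have hm' : (m : ℝ) ≠ 0 := by exact_mod_cast hm.ne'
  refine ⟨g + (0, (-(g.2.trace / m)) • 1), ⟨hg.add (isSymm_scalar _), ?_⟩, g.2.trace / m, h, hh,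
    fun x hx y => ?_⟩
  · simp only [Prod.snd_add, Matrix.trace_add, Matrix.trace_smul, Matrix.trace_one,
      Fintype.card_fin, smul_eq_mul]
    field_simp
    ring
  · rw [hform x hx y]
    congr 2
    refine Prod.ext (by simp) ?_
    simp only [Prod.snd_add]
    module

/-- The symmetry `b ∂ₓ + ⋯` on `I` and the field `β ∂ₓ + ⋯` with the same matrix `B` correspond to
each other under the transformation that straightens `c` over `J`: `b = β(φ) c`, and
`β` is constant unless the discriminant of `c` vanishes, as in `IsSymm.straighten`. -/
def Corresponds (I J : Set ℝ) (C : ℝ → Matrix (Fin m) (Fin m) ℝ) (c : ℝ × ℝ × ℝ) (φ : ℝ → ℝ)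
    (b β : ℝ × ℝ × ℝ) (B : Matrix (Fin m) (Fin m) ℝ) : Prop :=
  (b, B) ∈ tracelessSymm I C (deriv C) ∧ (∀ x ∈ J, quad b x = quad β (φ x) * quad c x) ∧
    ∀ x, (c.2.1 ^ 2 - 4 * c.1 * c.2.2) * quadDeriv β x = 0

theorem exists_corresponds_of_mem_span {I J : Set ℝ} {C : ℝ → Matrix (Fin m) (Fin m) ℝ}
    {c : ℝ × ℝ × ℝ} {φ : ℝ → ℝ} {s : Set (PointField m)}
    (hs : ∀ Z ∈ s, ∃ b β B, Corresponds I J C c φ b β B ∧ Z = genField (β, B))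
    {Z : PointField m} (hZ : Z ∈ Submodule.span ℝ s) :
    ∃ b β B, Corresponds I J C c φ b β B ∧ Z = genField (β, B) := by
  induction hZ using Submodule.span_induction with
  | mem Z hZ => exact hs Z hZ
  | zero =>
    refine ⟨0, 0, 0, ⟨(tracelessSymm I C (deriv C)).zero_mem, by simp [quad],
      by simp [quadDeriv]⟩, ?_⟩
    exact (show (0 : PointField m) = genField 0 by simpa using (genField_smul (m := m) 0 0).symm)
  | add Z Z' _ _ h h' =>
    obtain ⟨b, β, B, ⟨h1, h2, h3⟩, rfl⟩ := h
    obtain ⟨b', β', B', ⟨h1', h2', h3'⟩, rfl⟩ := h'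
    refine ⟨b + b', β + β', B + B', ⟨(tracelessSymm I C (deriv C)).add_mem h1 h1',
      fun x hx => ?_, fun x => ?_⟩, (genField_add (β, B) (β', B')).symm⟩
    · rw [quad_add, quad_add, h2 x hx, h2' x hx]; ring
    · rw [quadDeriv_add]; linear_combination h3 x + h3' x
  | smul r Z _ h =>
    obtain ⟨b, β, B, ⟨h1, h2, h3⟩, rfl⟩ := h
    refine ⟨r • b, r • β, r • B, ⟨(tracelessSymm I C (deriv C)).smul_mem r h1,
      fun x hx => ?_, fun x => ?_⟩, (genField_smul r (β, B)).symm⟩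
    · rw [quad_smul, quad_smul, h2 x hx]; ring
    · rw [quadDeriv_smul]; linear_combination r * h3 x

theorem eq_of_quad_eqOn {U : Set ℝ} (hU : IsOpen U) (hne : U.Nonempty) {c c' : ℝ × ℝ × ℝ}
    (h : ∀ x ∈ U, quad c x = quad c' x) : c = c' := by
  by_contra hcc
  obtain ⟨x, hx⟩ := hne
  obtain ⟨t, ht, htU⟩ := ((frequently_quad_ne_zero (sub_ne_zero.2 hcc) x).and_eventually
    (hU.mem_nhds hx)).exists
  refine ht ?_
  have e : c - c' = c + (-1 : ℝ) • c' := by module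
  rw [e, quad_add, quad_smul, h t htU]
  ring

/-- If `L` consists of fields that correspond to symmetries, and every symmetry has its
corresponding field in `L`, then the straightening transformation normalizes the system to `L`. In
particular `L` is closed under the Lie bracket, since the symmetries are. -/
theorem normalizesTo_straighten (hm : 0 < m) {I J : Set ℝ} (hI : IsOpen I)
    (hI' : I.OrdConnected) (hJ : IsOpen J) (hJ' : J.OrdConnected) (hJne : J.Nonempty)
    (hJI : J ⊆ I) {C : ℝ → Matrix (Fin m) (Fin m) ℝ} (hC : ContDiffOn ℝ ∞ C I)
    (htr : ∀ x ∈ I, (C x).trace = 0) (hne : ∃ x ∈ I, C x ≠ 0)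
    {c : ℝ × ℝ × ℝ} (hc : ∀ x ∈ J, quad c x ≠ 0) {φ : ℝ → ℝ}
    (hφ : ∀ x ∈ J, HasDerivAt φ (quad c x)⁻¹ x) {L : Submodule ℝ (PointField m)}
    (hL : ∀ Z ∈ L, ∃ b β B, Corresponds I J C c φ b β B ∧ Z = genField (β, B))
    (hL' : ∀ g ∈ tracelessSymm I C (deriv C), ∃ β, genField (β, g.2) ∈ L ∧
      ∀ x ∈ J, quad g.1 x = quad β (φ x) * quad c x) :
    NormalizesTo I (straighten m hJ hc hφ) C (straightMatrix J c φ C) L := by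
  have hder := hC.hasDerivAt_deriv hI
  have hderJ : ∀ x ∈ J, HasDerivAt C (deriv C x) x := fun x hx => hder x (hJI hx)
  have hopen := isOpen_image_of_hasDerivAt_inv_quad hJ hc hφ
  have hcarries := straighten_carries hJ hJ' hc hφ C
  refine ⟨hcarries, ⟨fun Z hZ => ?_, fun Z hZ Z' hZ' => ?_⟩, fun Z hZ => ?_, fun Y hY => ?_⟩
  · obtain ⟨b, β, B, ⟨h1, h2, h3⟩, rfl⟩ := hL Z hZ
    refine (admits_genField_iff hopen (hasDerivAt_straightMatrix hJ hJ' hc hφ hderJ) _).2 ?_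
    exact IsSymm.straighten hJ' hc hφ h2 (quadDeriv_eq_of_quad_eq hJ hc hφ h2) h3
      fun x hx => h1.1 x (hJI hx)
  · obtain ⟨b, β, B, ⟨h1, h2, h3⟩, rfl⟩ := hL Z hZ
    obtain ⟨b', β', B', ⟨h1', h2', h3'⟩, rfl⟩ := hL Z' hZ'
    obtain ⟨γ, hγ, hγ'⟩ := hL' _ (quadBracket_mem_tracelessSymm hI hC h1 h1')
    have e : γ = quadBracket β β' := by
      refine eq_of_quad_eqOn hopen (hJne.image φ) ?_
      rintro _ ⟨x, hx, rfl⟩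
      have h4 := hγ' x hx
      rw [quad_quadBracket, h2 x hx, h2' x hx, quadDeriv_eq_of_quad_eq hJ hc hφ h2 x hx,
        quadDeriv_eq_of_quad_eq hJ hc hφ h2' x hx] at h4
      rw [quad_quadBracket]
      refine mul_right_cancel₀ (hc x hx) ?_
      rw [← h4]
      ring
    rw [lieBracket_genField, ← e]
    exact hγ
  · obtain ⟨b, β, B, ⟨h1, h2, -⟩, rfl⟩ := hL Z hZ
    exact ⟨genField (b, B), (admits_genField_iff hI hder _).2 h1.1,
      straighten_pushes hJ hc hφ (B := B) h2 (h := 0) (k := 0) (by simp) (by simp) (by simp)⟩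
  · obtain ⟨g, hg, r, h, hh, hform⟩ := hY.exists_tracelessSymm hm hI hI' hC htr hne
    obtain ⟨β, hβ, hβ'⟩ := hL' g hg
    set k : ℝ → Fin m → ℝ := fun t =>
      multiplier c (Function.invFunOn φ J t) • h (Function.invFunOn φ J t) with hk
    have hkφ : ∀ x ∈ J, k (φ x) = multiplier c x • h x := by
      intro x hx
      simp only [hk, (injOn_of_hasDerivAt_inv_quad hJ' hc hφ).leftInvOn_invFunOn hx]
    have hksol : IsSolution (φ '' J) (straightMatrix J c φ C) k := by
      refine (hcarries h k fun x hx => ?_).1 ?_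
      · simpa [straighten, EquivTransf.toMap] using hkφ x hx
      · obtain ⟨w, hw⟩ := hh
        exact ⟨w, fun x hx => hw x (hJI hx)⟩
    refine ⟨genField (β, g.2), hβ, fun z => (0, r • z.2 + k z.1), ⟨r, k, hksol, by simp⟩, ?_⟩
    refine straighten_pushes hJ hc hφ (b := g.1) (β := β) (B := g.2 + r • 1) hβ' hkφ
      (fun x hx y => hform x (hJI hx) y) fun x hx y => ?_
    refine Prod.ext ?_ ?_
    · simp [genField]
    · simp only [genField, Pi.add_apply, Prod.snd_add, Matrix.add_mulVec, Matrix.smul_mulVec,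
        Matrix.one_mulVec]
      abel

theorem exists_interval {I : Set ℝ} (hI : IsOpen I) {c : ℝ × ℝ × ℝ} {x₀ : ℝ} (hx₀ : x₀ ∈ I)
    (hc : quad c x₀ ≠ 0) :
    ∃ J : Set ℝ, IsOpen J ∧ J.OrdConnected ∧ J ⊆ I ∧ x₀ ∈ J ∧ ∀ x ∈ J, quad c x ≠ 0 := by
  have h1 : ∀ᶠ x in nhds x₀, x ∈ I ∧ quad c x ≠ 0 :=
    Filter.Eventually.and (hI.mem_nhds hx₀)
      ((hasDerivAt_quad c x₀).continuousAt.eventually_ne hc)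
  obtain ⟨ε, hε, hball⟩ := Metric.eventually_nhds_iff_ball.1 h1
  exact ⟨Metric.ball x₀ ε, Metric.isOpen_ball, (convex_ball x₀ ε).ordConnected,
    fun x hx => (hball x hx).1, Metric.mem_ball_self hε, fun x hx => (hball x hx).2⟩

/-- If all symmetries are multiples of one, that one is straightened over an interval without zeros
of its polynomial. -/
theorem normalForm_line (hm : Odd m) {I : Set ℝ} (hI : IsOpen I) (hI' : I.OrdConnected)
    {C : ℝ → Matrix (Fin m) (Fin m) ℝ} (hC : ContDiffOn ℝ ∞ C I)
    (htr : ∀ x ∈ I, (C x).trace = 0) (hne : ∃ x ∈ I, C x ≠ 0) (hsub : ¬ ReducesToSubsystem I C)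
    (hred : ¬ ReducesToConstant I C) {c : ℝ × ℝ × ℝ} {A : Matrix (Fin m) (Fin m) ℝ}
    (hA : (c, A) ∈ tracelessSymm I C (deriv C)) (hc0 : c ≠ 0)
    (hall : ∀ g ∈ tracelessSymm I C (deriv C), ∃ r : ℝ, g.1 = r • c) :
    ∃ J : Set ℝ, IsOpen J ∧ J.OrdConnected ∧ J.Nonempty ∧ J ⊆ I ∧
      ∃ (T : EquivTransf m J) (C' : ℝ → Matrix (Fin m) (Fin m) ℝ)
        (A C₀ : Matrix (Fin m) (Fin m) ℝ), CaseA (T.φ '' J) C' A C₀ ∧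
          NormalizesTo I T C C' (Submodule.span ℝ {genX₃ m + genXA A}) := by
  have hder := hC.hasDerivAt_deriv hI
  obtain ⟨x₀, hx₀, hcx₀, hncomm⟩ := exists_not_commute hI hI' hder hred hA.1 hc0
  obtain ⟨J, hJ, hJ', hJI, hxJ, hcJ⟩ := exists_interval hI hx₀ hcx₀
  obtain ⟨φ, hφ⟩ := exists_hasDerivAt_inv_quad hJ hJ' hcJ
  obtain ⟨C₀, hC₀⟩ := caseA_of_isSymm hJ hJ' (fun x hx => hder x (hJI hx))
    (g := (c, A)) (fun x hx => hA.1 x (hJI hx)) hcJ hφ hxJ hncomm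
  refine ⟨J, hJ, hJ', ⟨x₀, hxJ⟩, hJI, straighten m hJ hcJ hφ, straightMatrix J c φ C,
    A, C₀, hC₀, ?_⟩
  rw [genX₃_add_genXA]
  refine normalizesTo_straighten hm.pos hI hI' hJ hJ' ⟨x₀, hxJ⟩ hJI hC htr hne hcJ hφ
    (fun Z hZ => exists_corresponds_of_mem_span ?_ hZ) fun g hg => ?_
  · rintro _ rfl
    exact ⟨c, (1, 0, 0), A, ⟨hA, by simp [quad], by simp [quadDeriv]⟩, rfl⟩
  · obtain ⟨r, hr⟩ := hall g hg
    have h2 : g.2 = r • A :=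
      tracelessSymm_ext hm hI hsub hg (Submodule.smul_mem _ r hA) hr
    refine ⟨r • (1, 0, 0), ?_, fun x _ => ?_⟩
    · rw [h2]
      change genField (r • ((1, 0, 0), A)) ∈ _
      rw [genField_smul]
      exact Submodule.smul_mem _ _ (Submodule.subset_span rfl)
    · rw [hr, quad_smul, quad_smul]
      simp [quad]

/-- If the polynomials of the symmetries have exactly one common root, finite or infinite, the one
for which it is a double root is straightened. Its discriminant vanishes, so the second symmetry
becomes a symmetry of the new system, with polynomial `2x`. -/
theorem normalForm_plane (hm : Odd m) {I : Set ℝ} (hI : IsOpen I) (hI' : I.OrdConnected)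
    {C : ℝ → Matrix (Fin m) (Fin m) ℝ} (hC : ContDiffOn ℝ ∞ C I)
    (htr : ∀ x ∈ I, (C x).trace = 0) (hne : ∃ x ∈ I, C x ≠ 0) (hsub : ¬ ReducesToSubsystem I C)
    (hred : ¬ ReducesToConstant I C) {e₂ e₃ : ℝ × ℝ × ℝ} {A₂ A₃ : Matrix (Fin m) (Fin m) ℝ}
    (h₂ : (e₂, A₂) ∈ tracelessSymm I C (deriv C)) (h₃ : (e₃, A₃) ∈ tracelessSymm I C (deriv C))
    (he : (e₃ = (1, 0, 0) ∧ e₂ = (0, 2, 0)) ∨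
      ∃ r : ℝ, e₃ = (r ^ 2, -2 * r, 1) ∧ e₂ = (2 * r, -2, 0))
    (hall : ∀ g ∈ tracelessSymm I C (deriv C), ∃ s t : ℝ, g.1 = s • e₂ + t • e₃) :
    ∃ J : Set ℝ, IsOpen J ∧ J.OrdConnected ∧ J.Nonempty ∧ J ⊆ I ∧
      ∃ (T : EquivTransf m J) (C' : ℝ → Matrix (Fin m) (Fin m) ℝ)
        (A₂ A₃ C₀ : Matrix (Fin m) (Fin m) ℝ), CaseB (T.φ '' J) C' A₂ A₃ C₀ ∧
          NormalizesTo I T C C'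
            (Submodule.span ℝ {genX₂ m + genXA A₂, genX₃ m + genXA A₃}) := by
  have hder := hC.hasDerivAt_deriv hI
  have he30 : e₃ ≠ 0 := by
    rcases he with ⟨rfl, -⟩ | ⟨r, rfl, -⟩ <;> simp
  have hdisc : e₃.2.1 ^ 2 - 4 * e₃.1 * e₃.2.2 = 0 := by
    rcases he with ⟨rfl, -⟩ | ⟨r, rfl, -⟩
    · simp
    · ring
  have hbr : quadBracket e₂ e₃ = (-2 : ℝ) • e₃ := by
    rcases he with ⟨rfl, rfl⟩ | ⟨r, rfl, rfl⟩ <;>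
      refine Prod.ext ?_ (Prod.ext ?_ ?_) <;> (norm_num [quadBracket]; try ring)
  -- a double root of `e₃` is moved to infinity by `φ = -1/(x - r)`
  obtain ⟨φ, hφ, hφ2⟩ : ∃ φ : ℝ → ℝ, (∀ x, quad e₃ x ≠ 0 → HasDerivAt φ (quad e₃ x)⁻¹ x) ∧
      ∀ x, quad e₃ x ≠ 0 → quad e₂ x = 2 * φ x * quad e₃ x := by
    rcases he with ⟨rfl, rfl⟩ | ⟨r, rfl, rfl⟩
    · refine ⟨id, fun x _ => (hasDerivAt_id x).congr_deriv ?_, fun x _ => ?_⟩ <;> simp [quad]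
    · have hsq : ∀ x, quad (r ^ 2, -2 * r, 1) x = (x - r) ^ 2 := fun x => by
        simp only [quad]; ring
      refine ⟨fun x => -(x - r)⁻¹, fun x hx => ?_, fun x hx => ?_⟩
      · rw [hsq] at hx ⊢
        have hx' : x - r ≠ 0 := fun h => hx (by rw [h]; ring)
        refine ((((hasDerivAt_id x).sub_const r).inv hx').neg).congr_deriv ?_
        simp only [id_eq]
        field_simp
      · rw [hsq] at hx ⊢
        have hx' : x - r ≠ 0 := fun h => hx (by rw [h]; ring)
        simp only [quad]
        field_simp
        ring
  have h23 : A₂ * A₃ - A₃ * A₂ = (2 : ℝ) • A₃ := by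
    have h1 : A₃ * A₂ - A₂ * A₃ = (-2 : ℝ) • A₃ :=
      tracelessSymm_ext hm hI hsub (quadBracket_mem_tracelessSymm hI hC h₂ h₃)
        (Submodule.smul_mem _ (-2 : ℝ) h₃) hbr
    linear_combination (norm := module) -h1
  obtain ⟨x₀, hx₀, hcx₀, hncomm⟩ := exists_not_commute hI hI' hder hred h₃.1 he30
  obtain ⟨J, hJ, hJ', hJI, hxJ, hcJ⟩ := exists_interval hI hx₀ hcx₀
  have hφJ : ∀ x ∈ J, HasDerivAt φ (quad e₃ x)⁻¹ x := fun x hx => hφ x (hcJ x hx)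
  have hb2 : ∀ x ∈ J, quad e₂ x = quad (0, 2, 0) (φ x) * quad e₃ x := fun x hx => by
    rw [hφ2 x (hcJ x hx)]; simp [quad]
  have hs2 : IsSymm (φ '' J) (straightMatrix J e₃ φ C) (straightMatrixDeriv J e₃ φ C (deriv C))
      ((0, 2, 0), A₂) :=
    IsSymm.straighten hJ' hcJ hφJ hb2 (quadDeriv_eq_of_quad_eq hJ hcJ hφJ hb2)
      (fun x => by rw [hdisc, zero_mul]) (fun x hx => h₂.1 x (hJI hx))
  obtain ⟨C₀, hC₀⟩ := caseB_of_isSymm (ordConnected_image_of_hasDerivAt_inv_quad hJ' hφJ)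
    (hasDerivAt_straightMatrix hJ hJ' hcJ hφJ fun x hx => hder x (hJI hx)) hs2
    (isSymm_straightMatrix hJ' (g := (e₃, A₃)) (fun x hx => h₃.1 x (hJI hx)) hcJ hφJ) h23
    (by
      rintro _ ⟨x, hx, rfl⟩
      rw [straightMatrix_apply hJ' hcJ hφJ C hx, hdisc]
      simp [htr x (hJI hx)])
    ⟨x₀, hxJ, rfl⟩
    (fun h => hncomm ((mul_straightMatrix_comm_iff hJ' hcJ hφJ C A₃ hxJ).1 h))
  refine ⟨J, hJ, hJ', ⟨x₀, hxJ⟩, hJI, straighten m hJ hcJ hφJ, straightMatrix J e₃ φ C,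
    A₂, A₃, C₀, hC₀, ?_⟩
  rw [genX₂_add_genXA, genX₃_add_genXA]
  refine normalizesTo_straighten hm.pos hI hI' hJ hJ' ⟨x₀, hxJ⟩ hJI hC htr hne hcJ hφJ
    (fun Z hZ => exists_corresponds_of_mem_span ?_ hZ) fun g hg => ?_
  · rintro _ (rfl | rfl)
    · exact ⟨e₂, (0, 2, 0), A₂, ⟨h₂, hb2, fun x => by rw [hdisc, zero_mul]⟩, rfl⟩
    · exact ⟨e₃, (1, 0, 0), A₃, ⟨h₃, by simp [quad], by simp [quadDeriv]⟩, rfl⟩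
  · obtain ⟨s, t, hst⟩ := hall g hg
    have h2 : g.2 = s • A₂ + t • A₃ :=
      tracelessSymm_ext hm hI hsub hg (Submodule.add_mem _ (Submodule.smul_mem _ s h₂)
        (Submodule.smul_mem _ t h₃)) hst
    refine ⟨s • (0, 2, 0) + t • (1, 0, 0), ?_, fun x hx => ?_⟩
    · rw [h2]
      change genField (s • ((0, 2, 0), A₂) + t • ((1, 0, 0), A₃)) ∈ _
      rw [genField_add, genField_smul, genField_smul]
      exact Submodule.add_mem _ (Submodule.smul_mem _ _ (Submodule.subset_span (by simp)))
        (Submodule.smul_mem _ _ (Submodule.subset_span (by simp)))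
    · rw [hst, quad_add, quad_add, quad_smul, quad_smul, quad_smul, quad_smul, hb2 x hx]
      simp only [quad]
      ring

/-- If all quadratic polynomials occur, the system is already in normal form over the whole of `I`;
`straighten` is here the identity. -/
theorem normalForm_full (hm : Odd m) {I : Set ℝ} (hI : IsOpen I) (hI' : I.OrdConnected)
    {C : ℝ → Matrix (Fin m) (Fin m) ℝ} (hC : ContDiffOn ℝ ∞ C I)
    (htr : ∀ x ∈ I, (C x).trace = 0) (hne : ∃ x ∈ I, C x ≠ 0) (hsub : ¬ ReducesToSubsystem I C)
    (hred : ¬ ReducesToConstant I C) {A₁ A₂ A₃ : Matrix (Fin m) (Fin m) ℝ}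
    (h₁ : ((0, 0, 1), A₁) ∈ tracelessSymm I C (deriv C))
    (h₂ : ((0, 2, 0), A₂) ∈ tracelessSymm I C (deriv C))
    (h₃ : ((1, 0, 0), A₃) ∈ tracelessSymm I C (deriv C)) :
    ∃ J : Set ℝ, IsOpen J ∧ J.OrdConnected ∧ J.Nonempty ∧ J ⊆ I ∧
      ∃ (T : EquivTransf m J) (C' : ℝ → Matrix (Fin m) (Fin m) ℝ)
        (A₁ A₂ A₃ C₀ : Matrix (Fin m) (Fin m) ℝ), CaseC (T.φ '' J) C' A₁ A₂ A₃ C₀ ∧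
          NormalizesTo I T C C'
            (Submodule.span ℝ
              {genX₁ m + genXA A₁, genX₂ m + genXA A₂, genX₃ m + genXA A₃}) := by
  have hder := hC.hasDerivAt_deriv hI
  have hc : ∀ x ∈ I, quad (1, 0, 0) x ≠ 0 := fun x _ => by simp [quad]
  have hφ : ∀ x ∈ I, HasDerivAt id (quad (1, 0, 0) x)⁻¹ x := fun x _ =>
    (hasDerivAt_id x).congr_deriv (by simp [quad])
  have hC' : ∀ x ∈ id '' I, straightMatrix I (1, 0, 0) id C x = C x := by
    rintro _ ⟨x, hx, rfl⟩
    rw [straightMatrix_apply hI' hc hφ C hx]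
    simp [quad]
  have h12 : A₁ * A₂ - A₂ * A₁ = (2 : ℝ) • A₁ := by
    have h : A₂ * A₁ - A₁ * A₂ = (-2 : ℝ) • A₁ :=
      tracelessSymm_ext hm hI hsub (quadBracket_mem_tracelessSymm hI hC h₁ h₂)
        (Submodule.smul_mem _ (-2 : ℝ) h₁) (by simp [quadBracket])
    linear_combination (norm := module) -h
  have h13 : A₁ * A₃ - A₃ * A₁ = A₂ := by
    have h : A₃ * A₁ - A₁ * A₃ = (-1 : ℝ) • A₂ :=
      tracelessSymm_ext hm hI hsub (quadBracket_mem_tracelessSymm hI hC h₁ h₃)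
        (Submodule.smul_mem _ (-1 : ℝ) h₂) (by simp [quadBracket])
    linear_combination (norm := module) -h
  have h23 : A₂ * A₃ - A₃ * A₂ = (2 : ℝ) • A₃ := by
    have h : A₃ * A₂ - A₂ * A₃ = (-2 : ℝ) • A₃ :=
      tracelessSymm_ext hm hI hsub (quadBracket_mem_tracelessSymm hI hC h₂ h₃)
        (Submodule.smul_mem _ (-2 : ℝ) h₃) (by simp [quadBracket])
    linear_combination (norm := module) -h
  obtain ⟨x₀, hx₀, -, hncomm⟩ := exists_not_commute hI hI' hder hred h₃.1 (by simp)
  obtain ⟨C₀, hexp, hrel⟩ := caseC_of_isSymm hI' hder h₁.1 h₂.1 h₃.1 h12 h13 h23 htr hx₀ hncomm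
  refine ⟨I, hI, hI', ⟨x₀, hx₀⟩, subset_rfl, straighten m hI hc hφ,
    straightMatrix I (1, 0, 0) id C, A₁, A₂, A₃, C₀, ⟨fun x hx => ?_, hrel⟩, ?_⟩
  · rw [hC' x hx]
    exact hexp x (by simpa [straighten] using hx)
  rw [genX₁_add_genXA, genX₂_add_genXA, genX₃_add_genXA]
  refine normalizesTo_straighten hm.pos hI hI' hI hI' ⟨x₀, hx₀⟩ subset_rfl hC htr hne hc hφ
    (fun Z hZ => exists_corresponds_of_mem_span ?_ hZ) fun g hg => ?_
  · rintro _ (rfl | rfl | rfl)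
    · exact ⟨_, (0, 0, 1), A₁, ⟨h₁, by simp [quad], by simp⟩, rfl⟩
    · exact ⟨_, (0, 2, 0), A₂, ⟨h₂, by simp [quad], by simp⟩, rfl⟩
    · exact ⟨_, (1, 0, 0), A₃, ⟨h₃, by simp [quad], by simp⟩, rfl⟩
  · have h1 : g.1 = g.1.2.2 • (0, 0, 1) + (g.1.2.1 / 2) • (0, 2, 0) + g.1.1 • (1, 0, 0) := by
      refine Prod.ext ?_ (Prod.ext ?_ ?_) <;> simp
    have h2 : g.2 = g.1.2.2 • A₁ + (g.1.2.1 / 2) • A₂ + g.1.1 • A₃ :=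
      tracelessSymm_ext hm hI hsub hg (Submodule.add_mem _ (Submodule.add_mem _
        (Submodule.smul_mem _ g.1.2.2 h₁) (Submodule.smul_mem _ (g.1.2.1 / 2) h₂))
        (Submodule.smul_mem _ g.1.1 h₃)) h1
    refine ⟨g.1, ?_, by simp [quad]⟩
    have h3 : g = g.1.2.2 • ((0, 0, 1), A₁) + (g.1.2.1 / 2) • ((0, 2, 0), A₂) +
        g.1.1 • ((1, 0, 0), A₃) := Prod.ext h1 h2
    change genField g ∈ _
    rw [h3, genField_add, genField_add, genField_smul, genField_smul, genField_smul]
    exact Submodule.add_mem _ (Submodule.add_mem _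
      (Submodule.smul_mem _ _ (Submodule.subset_span (by simp)))
      (Submodule.smul_mem _ _ (Submodule.subset_span (by simp))))
      (Submodule.smul_mem _ _ (Submodule.subset_span (by simp)))

theorem exists_normalForm (hm : Odd m) {I : Set ℝ} (hI : IsOpen I) (hI' : I.OrdConnected)
    {C : ℝ → Matrix (Fin m) (Fin m) ℝ} (hC : ContDiffOn ℝ ∞ C I)
    (htr : ∀ x ∈ I, (C x).trace = 0) (hirr : IsIrreducibleSystem I C)
    (hX : ∃ X : PointField m, Admits I C X ∧ ¬ IsTrivialGenerator I C X) :
    ∃ J : Set ℝ, IsOpen J ∧ J.OrdConnected ∧ J.Nonempty ∧ J ⊆ I ∧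
      ∃ (T : EquivTransf m J) (C' : ℝ → Matrix (Fin m) (Fin m) ℝ),
        (∃ A C₀ : Matrix (Fin m) (Fin m) ℝ, CaseA (T.φ '' J) C' A C₀ ∧
          NormalizesTo I T C C' (Submodule.span ℝ {genX₃ m + genXA A})) ∨
        (∃ A₂ A₃ C₀ : Matrix (Fin m) (Fin m) ℝ, CaseB (T.φ '' J) C' A₂ A₃ C₀ ∧
          NormalizesTo I T C C'
            (Submodule.span ℝ {genX₂ m + genXA A₂, genX₃ m + genXA A₃})) ∨
        (∃ A₁ A₂ A₃ C₀ : Matrix (Fin m) (Fin m) ℝ, CaseC (T.φ '' J) C' A₁ A₂ A₃ C₀ ∧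
          NormalizesTo I T C C'
            (Submodule.span ℝ
              {genX₁ m + genXA A₁, genX₂ m + genXA A₂, genX₃ m + genXA A₃})) := by
  obtain ⟨hsub, hred⟩ := hirr
  have hne : ∃ x ∈ I, C x ≠ 0 := by
    by_contra! h
    exact hred (reducesToConstant_of_eq_zero hI hI' h)
  -- the projection of the symmetries to the quadratic polynomials
  obtain ⟨V, hVmem⟩ : ∃ V : Submodule ℝ (ℝ × ℝ × ℝ),
      ∀ c, c ∈ V ↔ ∃ A, (c, A) ∈ tracelessSymm I C (deriv C) :=
    ⟨(tracelessSymm I C (deriv C)).map (LinearMap.fst ℝ _ _), fun c => by simp⟩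
  have hVbr : ∀ a ∈ V, ∀ b ∈ V, quadBracket a b ∈ V := by
    intro a ha b hb
    obtain ⟨A, hA⟩ := (hVmem a).1 ha
    obtain ⟨B, hB⟩ := (hVmem b).1 hb
    have hAB := quadBracket_mem_tracelessSymm hI hC hA hB
    dsimp only at hAB
    exact (hVmem (quadBracket a b)).2 ⟨B * A - A * B, hAB⟩
  have hVne : V ≠ ⊥ := by
    intro hbot
    obtain ⟨X, hadm, htriv⟩ := hX
    obtain ⟨g, hg, r, h, hh, hform⟩ := hadm.exists_tracelessSymm hm.pos hI hI' hC htr hne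
    have h1 : g.1 ∈ V := (hVmem _).2 ⟨g.2, hg⟩
    rw [hbot, Submodule.mem_bot] at h1
    have h2 : g.2 = 0 := tracelessSymm_ext hm hI hsub hg (Submodule.zero_mem _) h1
    refine htriv ⟨r, h, hh, fun x hx y => ?_⟩
    rw [hform x hx y, h1, h2]
    simp [genField, quad, quadDeriv, Matrix.smul_mulVec]
  rcases quadBracket_subalgebra_classification V hVne hVbr with
    ⟨c, hcV, hc0, hall⟩ | ⟨e₂, he₂, e₃, he₃, hform, hall⟩ | rfl
  · obtain ⟨A, hA⟩ := (hVmem c).1 hcV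
    obtain ⟨J, hJ, hJ', hJne, hJI, T, C', h⟩ := normalForm_line hm hI hI' hC htr hne hsub hred hA
      hc0 fun g hg => hall _ ((hVmem _).2 ⟨g.2, hg⟩)
    exact ⟨J, hJ, hJ', hJne, hJI, T, C', Or.inl h⟩
  · obtain ⟨A₂, hA₂⟩ := (hVmem _).1 he₂
    obtain ⟨A₃, hA₃⟩ := (hVmem _).1 he₃
    obtain ⟨J, hJ, hJ', hJne, hJI, T, C', h⟩ := normalForm_plane hm hI hI' hC htr hne hsub hred
      hA₂ hA₃ hform fun g hg => hall _ ((hVmem _).2 ⟨g.2, hg⟩)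
    exact ⟨J, hJ, hJ', hJne, hJI, T, C', Or.inr (Or.inl h)⟩
  · obtain ⟨A₁, hA₁⟩ := (hVmem (0, 0, 1)).1 trivial
    obtain ⟨A₂, hA₂⟩ := (hVmem (0, 2, 0)).1 trivial
    obtain ⟨A₃, hA₃⟩ := (hVmem (1, 0, 0)).1 trivial
    obtain ⟨J, hJ, hJ', hJne, hJI, T, C', h⟩ := normalForm_full hm hI hI' hC htr hne hsub hred
      hA₁ hA₂ hA₃
    exact ⟨J, hJ, hJ', hJne, hJI, T, C', Or.inr (Or.inr h)⟩

end

theorem mainTheorem1 (m : ℕ) (I : Set ℝ) (hIopen : IsOpen I) (hIconn : I.OrdConnected)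
    (hIne : I.Nonempty) (C : ℝ → Matrix (Fin m) (Fin m) ℝ)
    (hC : ∀ i j, ContDiffOn ℝ ∞ (fun x => C x i j) I)
    (htr : ∀ x ∈ I, (C x).trace = 0) :
    (¬ ReducesToConstant I C →
      -- (a) one-dimensional Lie algebras
      (∀ (A : Matrix (Fin m) (Fin m) ℝ) (X : PointField m),
        (X = genX₂ m + genXA A ∨ X = genX₃ m + genXA A ∨ X = genX₁ m + genX₃ m + genXA A) →
        AdmitsLieAlgebra I C (Submodule.span ℝ {X}) →
        ∀ J : Set ℝ, IsOpen J → J.OrdConnected → J.Nonempty → J ⊆ I →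
          (∀ x ∈ J, ∀ y, (X (x, y)).1 ≠ 0) →
          ∃ (T : EquivTransf m J) (C' : ℝ → Matrix (Fin m) (Fin m) ℝ)
            (A' C₀ : Matrix (Fin m) (Fin m) ℝ),
            T.Carries C C' ∧ CaseA (T.φ '' J) C' A' C₀ ∧
              T.Pushes X (genX₃ m + genXA A') ∧
              Admits (T.φ '' J) C' (genX₃ m + genXA A')) ∧
      -- (b) two-dimensional Lie algebras
      (∀ A₂ A₃ : Matrix (Fin m) (Fin m) ℝ,
        AdmitsLieAlgebra I C (Submodule.span ℝ {genX₂ m + genXA A₂, genX₃ m + genXA A₃}) →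
        ∃ C₀ : Matrix (Fin m) (Fin m) ℝ, CaseB I C A₂ A₃ C₀) ∧
      -- (c) three-dimensional Lie algebras
      (∀ A₁ A₂ A₃ : Matrix (Fin m) (Fin m) ℝ,
        AdmitsLieAlgebra I C
          (Submodule.span ℝ {genX₁ m + genXA A₁, genX₂ m + genXA A₂, genX₃ m + genXA A₃}) →
        ∃ C₀ : Matrix (Fin m) (Fin m) ℝ, CaseC I C A₁ A₂ A₃ C₀)) ∧
    -- odd number of dependent variables
    (IsIrreducibleSystem I C → Odd m →
      (∃ X : PointField m, Admits I C X ∧ ¬ IsTrivialGenerator I C X) →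
      ∃ J : Set ℝ, IsOpen J ∧ J.OrdConnected ∧ J.Nonempty ∧ J ⊆ I ∧
        ∃ (T : EquivTransf m J) (C' : ℝ → Matrix (Fin m) (Fin m) ℝ),
          (∃ A C₀ : Matrix (Fin m) (Fin m) ℝ, CaseA (T.φ '' J) C' A C₀ ∧
            NormalizesTo I T C C' (Submodule.span ℝ {genX₃ m + genXA A})) ∨
          (∃ A₂ A₃ C₀ : Matrix (Fin m) (Fin m) ℝ, CaseB (T.φ '' J) C' A₂ A₃ C₀ ∧
            NormalizesTo I T C C'
              (Submodule.span ℝ {genX₂ m + genXA A₂, genX₃ m + genXA A₃})) ∨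
          (∃ A₁ A₂ A₃ C₀ : Matrix (Fin m) (Fin m) ℝ, CaseC (T.φ '' J) C' A₁ A₂ A₃ C₀ ∧
            NormalizesTo I T C C'
              (Submodule.span ℝ
                {genX₁ m + genXA A₁, genX₂ m + genXA A₂, genX₃ m + genXA A₃}))) := by
  have hCs := contDiffOn_matrix_of_entries hC
  refine ⟨fun hred => ⟨?_, ?_, ?_⟩, ?_⟩
  · intro A X hX hL J hJ hJ' hJne hJI hnz
    have hadm : Admits I C X := hL.1 X (Submodule.subset_span rfl)
    rcases hX with rfl | rfl | rfl
    · rw [genX₂_add_genXA] at hadm hnz ⊢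
      exact straighten_of_admits hIopen hIconn hJ hJ' hJne hJI hCs hred (Or.inl rfl) hadm
        fun x hx => hnz x hx 0
    · rw [genX₃_add_genXA] at hadm hnz
      rw [genX₃_add_genXA A]
      exact straighten_of_admits hIopen hIconn hJ hJ' hJne hJI hCs hred (Or.inr (Or.inl rfl)) hadm
        fun x hx => hnz x hx 0
    · rw [genX₁_add_genX₃_add_genXA] at hadm hnz ⊢
      exact straighten_of_admits hIopen hIconn hJ hJ' hJne hJI hCs hred (Or.inr (Or.inr rfl)) hadm
        fun x hx => hnz x hx 0
  · exact fun A₂ A₃ h => caseB_of_admitsLieAlgebra hIopen hIconn hCs htr hred h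
  · exact fun A₁ A₂ A₃ h => caseC_of_admitsLieAlgebra hIopen hIconn hCs htr hred h
  · exact fun hirr hm hX => exists_normalForm hm hIopen hIconn hCs htr hirr hX
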